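/- Let $k$ be an algebraically closed field of characteristic $p>0$, let $\mathbf{T}$ be a torus over $k$, and let $\ell\neq p$ be a prime. Regard $\mathbb{F}_\ell,\overline{\mathbb{F}}_\ell$ (discrete) and $\mathbb{Z}_\ell,\mathbb{Q}_\ell$ ($\ell$-adic topology) as condensed rings $S\mapsto C(S,\Lambda)$, and let $\overline{\mathbb{Z}}_\ell=\varinjlim_E\mathcal{O}_E$, $\overline{\mathbb{Q}}_\ell=\varinjlim_E E$ be the filtered colimits, in condensed rings, over the finite extensions $E$ of $\mathbb{Q}_\ell$ in an algebraic closure, with their $\ell$-adic topology. Define condensed rings $\mathrm{R}_{\mathbf{T},\Lambda}$ as follows. 1. For $\Lambda\in\{\mathbb{F}_\ell,\mathbb{Z}_\ell\}$, $\mathrm{R}_{\mathbf{T},\Lambda}$ is the condensed ring attached to the topological ring $\varprojlim_n\Lambda[\mathbf{T}[\ell^n]]$, where $\mathbf{T}[\ell^n]$ is the finite group of $\ell^n$-torsion points of $\mathbf{T}(k)$ and the transition maps are induced by $x\mapsto x^\ell$. 2. $\mathrm{R}_{\mathbf{T},\mathbb{Q}_\ell}=\varprojlim_n\mathrm{R}_{\mathbf{T},\mathbb{Z}_\ell}[\tfrac1\ell]/I^n$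 (in condensed rings), where $I$ is the ideal generated by the kernel of the augmentation $\mathrm{R}_{\mathbf{T},\mathbb{Z}_\ell}\to\mathbb{Z}_\ell$. 3. For $\Lambda_0\in\{\mathbb{F}_\ell,\mathbb{Z}_\ell,\mathbb{Q}_\ell\}$ and $\Lambda=\overline{\Lambda}_0$ the corresponding ring among $\overline{\mathbb{F}}_\ell,\overline{\mathbb{Z}}_\ell,\overline{\mathbb{Q}}_\ell$, $\mathrm{R}_{\mathbf{T},\Lambda}=\mathrm{R}_{\mathbf{T},\Lambda_0}\otimes_{\Lambda_0}\Lambda$ (tensor product of condensed rings). A condensed ring $R$ is called t-admissible if its underlying ring $R(*)$ is regular coherent (every finitely generated ideal is finitely presented, and every finitely presented module has finite projective dimension) and, for every extremally disconnected set $S$, the map $R(*)\to\Gamma(S,R)$ is flat. Then for every $\Lambda\in\{\mathbb{F}_\ell,\mathbb{Z}_\ell,\mathbb{Q}_\ell,\overline{\mathbb{F}}_\ell,\overline{\mathbb{Z}}_\ell,\overline{\mathbb{Q}}_\ell\}$ the condensed rings $\Lambda$ and $\mathrm{R}_{\mathbf{T},\Lambda}$ are t-admissible. -/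

import Mathlib

open CategoryTheory Limits Opposite AlgebraicGeometry

universe u w w'

noncomputable section

/-- Condensed commutative rings. -/
abbrev CondensedCommRing := Condensed.{u} CommRingCat.{u + 1}

/-- A commutative ring is coherent if every finitely generated ideal is finitely presented. -/
def IsCoherentCommRing (A : Type*) [CommRing A] : Prop :=
  ∀ I : Ideal A, I.FG → Module.FinitePresentation A I

/-- A commutative ring is regular coherent if it is coherent and every finitely presented module
has finite projective dimension. -/
def IsRegularCoherent (A : Type u) [CommRing A] : Prop :=
  IsCoherentCommRing A ∧
    ∀ (M : Type u) [AddCommGroup M] [Module A M], Module.FinitePresentation A M →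
      ∃ n : ℕ, HasProjectiveDimensionLE (ModuleCat.of A M) n

namespace CondensedCommRing

/-- The one-point space. -/
abbrev point : CompHaus.{u} := CompHaus.of PUnit.{u + 1}

/-- The underlying ring `R(*)`. -/
abbrev underlying (R : CondensedCommRing.{u}) : CommRingCat.{u + 1} := R.obj.obj (op point)

/-- The ring map `R(*) → Γ(S, R)` given by the projection from `S` to the point. -/
abbrev toSections (R : CondensedCommRing.{u}) (S : CompHaus.{u}) :
    R.underlying →+* R.obj.obj (op S) :=
  (R.obj.map (CompHausLike.ofHom _ (ContinuousMap.const S PUnit.unit) : S ⟶ point).op).hom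

/-- A condensed ring `R` is t-admissible if `R(*)` is regular coherent and `Γ(S, R)` is flat
over `R(*)` for every extremally disconnected `S`. -/
def IsTAdmissible (R : CondensedCommRing.{u}) : Prop :=
  IsRegularCoherent R.underlying ∧ ∀ S : Stonean.{u}, (R.toSections S.compHaus).Flat

/-- The presheaf `S ↦ C(S, A)`. -/
def ofTopPresheaf (A : TopCommRingCat.{u + 1}) : CompHaus.{u}ᵒᵖ ⥤ CommRingCat.{u + 1} where
  obj S := .of C(S.unop, A)
  map f := CommRingCat.ofHom
    { toFun := fun g => g.comp f.unop.hom.hom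
      map_one' := rfl
      map_mul' := fun _ _ => rfl
      map_zero' := rfl
      map_add' := fun _ _ => rfl }

lemma ofTopPresheaf_isSheaf (A : TopCommRingCat.{u + 1}) :
    Presheaf.IsSheaf (coherentTopology CompHaus.{u}) (ofTopPresheaf A) := by
  rw [Presheaf.isSheaf_iff_isSheaf_forget _ _ (forget CommRingCat)]
  exact (TopCat.toCondensedSet.{u} (TopCat.of A)).property

/-- The condensed ring attached to a topological ring. -/
def ofTop : TopCommRingCat.{u + 1} ⥤ CondensedCommRing.{u} where
  obj A := ⟨ofTopPresheaf A, ofTopPresheaf_isSheaf A⟩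
  map {A B} φ := ⟨
    { app := fun S => CommRingCat.ofHom
        { toFun := fun g => (⟨φ.1, φ.2⟩ : C(A, B)).comp g
          map_one' := by ext; exact map_one φ.1
          map_mul' := fun _ _ => by ext; exact map_mul φ.1 _ _
          map_zero' := by ext; exact map_zero φ.1
          map_add' := fun _ _ => by ext; exact map_add φ.1 _ _ } }⟩

end CondensedCommRing

namespace CondensedCommRing

section invert

variable (P : CompHaus.{u}ᵒᵖ ⥤ CommRingCat.{u + 1}) (ℓ : ℕ)

lemma isUnit_invert {R S : Type*} [CommRing R] [CommRing S] (f : R →+* S) :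
    IsUnit (((algebraMap S (Localization.Away (ℓ : S))).comp f) (ℓ : R)) := by
  rw [RingHom.comp_apply, map_natCast]
  exact IsLocalization.Away.algebraMap_isUnit _

/-- The presheaf `S ↦ P(S)[1/ℓ]`. -/
def invert : CompHaus.{u}ᵒᵖ ⥤ CommRingCat.{u + 1} where
  obj S := .of (Localization.Away (ℓ : P.obj S))
  map {S S'} f := CommRingCat.ofHom (Localization.awayLift
    ((algebraMap (P.obj S') (Localization.Away (ℓ : P.obj S'))).comp (P.map f).hom) _
    (isUnit_invert ℓ _))
  map_id S := by
    ext : 1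
    refine IsLocalization.ringHom_ext (Submonoid.powers (ℓ : P.obj S)) ?_
    ext x
    simp [Localization.awayLift]
  map_comp {S S' S''} f g := by
    ext : 1
    refine IsLocalization.ringHom_ext (Submonoid.powers (ℓ : P.obj S)) ?_
    ext x
    simp [Localization.awayLift]

/-- The localization map `P → P[1/ℓ]`. -/
def toInvert : P ⟶ invert P ℓ where
  app S := CommRingCat.ofHom (algebraMap (P.obj S) (Localization.Away (ℓ : P.obj S)))
  naturality S S' f := by
    ext : 1
    exact (IsLocalization.Away.lift_comp (S := Localization.Away (ℓ : P.obj S)) (ℓ : P.obj S)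
      (isUnit_invert ℓ (P.map f).hom)).symm

variable {P} {Q Z : CompHaus.{u}ᵒᵖ ⥤ CommRingCat.{u + 1}}

/-- If `i : Z → Q` exhibits `Q(S)` as `Z(S)[1/ℓ]` for every `S`, then a map `c : Z → P` extends
uniquely to a map `Q → P[1/ℓ]`. -/
def invertLift (i : Z ⟶ Q)
    (hi : ∀ S, @IsLocalization.Away _ _ (ℓ : Z.obj S) (Q.obj S) _ (i.app S).hom.toAlgebra)
    (c : Z ⟶ P) : Q ⟶ invert P ℓ where
  app S := CommRingCat.ofHom <|
    letI := (i.app S).hom.toAlgebra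
    haveI := hi S
    IsLocalization.Away.lift (ℓ : Z.obj S)
      (g := (algebraMap _ (Localization.Away (ℓ : P.obj S))).comp (c.app S).hom)
      (isUnit_invert ℓ _)
  naturality S S' f := by
    let _ := (i.app S).hom.toAlgebra
    have := hi S
    let _ := (i.app S').hom.toAlgebra
    have := hi S'
    ext : 1
    refine IsLocalization.ringHom_ext (Submonoid.powers (ℓ : Z.obj S)) ?_
    ext x
    have h1 : (Q.map f).hom ((i.app S).hom x) = (i.app S').hom ((Z.map f).hom x) :=
      congr($(i.naturality f).hom x).symm
    have h2 : (P.map f).hom ((c.app S).hom x) = (c.app S').hom ((Z.map f).hom x) :=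
      congr($(c.naturality f).hom x).symm
    have h3 : ((invert P ℓ).map f).hom (((toInvert P ℓ).app S).hom ((c.app S).hom x)) =
        ((toInvert P ℓ).app S').hom ((P.map f).hom ((c.app S).hom x)) :=
      congr($((toInvert P ℓ).naturality f).hom ((c.app S).hom x)).symm
    have h4 := IsLocalization.Away.lift_eq (S := Q.obj S) (ℓ : Z.obj S)
      (isUnit_invert ℓ (c.app S).hom) x
    have h5 := IsLocalization.Away.lift_eq (S := Q.obj S') (ℓ : Z.obj S')
      (isUnit_invert ℓ (c.app S').hom) ((Z.map f).hom x)
    refine (congrArg _ h1).trans (h5.trans ?_)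
    refine Eq.trans ?_ (congrArg ((invert P ℓ).map f).hom h4).symm
    exact ((congrArg ((toInvert P ℓ).app S').hom h2).symm).trans h3.symm

end invert

section quotient

variable {F : CompHaus.{u}ᵒᵖ ⥤ CommRingCat.{u + 1}} (I : ∀ S, Ideal (F.obj S))

lemma pow_le_comap (hI : ∀ S S' (f : S ⟶ S'), I S ≤ (I S').comap (F.map f).hom)
    (n : ℕ) {S S' : CompHaus.{u}ᵒᵖ} (f : S ⟶ S') :
    I S ^ n ≤ (I S' ^ n).comap (F.map f).hom :=
  (Ideal.pow_right_mono (hI S S' f) n).trans (Ideal.le_comap_pow _ n)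

variable (hI : ∀ S S' (f : S ⟶ S'), I S ≤ (I S').comap (F.map f).hom)

/-- For a family of ideals `I(S)` of `F(S)` stable under restriction, the presheaf
`S ↦ F(S) / I(S)^n`. -/
def quotPow (n : ℕ) : CompHaus.{u}ᵒᵖ ⥤ CommRingCat.{u + 1} where
  obj S := .of (F.obj S ⧸ I S ^ n)
  map f := CommRingCat.ofHom (Ideal.quotientMap _ (F.map f).hom (pow_le_comap I hI n f))
  map_id S := by
    ext : 1
    refine Ideal.Quotient.ringHom_ext ?_
    ext x
    simp
  map_comp f g := by
    ext : 1
    refine Ideal.Quotient.ringHom_ext ?_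
    ext x
    simp

/-- The projection `F → F / I^n`. -/
def quotPowProj (n : ℕ) : F ⟶ quotPow I hI n where
  app S := CommRingCat.ofHom (Ideal.Quotient.mk (I S ^ n))

/-- The projection `F / I^(n+1) → F / I^n`. -/
def quotPowTransition (n : ℕ) : quotPow I hI (n + 1) ⟶ quotPow I hI n where
  app S := CommRingCat.ofHom (Ideal.Quotient.factor (Ideal.pow_le_pow_right n.le_succ))
  naturality S S' f := by
    ext : 1
    refine Ideal.Quotient.ringHom_ext ?_
    ext x
    rfl

lemma quotPowProj_transition (n : ℕ) :
    quotPowProj I hI (n + 1) ≫ quotPowTransition I hI n = quotPowProj I hI n := rfl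

/-- The sheafifications of the presheaves `S ↦ F(S) / I(S)^n`. -/
def quotPowSheaf (n : ℕ) : CondensedCommRing.{u} :=
  (presheafToSheaf (coherentTopology CompHaus.{u}) CommRingCat.{u + 1}).obj (quotPow I hI n)

/-- The transition maps `F / I^(n+1) → F / I^n` between the sheafifications. -/
def quotPowSheafTransition (n : ℕ) :
    quotPowSheaf I hI (n + 1) ⟶ quotPowSheaf I hI n :=
  (presheafToSheaf (coherentTopology CompHaus.{u}) CommRingCat.{u + 1}).map
    (quotPowTransition I hI n)

/-- The map from a condensed ring `R` to `F / I^n` induced by a map `R → F`. -/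
def toQuotPowSheaf (R : CondensedCommRing.{u}) (φ : R.obj ⟶ F) (n : ℕ) :
    R ⟶ quotPowSheaf I hI n :=
  ⟨φ ≫ quotPowProj I hI n ≫ toSheafify (coherentTopology CompHaus.{u}) _⟩

lemma toQuotPowSheaf_transition (R : CondensedCommRing.{u}) (φ : R.obj ⟶ F) (n : ℕ) :
    toQuotPowSheaf I hI R φ (n + 1) ≫ quotPowSheafTransition I hI n =
      toQuotPowSheaf I hI R φ n := by
  apply ObjectProperty.hom_ext
  change (φ ≫ quotPowProj I hI (n + 1) ≫ toSheafify (coherentTopology CompHaus.{u}) _) ≫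
    sheafifyMap (coherentTopology CompHaus.{u}) (quotPowTransition I hI n) =
      φ ≫ quotPowProj I hI n ≫ toSheafify (coherentTopology CompHaus.{u}) _
  rw [Category.assoc, Category.assoc, ← toSheafify_naturality, ← Category.assoc (quotPowProj I hI _),
    quotPowProj_transition]

/-- The condensed ring `lim_n F / I^n` (quotients and limit in condensed rings). -/
def adicCompletion : CondensedCommRing.{u} :=
  limit (Functor.ofOpSequence (quotPowSheafTransition I hI))

/-- The map `R → lim_n F / I^n` induced by a map `R → F`. -/
def toAdicCompletion (R : CondensedCommRing.{u}) (φ : R.obj ⟶ F) :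
    R ⟶ adicCompletion I hI :=
  limit.lift (Functor.ofOpSequence (quotPowSheafTransition I hI))
    { pt := R
      π := NatTrans.ofOpSequence (toQuotPowSheaf I hI R φ) (fun n => by
        rw [Functor.ofOpSequence_map_homOfLE_succ]
        exact (Category.id_comp _).trans (toQuotPowSheaf_transition I hI R φ n).symm) }

end quotient
/-- The ideal of `P(S)[1/ℓ]` generated by the kernel of `ε : P(S) → Z(S)`. -/
def invertKer {P Z : CompHaus.{u}ᵒᵖ ⥤ CommRingCat.{u + 1}} (ℓ : ℕ) (ε : P ⟶ Z)
    (S : CompHaus.{u}ᵒᵖ) : Ideal ((invert P ℓ).obj S) :=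
  (RingHom.ker (ε.app S).hom).map ((toInvert P ℓ).app S).hom

lemma invertKer_le_comap {P Z : CompHaus.{u}ᵒᵖ ⥤ CommRingCat.{u + 1}} (ℓ : ℕ) (ε : P ⟶ Z)
    (S S' : CompHaus.{u}ᵒᵖ) (f : S ⟶ S') :
    invertKer ℓ ε S ≤ (invertKer ℓ ε S').comap ((invert P ℓ).map f).hom := by
  refine Ideal.map_le_iff_le_comap.2 fun x hx => ?_
  have h1 : ((invert P ℓ).map f).hom (((toInvert P ℓ).app S).hom x) =
      ((toInvert P ℓ).app S').hom ((P.map f).hom x) :=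
    congr($((toInvert P ℓ).naturality f).hom x).symm
  have h2 : (Z.map f).hom ((ε.app S).hom x) = (ε.app S').hom ((P.map f).hom x) :=
    congr($(ε.naturality f).hom x).symm
  rw [Ideal.mem_comap, Ideal.mem_comap, h1]
  refine Ideal.mem_map_of_mem _ ?_
  rw [RingHom.mem_ker] at hx ⊢
  rw [← h2, hx, map_zero]

end CondensedCommRing

/-- The standard split torus `𝔾ₘ^r = Spec k[ℤ^r]` over `k`, as a scheme over `Spec k`. -/
abbrev splitTorus (k : Type u) [Field k] (r : ℕ) : Over (Spec (.of k)) :=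
  (Spec (.of (AddMonoidAlgebra k (Fin r → ℤ)))).asOver (Spec (.of k))

/-- A commutative group scheme over an algebraically closed field `k` is a torus if it is
isomorphic, as a group scheme, to `𝔾ₘ^r` for some `r`. -/
class IsTorus {k : Type u} [Field k] (T : Over (Spec (.of k))) [CommGrpObj T] : Prop where
  exists_iso : ∃ (r : ℕ) (e : T ≅ splitTorus k r), IsMonHom e.hom

/-- The `k`-points of a scheme over `k`. -/
abbrev KPoints {k : Type u} [Field k] (T : Over (Spec (.of k))) : Type u :=
  MonoidalCategoryStruct.tensorUnit (Over (Spec (.of k))) ⟶ T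

/-- The `m`-torsion subgroup of a commutative group. -/
abbrev torsionSubgroup (G : Type*) [CommGroup G] (m : ℕ) : Subgroup G :=
  (powMonoidHom m : G →* G).ker

section finiteness

open scoped MonObj

variable {k : Type u} [Field k]

lemma convMul_single (r : ℕ) (f g : WithConv (AddMonoidAlgebra k (Fin r → ℤ) →ₐ[k] k))
    (a : Fin r → ℤ) : (f * g).ofConv (AddMonoidAlgebra.single a 1) =
      f.ofConv (AddMonoidAlgebra.single a 1) * g.ofConv (AddMonoidAlgebra.single a 1) := by
  simp [AlgHom.convMul_def]

instance finite_torsion_algHom (r m : ℕ) [NeZero m] :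
    Finite (torsionSubgroup (WithConv (AddMonoidAlgebra k (Fin r → ℤ) →ₐ[k] k)) m) := by
  let ev : torsionSubgroup (WithConv (AddMonoidAlgebra k (Fin r → ℤ) →ₐ[k] k)) m →
      (Fin r → {x : k // x ^ m = 1}) := fun f i =>
    ⟨f.1.ofConv (AddMonoidAlgebra.single (Pi.single i 1) 1), by
      have hf := f.2
      rw [MonoidHom.mem_ker, powMonoidHom_apply] at hf
      have key : ∀ n : ℕ, (f.1 ^ n).ofConv (AddMonoidAlgebra.single (Pi.single i 1) 1) =
          f.1.ofConv (AddMonoidAlgebra.single (Pi.single i 1) 1) ^ n := by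
        intro n
        induction n with
        | zero => simp [AlgHom.convOne_def]
        | succ n ih => rw [pow_succ, convMul_single, ih, pow_succ]
      rw [← key, hf]
      simp [AlgHom.convOne_def]⟩
  classical
  have : Finite {x : k // x ^ m = 1} :=
    Set.Finite.to_subtype (((Polynomial.nthRoots m (1 : k)).toFinset.finite_toSet).subset
      fun x hx => by
        rw [Finset.mem_coe, Multiset.mem_toFinset, Polynomial.mem_nthRoots (NeZero.pos m)]
        exact hx)
  refine Finite.of_injective ev fun f g h => ?_
  have hfg : ∀ i, f.1.ofConv (AddMonoidAlgebra.single (Pi.single i 1) 1) =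
      g.1.ofConv (AddMonoidAlgebra.single (Pi.single i 1) 1) := fun i =>
    congrArg Subtype.val (congrFun h i)
  apply Subtype.ext
  apply WithConv.ext
  let toAdd (φ : AddMonoidAlgebra k (Fin r → ℤ) →ₐ[k] k) : (Fin r → ℤ) →+ Additive k :=
    { toFun := fun a => Additive.ofMul (φ (AddMonoidAlgebra.single a 1))
      map_zero' := by rw [← AddMonoidAlgebra.one_def, map_one]; rfl
      map_add' := fun a b => by
        rw [← ofMul_mul, ← map_mul, AddMonoidAlgebra.single_mul_single, _root_.mul_one] }
  have hadd : toAdd f.1.ofConv = toAdd g.1.ofConv := by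
    apply AddMonoidHom.functions_ext'
    intro i
    apply AddMonoidHom.ext_int
    exact congrArg Additive.ofMul (hfg i)
  exact AddMonoidAlgebra.algHom_ext
    (fun a => congrArg Additive.toMul (DFunLike.congr_fun hadd a)) (Subsingleton.elim _ _)

lemma finite_torsion_points (T : Over (Spec (.of k))) [CommGrpObj T] [IsTorus T] (m : ℕ)
    [NeZero m] : Finite (torsionSubgroup (KPoints T) m) := by
  obtain ⟨r, e, he⟩ := IsTorus.exists_iso (T := T)
  let i : (Spec (.of k)).asOver (Spec (.of k)) ≅
      MonoidalCategoryStruct.tensorUnit (Over (Spec (.of k))) :=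
    Over.isoMk (Iso.refl _) (by
      change 𝟙 _ ≫ 𝟙 _ = Spec.map (CommRingCat.ofHom (algebraMap k k))
      rw [Category.comp_id]; exact (Spec.map_id _).symm)
  let F : KPoints T →* ((Spec (.of k)).asOver (Spec (.of k)) ⟶ splitTorus k r) :=
    { toFun := fun x => i.hom ≫ x ≫ e.hom
      map_one' := by rw [MonObj.one_comp, MonObj.comp_one]
      map_mul' := fun x y => by rw [MonObj.mul_comp, MonObj.comp_mul] }
  have hF : Function.Injective F := fun x y h => by simpa [F] using h
  let E := (Spec.mapMulEquiv (R := k) (S := AddMonoidAlgebra k (Fin r → ℤ)) (T := k)).symm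
  have hE : ∀ x : KPoints T, x ∈ torsionSubgroup (KPoints T) m →
      E (F x) ∈ torsionSubgroup (WithConv (AddMonoidAlgebra k (Fin r → ℤ) →ₐ[k] k)) m := by
    intro x hx
    rw [MonoidHom.mem_ker, powMonoidHom_apply] at hx ⊢
    have h1 : F x ^ m = 1 := by rw [← map_pow, hx, map_one]
    exact ((map_pow E (F x) m).symm.trans (congrArg E h1)).trans (map_one E)
  exact Finite.of_injective
    (fun x : torsionSubgroup (KPoints T) m => (⟨E (F x.1), hE x.1 x.2⟩ :
      torsionSubgroup (WithConv (AddMonoidAlgebra k (Fin r → ℤ) →ₐ[k] k)) m))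
    fun x y h => Subtype.ext (hF (E.injective (congrArg Subtype.val h)))

end finiteness

section groupAlgebra

variable (A : Type*) [CommRing A] [TopologicalSpace A] 

/-- The topology of pointwise convergence of the coefficients on a group algebra `A[G]`.  For
finite `G` it is the product topology on `A[G] = A^G`. -/
instance MonoidAlgebra.coeffTopology (G : Type*) : TopologicalSpace (MonoidAlgebra A G) :=
  .induced (fun x (g : G) => x.coeff g) inferInstance

variable {A}

lemma MonoidAlgebra.continuous_coeff {G : Type*} (g : G) :
    Continuous fun x : MonoidAlgebra A G => x.coeff g :=
  (continuous_apply g).comp continuous_induced_dom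

lemma MonoidAlgebra.continuous_of_coeff {X G : Type*} [TopologicalSpace X]
    {f : X → MonoidAlgebra A G} (h : ∀ g, Continuous fun x => (f x).coeff g) : Continuous f :=
  continuous_induced_rng.2 (continuous_pi h)

instance MonoidAlgebra.isTopologicalRing [IsTopologicalRing A] (G : Type*) [Group G] [Finite G] :
    IsTopologicalRing (MonoidAlgebra A G) where
  continuous_add := continuous_of_coeff fun g =>
    ((continuous_coeff g).comp continuous_fst).add ((continuous_coeff g).comp continuous_snd)
  continuous_neg := continuous_of_coeff fun g => (continuous_coeff g).neg
  continuous_mul := continuous_of_coeff fun g => by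
    classical
    have := Fintype.ofFinite G
    have h : ∀ z : MonoidAlgebra A G × MonoidAlgebra A G, (z.1 * z.2).coeff g =
        ∑ p ∈ (Finset.univ : Finset (G × G)).filter (fun p => p.1 * p.2 = g),
          z.1.coeff p.1 * z.2.coeff p.2 :=
      fun z => MonoidAlgebra.coeff_mul_antidiag _ _ _ _ (by simp)
    rw [continuous_congr h]
    exact continuous_finsetSum _ fun p _ =>
      ((continuous_coeff _).comp continuous_fst).mul ((continuous_coeff _).comp continuous_snd)

variable (A) (ℓ : ℕ) (G : Type*) [CommGroup G]

/-- The transition map `G[ℓ^(n+1)] → G[ℓ^n]`, `x ↦ x^ℓ`. -/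
def torsionTransition (n : ℕ) : torsionSubgroup G (ℓ ^ (n + 1)) →* torsionSubgroup G (ℓ ^ n) :=
  ((powMonoidHom ℓ).comp (Subgroup.subtype _)).codRestrict _ fun x => by
    have hx := x.2
    simp only [MonoidHom.mem_ker, powMonoidHom_apply] at hx
    simpa [← pow_mul, ← pow_succ'] using hx

/-- The inverse limit `lim_n A[G[ℓ^n]]` along the maps `x ↦ x^ℓ`, inside the product of the
`A[G[ℓ^n]]`; it carries the inverse limit topology. -/
def completedGroupAlgebra : Subring (∀ n : ℕ, MonoidAlgebra A (torsionSubgroup G (ℓ ^ n))) where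
  carrier := {x | ∀ n, MonoidAlgebra.mapDomainRingHom A (torsionTransition ℓ G n) (x (n + 1)) = x n}
  mul_mem' hx hy n := by simp only [Pi.mul_apply, map_mul, hx n, hy n]
  one_mem' n := by simp only [Pi.one_apply, map_one]
  add_mem' hx hy n := by simp only [Pi.add_apply, map_add, hx n, hy n]
  zero_mem' n := by simp only [Pi.zero_apply, map_zero]
  neg_mem' hx n := by simp only [Pi.neg_apply, map_neg, hx n]

instance [IsTopologicalRing A] [∀ n, Finite (torsionSubgroup G (ℓ ^ n))] : 
  IsTopologicalRing (completedGroupAlgebra A ℓ G) := inferInstance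


namespace completedGroupAlgebra

/-- The structure map `A → lim_n A[G[ℓ^n]]`. -/
def const : A →+* completedGroupAlgebra A ℓ G :=
  (RingHom.pi fun n => algebraMap A (MonoidAlgebra A (torsionSubgroup G (ℓ ^ n)))).codRestrict _
    fun a n => by
      change MonoidAlgebra.mapDomainRingHom A _ (MonoidAlgebra.single 1 a) =
        MonoidAlgebra.single 1 a
      simp

/-- The augmentation `lim_n A[G[ℓ^n]] → A`, induced by the sum of the coefficients on
`A[G[ℓ^n]]` for any `n` (we take `n = 0`). -/
def augmentation : completedGroupAlgebra A ℓ G →+* A :=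
  (MonoidAlgebra.lift A A (torsionSubgroup G (ℓ ^ 0)) 1).toRingHom.comp
    ((Pi.evalRingHom (fun n : ℕ => MonoidAlgebra A (torsionSubgroup G (ℓ ^ n))) 0).comp
      (Subring.subtype _))

lemma continuous_const : Continuous (const A ℓ G) := by
  classical
  refine Continuous.subtype_mk (continuous_pi fun n => MonoidAlgebra.continuous_of_coeff fun g => ?_) _
  change Continuous fun a : A => (Finsupp.single 1 a) g
  simp only [Finsupp.single_apply]
  split_ifs
  · exact continuous_id
  · exact _root_.continuous_const

lemma continuous_augmentation [IsTopologicalRing A] [Finite (torsionSubgroup G (ℓ ^ 0))] :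
    Continuous (augmentation A ℓ G) := by
  have := Fintype.ofFinite (torsionSubgroup G (ℓ ^ 0))
  have h : ∀ x, augmentation A ℓ G x = ∑ g, (x.1 0).coeff g := by
    intro x
    change MonoidAlgebra.lift A A (torsionSubgroup G (ℓ ^ 0)) 1 (x.1 0) = _
    rw [MonoidAlgebra.lift_apply, Finsupp.sum_fintype _ _ (by simp)]
    exact Finset.sum_congr rfl fun g _ => mul_one _
  rw [continuous_congr h]
  exact continuous_finsetSum _ fun g _ => (MonoidAlgebra.continuous_coeff g).comp
    ((continuous_apply 0).comp continuous_subtype_val)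

end completedGroupAlgebra

end groupAlgebra

section ULiftHom

/-- A ring homomorphism, transported to `ULift`s. -/
def uliftRingHom {A B : Type*} [CommRing A] [CommRing B] (f : A →+* B) :
    ULift.{w} A →+* ULift.{w'} B :=
  (ULift.ringEquiv.symm : B ≃+* ULift.{w'} B).toRingHom.comp
    (f.comp (ULift.ringEquiv : ULift.{w} A ≃+* A).toRingHom)

lemma continuous_uliftRingHom {A B : Type*} [CommRing A] [CommRing B] [TopologicalSpace A]
    [TopologicalSpace B] (f : A →+* B) (hf : Continuous f) :
    Continuous (uliftRingHom.{w, w'} f) :=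
  continuous_uliftUp.comp (hf.comp continuous_uliftDown)

end ULiftHom

section padic

variable (ℓ : ℕ) [Fact ℓ.Prime]

/-- The topological ring `ℤ_ℓ`. -/
abbrev topZl : TopCommRingCat.{u + 1} := .of (ULift.{u + 1} ℤ_[ℓ])

/-- The topological field `ℚ_ℓ`. -/
abbrev topQl : TopCommRingCat.{u + 1} := .of (ULift.{u + 1} ℚ_[ℓ])

/-- The inclusion `ℤ_ℓ → ℚ_ℓ`. -/
def topZlToQl : topZl.{u} ℓ ⟶ topQl.{u} ℓ :=
  ⟨uliftRingHom (PadicInt.Coe.ringHom), continuous_uliftRingHom _ continuous_subtype_val⟩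

/-- A continuous function from a compact space to `ℚ_ℓ` becomes `ℤ_ℓ`-valued after multiplication
by a power of `ℓ`, so that `C(S, ℚ_ℓ) = C(S, ℤ_ℓ)[1/ℓ]`. -/
lemma isLocalization_topZlToQl (S : CompHaus.{u}ᵒᵖ) :
    @IsLocalization.Away _ _ (ℓ : (CondensedCommRing.ofTop.{u}.obj (topZl ℓ)).obj.obj S)
      ((CondensedCommRing.ofTop.{u}.obj (topQl ℓ)).obj.obj S) _
      (((CondensedCommRing.ofTop.{u}.map (topZlToQl ℓ)).hom.app S).hom).toAlgebra := by
  let Z := C(S.unop, ULift.{u + 1} ℤ_[ℓ])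
  let Q := C(S.unop, ULift.{u + 1} ℚ_[ℓ])
  let φ : Z →+* Q := ((CondensedCommRing.ofTop.{u}.map (topZlToQl ℓ)).hom.app S).hom
  have hφ : ∀ (g : Z) (s : S.unop), ((φ g) s).down = ((g s).down : ℚ_[ℓ]) := fun g s => rfl
  have hinj : Function.Injective φ := by
    intro g h e
    ext s
    have := congrArg (fun q : Q => (q s).down) e
    exact Subtype.ext this
  have hℓ : (ℓ : ℚ_[ℓ]) ≠ 0 := Nat.cast_ne_zero.2 (Fact.out : ℓ.Prime).ne_zero
  let _ : Algebra Z Q := φ.toAlgebra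
  change IsLocalization (Submonoid.powers (ℓ : Z)) Q
  rw [isLocalization_iff]
  refine ⟨?_, fun f => ?_, fun {x y} e => ⟨1, by rw [hinj e]⟩⟩
  · rintro ⟨_, n, rfl⟩
    let inv : Q := ContinuousMap.const _ ⟨(ℓ : ℚ_[ℓ])⁻¹⟩
    have h : IsUnit (φ (ℓ : Z)) := by
      refine IsUnit.of_mul_eq_one inv ?_
      rw [map_natCast]
      ext s
      exact mul_inv_cancel₀ hℓ
    change IsUnit (φ ((ℓ : Z) ^ n))
    rw [map_pow]
    exact h.pow n
  · obtain ⟨C, hC⟩ := (isCompact_univ (X := S.unop)).exists_bound_of_continuousOn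
      (f := fun s => (f s).down) (continuous_uliftDown.comp f.continuous).continuousOn
    obtain ⟨n, hn⟩ := pow_unbounded_of_one_lt C
      (Nat.one_lt_cast.2 (Fact.out : ℓ.Prime).one_lt : (1 : ℝ) < (ℓ : ℝ))
    have hle : ∀ s, ‖(f s).down * (ℓ : ℚ_[ℓ]) ^ n‖ ≤ 1 := fun s => by
      have hpos : (0 : ℝ) < (ℓ : ℝ) ^ n := pow_pos (Nat.cast_pos.2 (Fact.out : ℓ.Prime).pos) n
      rw [norm_mul, norm_pow, Padic.norm_p, inv_pow, mul_inv_le_iff₀ hpos, one_mul]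
      exact (hC s (Set.mem_univ s)).trans hn.le
    let g : Z := ⟨fun s => ⟨⟨(f s).down * (ℓ : ℚ_[ℓ]) ^ n, hle s⟩⟩,
      continuous_uliftUp.comp (Continuous.subtype_mk
        ((continuous_uliftDown.comp f.continuous).mul continuous_const) _)⟩
    refine ⟨⟨g, ⟨(ℓ : Z) ^ n, n, rfl⟩⟩, ?_⟩
    change f * φ ((ℓ : Z) ^ n) = φ g
    rw [map_pow, map_natCast]
    ext s
    rfl

/-- Finite extensions of `ℚ_ℓ` inside a fixed algebraic closure, ordered by inclusion. -/
abbrev FinExt : Type := {E : IntermediateField ℚ_[ℓ] (PadicAlgCl ℓ) // FiniteDimensional ℚ_[ℓ] E}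

/-- The finite extension `ℚ_ℓ` of `ℚ_ℓ`. -/
def FinExt.base : FinExt ℓ := ⟨⊥, inferInstance⟩

variable {ℓ}

/-- The ring of integers of `E`: the elements which are integral over `ℤ_ℓ`. -/
abbrev FinExt.integers (E : FinExt ℓ) : Subalgebra ℤ_[ℓ] E.1 := integralClosure ℤ_[ℓ] E.1

/-- The inclusion of finite extensions. -/
def FinExt.incl {E F : FinExt ℓ} (h : E ≤ F) : E.1 →+* F.1 := (IntermediateField.inclusion h).toRingHom

lemma FinExt.continuous_incl {E F : FinExt ℓ} (h : E ≤ F) : Continuous (FinExt.incl h) :=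
  Continuous.subtype_mk continuous_subtype_val _

/-- The inclusion of rings of integers. -/
def FinExt.inclIntegers {E F : FinExt ℓ} (h : E ≤ F) : E.integers →+* F.integers :=
  ((FinExt.incl h).comp E.integers.subtype).codRestrict F.integers.toSubring fun x =>
    x.2.map ((IntermediateField.inclusion h).restrictScalars ℤ_[ℓ])

lemma FinExt.continuous_inclIntegers {E F : FinExt ℓ} (h : E ≤ F) :
    Continuous (FinExt.inclIntegers h) :=
  Continuous.subtype_mk ((FinExt.continuous_incl h).comp continuous_subtype_val) _

variable (ℓ)

/-- The diagram of the finite extensions `E` of `ℚ_ℓ`, with their `ℓ`-adic topology (induced by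
the unique extension of the absolute value). -/
def finExtDiagram : FinExt ℓ ⥤ TopCommRingCat.{u + 1} where
  obj E := .of (ULift.{u + 1} E.1)
  map f := ⟨uliftRingHom (FinExt.incl f.le), continuous_uliftRingHom _ (FinExt.continuous_incl _)⟩

/-- The diagram of the rings of integers `𝒪_E`, with their `ℓ`-adic topology, for the finite
extensions `E` of `ℚ_ℓ`. -/
def integersDiagram : FinExt ℓ ⥤ TopCommRingCat.{u + 1} where
  obj E := .of (ULift.{u + 1} E.integers)
  map f := ⟨uliftRingHom (FinExt.inclIntegers f.le),
    continuous_uliftRingHom _ (FinExt.continuous_inclIntegers _)⟩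

/-- The condensed ring `\overline ℚ_ℓ`, the filtered colimit of the finite extensions. -/
def condensedQlBar : CondensedCommRing.{u} :=
  colimit (finExtDiagram.{u} ℓ ⋙ CondensedCommRing.ofTop)

/-- The condensed ring `\overline ℤ_ℓ`, the filtered colimit of the `𝒪_E`. -/
def condensedZlBar : CondensedCommRing.{u} :=
  colimit (integersDiagram.{u} ℓ ⋙ CondensedCommRing.ofTop)

/-- The isomorphism from `ℚ_ℓ` to the smallest finite extension. -/
def qlToBase : topQl.{u} ℓ ⟶ (finExtDiagram.{u} ℓ).obj (FinExt.base ℓ) :=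
  ⟨uliftRingHom (algebraMap ℚ_[ℓ] (FinExt.base ℓ).1),
    continuous_uliftRingHom _ (Continuous.subtype_mk (continuous_algebraMap ℚ_[ℓ] (PadicAlgCl ℓ)) _)⟩

/-- The isomorphism from `ℤ_ℓ` to the ring of integers of the smallest finite extension. -/
def zlToBase : topZl.{u} ℓ ⟶ (integersDiagram.{u} ℓ).obj (FinExt.base ℓ) :=
  ⟨uliftRingHom (algebraMap ℤ_[ℓ] (FinExt.base ℓ).integers),
    continuous_uliftRingHom _ (Continuous.subtype_mk (Continuous.subtype_mk
      ((continuous_algebraMap ℚ_[ℓ] (PadicAlgCl ℓ)).comp continuous_subtype_val) _) _)⟩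

def qlToQlBar : CondensedCommRing.ofTop.obj (topQl.{u} ℓ) ⟶ condensedQlBar.{u} ℓ :=
  CondensedCommRing.ofTop.map (qlToBase ℓ) ≫
    colimit.ι (finExtDiagram.{u} ℓ ⋙ CondensedCommRing.ofTop) (FinExt.base ℓ)

def zlToZlBar : CondensedCommRing.ofTop.obj (topZl.{u} ℓ) ⟶ condensedZlBar.{u} ℓ :=
  CondensedCommRing.ofTop.map (zlToBase ℓ) ≫
    colimit.ι (integersDiagram.{u} ℓ ⋙ CondensedCommRing.ofTop) (FinExt.base ℓ)

end padic

section torusRings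

open scoped MonObj

variable (ℓ : ℕ) [Fact ℓ.Prime]

/-- The coefficient rings `F_ℓ`, `ℤ_ℓ`, `ℚ_ℓ`, the algebraic closures of `F_ℓ` and `ℚ_ℓ`, and
the integral closure of `ℤ_ℓ` in the algebraic closure of `ℚ_ℓ`. -/
inductive CoeffKind
  | Fl | Zl | Ql | FlBar | ZlBar | QlBar

/-- The discrete field `F_ℓ`. -/
abbrev topFl : TopCommRingCat.{u + 1} := .of (ULift.{u + 1} (ZMod ℓ))

/-- The discrete field `\overline F_ℓ`. -/
def topFlBar : TopCommRingCat.{u + 1} :=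
  letI : TopologicalSpace (ULift.{u + 1} (AlgebraicClosure (ZMod ℓ))) := ⊥
  haveI : DiscreteTopology (ULift.{u + 1} (AlgebraicClosure (ZMod ℓ))) := ⟨rfl⟩
  .of (ULift.{u + 1} (AlgebraicClosure (ZMod ℓ)))

/-- The inclusion of `F_ℓ` in its algebraic closure. -/
def topFlToFlBar : topFl.{u} ℓ ⟶ topFlBar.{u} ℓ :=
  ⟨uliftRingHom (algebraMap (ZMod ℓ) (AlgebraicClosure (ZMod ℓ))), by
    have : DiscreteTopology (ULift.{u + 1} (ZMod ℓ)) :=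
      (Homeomorph.ulift (X := ZMod ℓ)).symm.discreteTopology
    exact continuous_of_discreteTopology⟩

/-- The condensed ring `Λ`. -/
def coeffRing : CoeffKind → CondensedCommRing.{u}
  | .Fl => CondensedCommRing.ofTop.obj (topFl ℓ)
  | .Zl => CondensedCommRing.ofTop.obj (topZl ℓ)
  | .Ql => CondensedCommRing.ofTop.obj (topQl ℓ)
  | .FlBar => CondensedCommRing.ofTop.obj (topFlBar ℓ)
  | .ZlBar => condensedZlBar ℓ
  | .QlBar => condensedQlBar ℓ

variable {k : Type u} [Field k] (T : Over (Spec (.of k))) [CommGrpObj T] [IsTorus T]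

instance finite_torsion_points_pow (n : ℕ) : Finite (torsionSubgroup (KPoints T) (ℓ ^ n)) :=
  finite_torsion_points T (ℓ ^ n)

/-- The topological ring `F_ℓ⟦π₁(T)_ℓ⟧ = lim_n F_ℓ[T[ℓ^n]]`. -/
abbrev topTorusRingFl : TopCommRingCat.{u + 1} :=
  .of (ULift.{u + 1} (completedGroupAlgebra (ZMod ℓ) ℓ (KPoints T)))

/-- The topological ring `ℤ_ℓ⟦π₁(T)_ℓ⟧ = lim_n ℤ_ℓ[T[ℓ^n]]`. -/
abbrev topTorusRingZl : TopCommRingCat.{u + 1} :=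
  .of (ULift.{u + 1} (completedGroupAlgebra ℤ_[ℓ] ℓ (KPoints T)))

/-- The structure map of the `F_ℓ`-algebra `F_ℓ⟦π₁(T)_ℓ⟧`. -/
def torusRingFlConst : topFl ℓ ⟶ topTorusRingFl ℓ T :=
  ⟨uliftRingHom (completedGroupAlgebra.const _ _ _),
    continuous_uliftRingHom _ (completedGroupAlgebra.continuous_const _ _ _)⟩

/-- The structure map of the `ℤ_ℓ`-algebra `ℤ_ℓ⟦π₁(T)_ℓ⟧`. -/
def torusRingZlConst : topZl ℓ ⟶ topTorusRingZl ℓ T :=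
  ⟨uliftRingHom (completedGroupAlgebra.const _ _ _),
    continuous_uliftRingHom _ (completedGroupAlgebra.continuous_const _ _ _)⟩

/-- The augmentation `ℤ_ℓ⟦π₁(T)_ℓ⟧ → ℤ_ℓ`. -/
def torusRingZlAug : topTorusRingZl ℓ T ⟶ topZl ℓ :=
  ⟨uliftRingHom (completedGroupAlgebra.augmentation _ _ _),
    continuous_uliftRingHom _ (completedGroupAlgebra.continuous_augmentation _ _ _)⟩

/-- The condensed ring `lim_n (ℤ_ℓ⟦π₁(T)_ℓ⟧[1/ℓ]) / I^n`, with `I` the augmentation ideal. -/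
def torusRingQl : CondensedCommRing.{u} :=
  CondensedCommRing.adicCompletion
    (CondensedCommRing.invertKer ℓ (CondensedCommRing.ofTop.map (torusRingZlAug ℓ T)).hom)
    (CondensedCommRing.invertKer_le_comap ℓ _)

/-- The structure map of the condensed `ℚ_ℓ`-algebra `lim_n (ℤ_ℓ⟦π₁(T)_ℓ⟧[1/ℓ]) / I^n`. -/
def torusRingQlConst : CondensedCommRing.ofTop.obj (topQl ℓ) ⟶ torusRingQl ℓ T :=
  CondensedCommRing.toAdicCompletion _ _ _
    (CondensedCommRing.invertLift ℓ (CondensedCommRing.ofTop.map (topZlToQl ℓ)).hom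
      (isLocalization_topZlToQl ℓ) (CondensedCommRing.ofTop.map (torusRingZlConst ℓ T)).hom)

/-- The condensed ring `R_{T,Λ}`.  For `Λ` one of the three algebraic closures of `Λ₀`, it is
the tensor product `R_{T,Λ₀} ⊗_{Λ₀} Λ`, that is the pushout of condensed commutative rings. -/
def torusRing : CoeffKind → CondensedCommRing.{u}
  | .Fl => CondensedCommRing.ofTop.obj (topTorusRingFl ℓ T)
  | .Zl => CondensedCommRing.ofTop.obj (topTorusRingZl ℓ T)
  | .Ql => torusRingQl ℓ T
  | .FlBar => pushout (CondensedCommRing.ofTop.map (torusRingFlConst ℓ T))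
      (CondensedCommRing.ofTop.map (topFlToFlBar ℓ))
  | .ZlBar => pushout (CondensedCommRing.ofTop.map (torusRingZlConst ℓ T)) (zlToZlBar ℓ)
  | .QlBar => pushout (torusRingQlConst ℓ T) (qlToQlBar ℓ)

end torusRings

end

/-! Since `ℓ ≠ p`, a compatible system of `ℓ`-power roots of unity in `k` identifies `T[ℓ^n]` with
`(ℤ/ℓ^n)^r`. As in Iwasawa theory, `γ_i ↦ 1 + x_i` then identifies `lim Λ[T[ℓ^n]]` with `Λ⟦x_1, …,
x_r⟧` for `Λ = F_ℓ, ℤ_ℓ`, compatibly with the topology, the constants and the augmentation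
(`IsTateBasis.exists_ringEquiv`). Inverting `ℓ` and completing along the augmentation ideal turns
`ℤ_ℓ⟦x⟧` into `ℚ_ℓ⟦x⟧`, on sections over every `S` (`exists_iso_adicCompletion_topMvPowerSeries`).
Over the three basic coefficient rings everything is thus a power series ring over a principal ideal
domain `A`.

Flatness: `C(S, A)` is torsion-free, hence flat, over `A`; moreover `C(S, A⟦x⟧) = C(S, A)⟦x⟧`, and
`A⟦x⟧ → B⟦x⟧` is flat for `A` noetherian and `B` flat over `A` (`MvPowerSeries.flat_map`, by
Artin–Rees). Regularity: the property `HasFiniteFreeResolutions` implies regular coherence. It holds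
for principal ideal domains, lifts from `R / x` to a noetherian `R` if `x` is regular and lies in
the Jacobson radical, hence passes to power series, and passes to filtered colimits with flat maps
(`HasFiniteFreeResolutions.of_exists_flat`).

Algebraic closures: a finite extension has a basis with continuous coordinates, so its sections over
`S` are those of `Λ₀` tensored with a flat algebra that does not depend on `S`. The coherent sheaf
condition involves only finite limits, which flat base change preserves (`isSheaf_pushout`). Hence
the colimits and tensor products of condensed rings that occur are computed on sections: the
sections of `X = R ⊗_{Λ₀} Λ` are `R(S) ⊗_{R(*)} X(*)`, flat over `X(*)`, and `X(*)` is a filtered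
colimit of power series rings over fields or over the principal ideal domains `𝒪_E`. Nothing
requires `S` to be extremally disconnected. -/

noncomputable section

/-! ### Finite free resolutions: base change, reduction modulo a regular element, power series. -/

section FiniteFreeResolution

/-- A submodule of `R^m` has a finite free resolution by finite free modules. -/
inductive HasFFR (R : Type*) [CommRing R] : ∀ {m : ℕ}, Submodule R (Fin m → R) → Prop
  | bot (m : ℕ) : HasFFR R (⊥ : Submodule R (Fin m → R))
  | range {k m : ℕ} (f : (Fin k → R) →ₗ[R] (Fin m → R)) :
      HasFFR R (LinearMap.ker f) → HasFFR R (LinearMap.range f)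

/-- Every finitely generated submodule of a finite free module has a finite free resolution. -/
def HasFiniteFreeResolutions (R : Type*) [CommRing R] : Prop :=
  ∀ (m : ℕ) (N : Submodule R (Fin m → R)), N.FG → HasFFR R N

lemma HasFFR.fg {R : Type*} [CommRing R] {m : ℕ} {N : Submodule R (Fin m → R)}
    (h : HasFFR R N) : N.FG := by
  cases h with
  | bot => exact Submodule.fg_bot
  | range f _ => exact Module.Finite.range f |>.fg_top |> (Submodule.fg_top _).1

lemma HasFFR.finitePresentation {R : Type*} [CommRing R] {m : ℕ}
    {N : Submodule R (Fin m → R)} (h : HasFFR R N) : Module.FinitePresentation R N := by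
  cases h with
  | bot => infer_instance
  | range f hf =>
    refine Module.finitePresentation_of_free_of_surjective f.rangeRestrict
      f.surjective_rangeRestrict ?_
    rw [LinearMap.ker_rangeRestrict]
    exact hf.fg

/-- Dimension shifting along `0 → R^k / ker f → R^m → R^m / range f → 0`, whose middle term is free.
-/
lemma HasFFR.exists_hasProjectiveDimensionLT {R : Type u} [CommRing R] {m : ℕ}
    {N : Submodule R (Fin m → R)} (h : HasFFR R N) :
    ∃ n, HasProjectiveDimensionLT (ModuleCat.of R ((Fin m → R) ⧸ N)) n := by
  induction h with
  | bot m =>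
    refine ⟨1, ?_⟩
    have : Module.Projective R ((Fin m → R) ⧸ (⊥ : Submodule R (Fin m → R))) :=
      .of_equiv (Submodule.quotEquivOfEqBot _ rfl).symm
    infer_instance
  | @range k m f _ ih =>
    obtain ⟨n, hn⟩ := ih
    let g : ((Fin k → R) ⧸ LinearMap.ker f) →ₗ[R] (Fin m → R) := (LinearMap.ker f).liftQ f le_rfl
    have hgf : (LinearMap.range f).mkQ ∘ₗ g = 0 := by
      ext x
      simp [g]
    let S : ShortComplex (ModuleCat.{u} R) :=
      ShortComplex.mk (ModuleCat.ofHom g) (ModuleCat.ofHom (LinearMap.range f).mkQ)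
        (by rw [← ModuleCat.ofHom_comp, hgf]; rfl)
    have hS : S.ShortExact :=
      { exact := by
          rw [ShortComplex.moduleCat_exact_iff]
          intro x hx
          obtain ⟨y, rfl⟩ := (Submodule.Quotient.mk_eq_zero _).1 hx
          exact ⟨Submodule.Quotient.mk y, rfl⟩
        mono_f := by
          rw [ModuleCat.mono_iff_injective]
          exact LinearMap.ker_eq_bot.1 (Submodule.ker_liftQ_eq_bot _ _ _ le_rfl)
        epi_g := by
          rw [ModuleCat.epi_iff_surjective]
          exact Submodule.mkQ_surjective _ }
    -- The shift is applied to a bound of the form `n + 1`, so the bound `n` is weakened first.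
    refine ⟨n + 1 + 1, ?_⟩
    have : HasProjectiveDimensionLT S.X₁ (n + 1) :=
      hasProjectiveDimensionLT_of_ge (X := S.X₁) (n := n) (h := by omega) _
    have h2 : Projective S.X₂ := by
      have : Module.Projective R (Fin m → R) := inferInstance
      exact (IsProjective.iff_projective _).1 this
    exact (hS.hasProjectiveDimensionLT_X₃_iff n h2).2 this

lemma Submodule.FG.exists_range_eq {R M : Type*} [CommRing R] [AddCommGroup M] [Module R M]
    {N : Submodule R M} (h : N.FG) : ∃ (k : ℕ) (f : (Fin k → R) →ₗ[R] M),
      LinearMap.range f = N := by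
  obtain ⟨k, s, hs⟩ := Submodule.fg_iff_exists_fin_generating_family.1 h
  exact ⟨k, Fintype.linearCombination R s, by rw [Fintype.range_linearCombination, hs]⟩

/-- An ideal is a submodule of `R^1`, and a finitely presented module is `R^m / N` with `N` finitely
generated, so both halves of regular coherence are read off from resolutions of submodules of finite
free modules. -/
theorem HasFiniteFreeResolutions.isRegularCoherent {R : Type u} [CommRing R]
    (h : HasFiniteFreeResolutions R) : IsRegularCoherent R := by
  refine ⟨fun I hI => ?_, fun M _ _ hM => ?_⟩
  · let e : R ≃ₗ[R] (Fin 1 → R) := (LinearEquiv.funUnique (Fin 1) R R).symm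
    have := (h 1 (Submodule.map e.toLinearMap I) (Submodule.FG.map _ hI)).finitePresentation
    exact .of_equiv (e.submoduleMap I).symm
  · obtain ⟨m, N, e, hN⟩ := Module.FinitePresentation.exists_fin R M
    obtain ⟨n, hn⟩ := (h m N hN).exists_hasProjectiveDimensionLT
    refine ⟨n, ?_⟩
    have : HasProjectiveDimensionLT (ModuleCat.of R ((Fin m → R) ⧸ N)) (n + 1) :=
      hasProjectiveDimensionLT_of_ge _ n _ (by omega)
    exact hasProjectiveDimensionLT_of_iso (LinearEquiv.toModuleIso e.symm) _

/-- The extension of a submodule of `R^m` to a submodule of `S^m`. -/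
abbrev Submodule.extendScalarsPi {R : Type*} (S : Type*) [CommRing R] [CommRing S] [Algebra R S]
    {m : ℕ} (N : Submodule R (Fin m → R)) : Submodule S (Fin m → S) :=
  Submodule.span S ((fun (v : Fin m → R) i => algebraMap R S (v i)) '' N)

section BaseChange

variable {R : Type*} {S : Type*} [CommRing R] [CommRing S] [Algebra R S]

lemma Submodule.extendScalarsPi_span {m : ℕ} (s : Set (Fin m → R)) :
    (Submodule.span R s).extendScalarsPi S =
      Submodule.span S ((fun (v : Fin m → R) i => algebraMap R S (v i)) '' s) := by
  refine le_antisymm (Submodule.span_le.2 ?_)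
    (Submodule.span_mono (Set.image_mono Submodule.subset_span))
  rintro _ ⟨v, hv, rfl⟩
  induction hv using Submodule.span_induction with
  | mem v hv => exact Submodule.subset_span ⟨v, hv, rfl⟩
  | zero => change _ ∈ Submodule.span S _; convert Submodule.zero_mem _ using 1; ext; simp
  | add v w _ _ hv hw => change _ ∈ Submodule.span S _; convert Submodule.add_mem _ hv hw using 1; ext; simp
  | smul a v _ hv => change _ ∈ Submodule.span S _; convert Submodule.smul_mem _ (algebraMap R S a) hv using 1; ext; simp

lemma LinearMap.pi_apply_eq_sum {k m : ℕ} (f : (Fin k → R) →ₗ[R] (Fin m → R))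
    (v : Fin k → R) (j : Fin m) : f v j = ∑ i, f (Pi.single i 1) j * v i := by
  have : v = ∑ i, v i • Pi.single i (1 : R) := by
    ext j
    simp [Finset.sum_apply, Pi.single_apply]
  conv_lhs => rw [this, map_sum]
  simp [Finset.sum_apply, mul_comm]

/-- The base change of a linear map between finite free modules. -/
def LinearMap.extendScalarsPi (S : Type*) [CommRing S] [Algebra R S] {k m : ℕ}
    (f : (Fin k → R) →ₗ[R] (Fin m → R)) : (Fin k → S) →ₗ[S] (Fin m → S) :=
  Matrix.toLin' ((LinearMap.toMatrix' f).map (algebraMap R S))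

lemma LinearMap.extendScalarsPi_algebraMap {k m : ℕ} (f : (Fin k → R) →ₗ[R] (Fin m → R))
    (v : Fin k → R) : f.extendScalarsPi S (fun i => algebraMap R S (v i)) =
      fun j => algebraMap R S (f v j) := by
  ext j
  rw [LinearMap.pi_apply_eq_sum f v]
  simp [extendScalarsPi, Matrix.mulVec, dotProduct]

lemma LinearMap.range_extendScalarsPi {k m : ℕ} (f : (Fin k → R) →ₗ[R] (Fin m → R)) :
    LinearMap.range (f.extendScalarsPi S) = (LinearMap.range f).extendScalarsPi S := by
  refine le_antisymm ?_ (Submodule.span_le.2 ?_)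
  · rintro _ ⟨v, rfl⟩
    have : v = ∑ i, v i • fun j => algebraMap R S ((Pi.single i 1 : Fin k → R) j) := by
      ext j
      simp [Finset.sum_apply, Pi.single_apply]
    rw [this, map_sum]
    refine Submodule.sum_mem _ fun i _ => ?_
    rw [map_smul, extendScalarsPi_algebraMap]
    exact Submodule.smul_mem _ _ (Submodule.subset_span ⟨_, ⟨_, rfl⟩, rfl⟩)
  · rintro _ ⟨_, ⟨v, rfl⟩, rfl⟩
    exact ⟨_, extendScalarsPi_algebraMap f v⟩

/-- The equational criterion for flatness: a vector `v ∈ S^k` is a linear form `R^k → S`, and `v` is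
in the kernel when this form kills the image of the transpose of `f`. By flatness the form factors
through a map from `R^k` to a finite free module which kills the same image; the components of that
map are elements of `ker f` that span `v`. -/
lemma LinearMap.ker_extendScalarsPi [Module.Flat R S] {k m : ℕ}
    (f : (Fin k → R) →ₗ[R] (Fin m → R)) :
    LinearMap.ker (f.extendScalarsPi S) = (LinearMap.ker f).extendScalarsPi S := by
  refine le_antisymm (fun v hv => ?_) (Submodule.span_le.2 ?_)
  · let x : (Fin k → R) →ₗ[R] S := Fintype.linearCombination R v
    let ft : (Fin m → R) →ₗ[R] (Fin k → R) := Matrix.toLin' (LinearMap.toMatrix' f).transpose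
    have hx : x ∘ₗ ft = 0 := by
      refine LinearMap.pi_ext' fun j => LinearMap.ext_ring ?_
      have := congrFun (LinearMap.mem_ker.1 hv) j
      simpa [x, ft, Fintype.linearCombination_apply, extendScalarsPi, Matrix.mulVec,
        dotProduct, Algebra.smul_def, Pi.single_apply] using this
    obtain ⟨l, a, y, hxy, haf⟩ := Module.Flat.exists_factorization_of_comp_eq_zero_of_free hx
    let w : Fin l → (Fin k → R) := fun t i => a (Pi.single i 1) t
    have hw : ∀ t, w t ∈ LinearMap.ker f := fun t => by
      rw [LinearMap.mem_ker]
      ext j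
      have h1 := DFunLike.congr_fun (LinearMap.congr_fun haf (Pi.single j 1)) t
      have h2 : ft (Pi.single j 1) = ∑ i, (LinearMap.toMatrix' f j i) • Pi.single i 1 := by
        ext i
        simp [ft, Finset.sum_apply, Pi.single_apply]
      rw [LinearMap.comp_apply, h2, map_sum] at h1
      rw [LinearMap.pi_apply_eq_sum f]
      simpa [w, Finsupp.finsetSum_apply] using h1
    have hv' : v = ∑ t, y (Finsupp.single t 1) • fun i => algebraMap R S (w t i) := by
      ext i
      have h1 : x (Pi.single i 1) = v i := by simp [x, Fintype.linearCombination_apply]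
      rw [← h1, hxy, LinearMap.comp_apply]
      conv_lhs => rw [← Finsupp.univ_sum_single (a (Pi.single i 1))]
      simp only [map_sum, Finset.sum_apply, Pi.smul_apply, smul_eq_mul]
      refine Finset.sum_congr rfl fun t _ => ?_
      rw [mul_comm, ← Algebra.smul_def, ← map_smul, Finsupp.smul_single, smul_eq_mul, mul_one]
    rw [hv']
    exact Submodule.sum_mem _ fun t _ =>
      Submodule.smul_mem _ _ (Submodule.subset_span ⟨_, hw t, rfl⟩)
  · rintro _ ⟨v, hv, rfl⟩
    rw [SetLike.mem_coe, LinearMap.mem_ker] at *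
    rw [extendScalarsPi_algebraMap, hv]
    ext; simp

lemma HasFFR.extendScalars [Module.Flat R S] {m : ℕ} {N : Submodule R (Fin m → R)}
    (h : HasFFR R N) : HasFFR S (N.extendScalarsPi S) := by
  induction h with
  | bot m =>
    have : (⊥ : Submodule R (Fin m → R)).extendScalarsPi S = ⊥ := by
      rw [← Submodule.span_empty, Submodule.extendScalarsPi_span]
      simp
    rw [this]
    exact .bot m
  | range f _ ih =>
    rw [← LinearMap.ker_extendScalarsPi] at ih
    rw [← LinearMap.range_extendScalarsPi]
    exact .range _ ih

end BaseChange

/-- A filtered union of flat maps from rings with finite free resolutions. -/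
theorem HasFiniteFreeResolutions.of_exists_flat {S : Type*} [CommRing S]
    (h : ∀ s : Finset S, ∃ (R : Type w) (_ : CommRing R) (_ : Algebra R S),
      HasFiniteFreeResolutions R ∧ Module.Flat R S ∧ (s : Set S) ⊆ Set.range (algebraMap R S)) :
    HasFiniteFreeResolutions S := by
  classical
  intro m N hN
  obtain ⟨t, rfl⟩ := hN
  obtain ⟨R, _, _, hR, _, hs⟩ := h (t.biUnion fun v => Finset.univ.image v)
  have hlift : ∀ v ∈ t, ∃ w : Fin m → R, (fun i => algebraMap R S (w i)) = v := fun v hv => by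
    have : ∀ i, ∃ r, algebraMap R S r = v i := fun i => hs (by
      simp only [Finset.coe_biUnion, Set.mem_iUnion]
      exact ⟨v, hv, by simp⟩)
    choose w hw using this
    exact ⟨w, funext hw⟩
  choose! w hw using hlift
  have key : (Submodule.span R (w '' t)).extendScalarsPi S = Submodule.span S t := by
    rw [Submodule.extendScalarsPi_span]
    congr 1
    ext v
    constructor
    · rintro ⟨_, ⟨u, hu, rfl⟩, rfl⟩
      change (fun i => algebraMap R S (w u i)) ∈ (t : Set (Fin m → S))
      rw [hw u hu]
      exact hu
    · intro hv
      exact ⟨_, ⟨v, hv, rfl⟩, hw v hv⟩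
  rw [← key]
  exact (hR m _ (Submodule.fg_span (t.finite_toSet.image w))).extendScalars

theorem HasFiniteFreeResolutions.of_ringEquiv {R S : Type*} [CommRing R] [CommRing S]
    (e : R ≃+* S) (h : HasFiniteFreeResolutions R) : HasFiniteFreeResolutions S := by
  refine .of_exists_flat fun s => ?_
  let _ := e.toRingHom.toAlgebra
  refine ⟨R, _, _, h, ?_, fun x _ => e.surjective x⟩
  exact RingHom.Flat.of_bijective (f := e.toRingHom) e.bijective

/-- A submodule of `R^m` is itself free, so a basis gives a presentation with zero kernel. -/
theorem hasFiniteFreeResolutions_of_isPrincipalIdealRing (R : Type*) [CommRing R] [IsDomain R]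
    [IsPrincipalIdealRing R] : HasFiniteFreeResolutions R := by
  intro m N _
  let b := Module.finBasis R N
  let f : (Fin _ → R) →ₗ[R] (Fin m → R) := N.subtype ∘ₗ b.equivFun.symm.toLinearMap
  have hr : LinearMap.range f = N := by
    rw [LinearMap.range_comp, LinearEquiv.range, Submodule.map_top, Submodule.range_subtype]
  have hk : LinearMap.ker f = ⊥ :=
    LinearMap.ker_eq_bot.2 (N.subtype_injective.comp b.equivFun.symm.injective)
  rw [← hr]
  exact .range f (hk ▸ .bot _)

section Lift

variable {R A : Type*} [CommRing R] [CommRing A] (π : R →+* A) (hπ : Function.Surjective π) (x : R)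
  (hker : RingHom.ker π = Ideal.span {x}) (hx : x ∈ nonZeroDivisors R)
  (hjac : x ∈ Ideal.jacobson (⊥ : Ideal R))

include hker in
lemma exists_eq_smul_of_map_eq_zero {m : ℕ} {v : Fin m → R} (hv : ∀ i, π (v i) = 0) :
    ∃ w, v = x • w := by
  have : ∀ i, ∃ w, v i = x * w := fun i => Ideal.mem_span_singleton'.1
    (hker ▸ (RingHom.mem_ker.2 (hv i)) : v i ∈ Ideal.span {x}) |>.imp fun a h => by rw [← h, mul_comm]
  choose w hw using this
  exact ⟨w, funext hw⟩

include hπ hker hx hjac in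
/-- A submodule of `R^m` saturated with respect to `x` has a finite free resolution if its
reduction modulo `x` has one. -/
lemma HasFFR.of_reduction [IsNoetherianRing R] {m : ℕ} {N' : Submodule A (Fin m → A)}
    (h : HasFFR A N') : ∀ N : Submodule R (Fin m → R), (∀ v, x • v ∈ N → v ∈ N) →
      (∀ v, v ∈ N' ↔ ∃ w ∈ N, (fun i => π (w i)) = v) → HasFFR R N := by
  have hπx : π x = 0 := by
    rw [← RingHom.mem_ker, hker]
    exact Ideal.mem_span_singleton_self x
  have hI : Ideal.span {x} ≤ Ideal.jacobson (⊥ : Ideal R) := by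
    rwa [Ideal.span_le, Set.singleton_subset_iff]
  induction h with
  | bot m =>
    intro N hsat hN
    -- A zero reduction means `N ⊆ x R^m`; saturation improves this to `N ⊆ x N`, and Nakayama
    -- applies.
    have : N = ⊥ := by
      refine Submodule.eq_bot_of_le_smul_of_le_jacobson_bot _ N (IsNoetherian.noetherian N) ?_ hI
      intro v hv
      have h0 := (hN _).2 ⟨v, hv, rfl⟩
      obtain ⟨w, rfl⟩ := exists_eq_smul_of_map_eq_zero π x hker
        (congrFun ((Submodule.mem_bot A).1 h0))
      exact Submodule.smul_mem_smul (Ideal.mem_span_singleton_self x) (hsat w hv)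
    rw [this]
    exact .bot m
  | @range k m f' _ ih =>
    intro N hsat hN
    have h1 : ∀ i : Fin k, ∃ w ∈ N, (fun j => π (w j)) = f' (Pi.single i 1) :=
      fun i => (hN _).1 ⟨_, rfl⟩
    choose n hnN hn using h1
    let f : (Fin k → R) →ₗ[R] (Fin m → R) := Fintype.linearCombination R n
    have hf : ∀ v, (fun j => π (f v j)) = f' (fun i => π (v i)) := fun v => by
      have : (fun i => π (v i)) = ∑ i, π (v i) • Pi.single i (1 : A) := by
        ext i; simp [Finset.sum_apply, Pi.single_apply]
      rw [this, map_sum]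
      ext j
      simp only [f, Fintype.linearCombination_apply, Finset.sum_apply, Pi.smul_apply, smul_eq_mul,
        map_sum, map_mul, map_smul]
      exact Finset.sum_congr rfl fun i _ => by rw [← hn]
    have hfN : LinearMap.range f ≤ N := by
      rintro _ ⟨v, rfl⟩
      rw [Fintype.linearCombination_apply]
      exact Submodule.sum_mem _ fun i _ => Submodule.smul_mem _ _ (hnN i)
    have hNx : ∀ v ∈ N, ∃ u, ∃ w ∈ N, v = f u + x • w := by
      intro v hv
      obtain ⟨u', hu'⟩ := (hN _).2 ⟨v, hv, rfl⟩
      choose u hu using fun i => hπ (u' i)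
      have h2 : ∀ j, π ((v - f u) j) = 0 := fun j => by
        have := congrFun (hf u) j
        simp only [hu] at this
        rw [Pi.sub_apply, map_sub, this, hu', sub_self]
      obtain ⟨w, hw⟩ := exists_eq_smul_of_map_eq_zero π x hker h2
      refine ⟨u, w, hsat w ?_, by rw [← hw]; abel⟩
      rw [← hw]
      exact N.sub_mem hv (hfN ⟨u, rfl⟩)
    -- Nakayama again: lifts of generators of the reduction generate `N`.
    have hrange : LinearMap.range f = N := by
      refine le_antisymm hfN (Submodule.le_of_le_smul_of_le_jacobson_bot
        (IsNoetherian.noetherian N) hI fun v hv => ?_)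
      obtain ⟨u, w, hw, rfl⟩ := hNx v hv
      exact Submodule.add_mem_sup ⟨u, rfl⟩
        (Submodule.smul_mem_smul (Ideal.mem_span_singleton_self x) hw)
    have hreg : ∀ {l : ℕ} (v : Fin l → R), x • v = 0 → v = 0 := fun v hv => by
      ext i
      exact (mem_nonZeroDivisors_iff.1 hx).1 _ (congrFun hv i)
    rw [← hrange]
    -- The induction hypothesis applies to `ker f`. It is saturated since `x` is regular, and its
    -- reduction is all of `ker f'`: a lift `v` of a vector of `ker f'` has `f v = x • w` with `w ∈
    -- N` by saturation, so `w = f u` and `v - x • u` is a lift in `ker f`.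
    refine .range f (ih _ (fun v hv => ?_) fun v' => ⟨fun hv' => ?_, ?_⟩)
    · rw [LinearMap.mem_ker, map_smul] at hv
      exact hreg _ hv
    · choose v hv using fun i => hπ (v' i)
      obtain rfl : (fun i => π (v i)) = v' := funext hv
      rw [LinearMap.mem_ker, ← hf] at hv'
      obtain ⟨w, hw⟩ := exists_eq_smul_of_map_eq_zero π x hker (congrFun hv')
      obtain ⟨u, rfl⟩ := hrange.ge (hsat w (hw ▸ hfN ⟨v, rfl⟩))
      refine ⟨v - x • u, ?_, ?_⟩
      · rw [LinearMap.mem_ker, map_sub, map_smul, hw, sub_self]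
      · ext i
        simp [hπx]
    · rintro ⟨w, hw, rfl⟩
      rw [LinearMap.mem_ker] at hw ⊢
      rw [← hf, hw]
      ext; simp

-- The given submodule need not be saturated. The kernel of a presentation of it is, because `x` is
-- regular, so `HasFFR.of_reduction` is applied one step further along the resolution.
include hπ hker hx hjac in
theorem HasFiniteFreeResolutions.of_reduction [IsNoetherianRing R]
    (h : HasFiniteFreeResolutions A) : HasFiniteFreeResolutions R := by
  intro m N hN
  obtain ⟨k, f, rfl⟩ := hN.exists_range_eq
  let K : Submodule A (Fin k → A) :=
    { carrier := {v | ∃ w ∈ LinearMap.ker f, (fun i => π (w i)) = v}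
      zero_mem' := ⟨0, Submodule.zero_mem _, by ext; simp⟩
      add_mem' := by
        rintro _ _ ⟨v, hv, rfl⟩ ⟨w, hw, rfl⟩
        exact ⟨v + w, Submodule.add_mem _ hv hw, by ext; simp⟩
      smul_mem' := by
        rintro a _ ⟨v, hv, rfl⟩
        obtain ⟨r, rfl⟩ := hπ a
        exact ⟨r • v, Submodule.smul_mem _ _ hv, by ext; simp⟩ }
  have := isNoetherianRing_of_surjective R A π hπ
  refine .range f ((h k K (IsNoetherian.noetherian K)).of_reduction π hπ x hker hx hjac _ ?_
    fun _ => Iff.rfl)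
  intro v hv
  rw [LinearMap.mem_ker, map_smul] at hv
  rw [LinearMap.mem_ker]
  ext i
  exact (mem_nonZeroDivisors_iff.1 hx).1 _ (congrFun hv i)

end Lift

theorem HasFiniteFreeResolutions.powerSeries {A : Type*} [CommRing A] [IsNoetherianRing A]
    (h : HasFiniteFreeResolutions A) : HasFiniteFreeResolutions (PowerSeries A) := by
  refine h.of_reduction PowerSeries.constantCoeff PowerSeries.constantCoeff_surj PowerSeries.X
    ?_ ?_ ?_
  · ext f
    rw [RingHom.mem_ker, Ideal.mem_span_singleton, PowerSeries.X_dvd_iff]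
  · refine mem_nonZeroDivisors_iff.2 ⟨fun f hf => ?_, fun f hf => ?_⟩
    · exact PowerSeries.X_mul_injective (hf.trans (mul_zero _).symm)
    · exact PowerSeries.mul_X_injective (hf.trans (zero_mul _).symm)
  · rw [Ideal.mem_jacobson_bot]
    intro f
    rw [PowerSeries.isUnit_iff_constantCoeff]
    simp

theorem HasFiniteFreeResolutions.mvPowerSeries {A : Type*} [CommRing A] [IsNoetherianRing A]
    (h : HasFiniteFreeResolutions A) (r : ℕ) :
    HasFiniteFreeResolutions (MvPowerSeries (Fin r) A) := by
  induction r with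
  | zero => exact h.of_ringEquiv (MvPowerSeries.isEmptyEquiv (Fin 0) A).toRingEquiv.symm
  | succ r ih => exact ih.powerSeries.of_ringEquiv (MvPowerSeries.finSuccEquiv A r).toRingEquiv.symm

end FiniteFreeResolution

/-! ### Flatness of power series rings over a flat extension of a noetherian ring. -/

section PowerSeriesFlat

open PowerSeries

/-- The sum `∑ X ^ p * n p`, which converges `X`-adically. -/
def PowerSeries.sumXPow {B : Type*} [CommRing B] (n : ℕ → PowerSeries B) : PowerSeries B :=
  .mk fun d => coeff d (∑ p ∈ Finset.range (d + 1), X ^ p * n p)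

lemma PowerSeries.X_pow_dvd_sumXPow_sub {B : Type*} [CommRing B] (n : ℕ → PowerSeries B) (P : ℕ) :
    X ^ P ∣ sumXPow n - ∑ p ∈ Finset.range P, X ^ p * n p := by
  rw [X_pow_dvd_iff]
  intro d hd
  rw [map_sub, sumXPow, coeff_mk, sub_eq_zero]
  rw [← Finset.sum_sdiff (Finset.range_mono (Nat.succ_le_of_lt hd)), map_add, map_sum _ _ (_ \ _)]
  refine (add_eq_right.2 (Finset.sum_eq_zero fun p hp => ?_)).symm
  rw [coeff_X_pow_mul', if_neg]
  simp only [Finset.mem_sdiff, Finset.mem_range] at hp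
  omega

lemma PowerSeries.eq_zero_of_X_pow_dvd {B : Type*} [CommRing B] {f : PowerSeries B}
    (h : ∀ n, X ^ n ∣ f) : f = 0 := by
  ext d
  exact X_pow_dvd_iff.1 (h (d + 1)) d (Nat.lt_succ_self d)

lemma PowerSeries.coeff_sum_mul {C : Type*} [CommRing C] {l N : ℕ} (b c : Fin l → PowerSeries C)
    (d : Fin N) : coeff d (∑ i, b i * c i) = ∑ ij : Fin l × Fin N,
      (if ij.2.1 ≤ d.1 then coeff (d.1 - ij.2.1) (b ij.1) else 0) * coeff ij.2 (c ij.1) := by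
  rw [map_sum, Fintype.sum_prod_type]
  refine Finset.sum_congr rfl fun i _ => ?_
  rw [mul_comm, coeff_mul, Finset.Nat.sum_antidiagonal_eq_sum_range_succ_mk]
  refine Eq.trans ?_ (Fin.sum_univ_eq_sum_range (fun j => (if j ≤ d.1 then coeff (d.1 - j) (b i)
    else 0) * coeff j (c i)) N).symm
  rw [← Finset.sum_subset (Finset.range_mono (Nat.succ_le_of_lt d.2))]
  · refine Finset.sum_congr rfl fun j hj => ?_
    rw [if_pos (by simpa [Nat.lt_succ_iff] using hj), mul_comm]
  · intro j _ hj
    rw [if_neg (by simpa [Nat.lt_succ_iff] using hj), zero_mul]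

variable {A B : Type*} [CommRing A] [CommRing B] [Algebra A B]

/-- A relation modulo `X ^ N` with coefficients in a flat algebra comes from relations
modulo `X ^ N` over the base. -/
lemma PowerSeries.exists_of_X_pow_dvd_sum [Module.Flat A B] {l : ℕ} (a : Fin l → PowerSeries A)
    (z : Fin l → PowerSeries B) (N : ℕ)
    (h : X ^ N ∣ ∑ i, PowerSeries.map (algebraMap A B) (a i) * z i) :
    ∃ (k : ℕ) (v : Fin k → Fin l → PowerSeries A) (y : Fin k → PowerSeries B)
      (z' : Fin l → PowerSeries B),
      (∀ t, X ^ N ∣ ∑ i, a i * v t i) ∧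
      ∀ i, z i = ∑ t, PowerSeries.map (algebraMap A B) (v t i) * y t + X ^ N * z' i := by
  rw [X_pow_dvd_iff] at h
  -- Modulo `X ^ N` the relation is a linear system over `A` in the `l * N` lowest coefficients of
  -- the `z i`; `F d` is the equation in degree `d`. Flatness of `B` over `A` solves this system.
  let F (d : Fin N) (ij : Fin l × Fin N) : A :=
    if ij.2.1 ≤ d.1 then coeff (d.1 - ij.2.1) (a ij.1) else 0
  let f : (Fin N → A) →ₗ[A] (Fin l × Fin N → A) := Fintype.linearCombination A F
  let x : (Fin l × Fin N → A) →ₗ[A] B := Fintype.linearCombination A fun ij => coeff ij.2 (z ij.1)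
  have hxf : x ∘ₗ f = 0 := by
    refine LinearMap.pi_ext' fun d => LinearMap.ext_ring ?_
    have h1 := h d d.2
    rw [coeff_sum_mul] at h1
    simp only [LinearMap.comp_apply, LinearMap.single_apply, f, x,
      Fintype.linearCombination_apply_single, one_smul, LinearMap.zero_apply]
    rw [Fintype.linearCombination_apply, ← h1]
    refine Finset.sum_congr rfl fun ij _ => ?_
    rw [Algebra.smul_def]
    congr 1
    simp only [F]
    split_ifs <;> simp
  obtain ⟨k, a', y, hxy, haf⟩ := Module.Flat.exists_factorization_of_comp_eq_zero_of_free hxf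
  let v (t : Fin k) (i : Fin l) : PowerSeries A :=
    .mk fun j => if hj : j < N then a' (Pi.single (i, ⟨j, hj⟩) 1) t else 0
  have hv : ∀ t i (j : Fin N), coeff j (v t i) = a' (Pi.single (i, j) 1) t := fun t i j => by
    simp [v]
  have hz : ∀ i, X ^ N ∣ z i -
      ∑ t, PowerSeries.map (algebraMap A B) (v t i) * C (y (Finsupp.single t 1)) := by
    intro i
    rw [X_pow_dvd_iff]
    intro j hj
    rw [map_sub, sub_eq_zero, map_sum]
    have h1 : x (Pi.single (i, ⟨j, hj⟩) 1) = coeff j (z i) := by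
      simp [x, Fintype.linearCombination_apply_single]
    rw [← h1, hxy, LinearMap.comp_apply]
    conv_lhs => rw [← Finsupp.univ_sum_single (a' (Pi.single (i, ⟨j, hj⟩) 1))]
    rw [map_sum]
    refine Finset.sum_congr rfl fun t _ => ?_
    rw [coeff_mul_C, coeff_map, hv t i ⟨j, hj⟩, ← Algebra.smul_def, ← map_smul, Finsupp.smul_single,
      smul_eq_mul, mul_one]
  choose z' hz' using hz
  refine ⟨k, v, fun t => C (y (Finsupp.single t 1)), z', fun t => ?_, fun i => ?_⟩
  · rw [X_pow_dvd_iff]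
    intro d hd
    have h1 := coeff_sum_mul a (v t) ⟨d, hd⟩
    rw [show coeff d (∑ i, a i * v t i) = _ from h1]
    have h2 := DFunLike.congr_fun (LinearMap.congr_fun haf (Pi.single ⟨d, hd⟩ 1)) t
    have h3 : f (Pi.single ⟨d, hd⟩ 1) = ∑ ij, F ⟨d, hd⟩ ij • Pi.single ij 1 := by
      ext ij
      simp [f, Fintype.linearCombination_apply_single, Finset.sum_apply, Pi.single_apply]
    rw [LinearMap.comp_apply, h3, map_sum, Finsupp.finsetSum_apply] at h2
    refine Eq.trans (Finset.sum_congr rfl fun ij _ => ?_) h2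
    rw [hv, map_smul]
    rfl
  · rw [← hz']; ring

/-- `B⟦X⟧` is in general only a completion of `A⟦X⟧ ⊗_A B`, so a relation `∑ a_i z_i = 0` is
trivialized by successive approximation. Up to `X` times another solution `z'`, the vector `z` is a
combination of the generators `g` of the relations over `A⟦X⟧`; iterating and summing `X`-adically
makes the remainder disappear. -/
theorem PowerSeries.flat_map [IsNoetherianRing A] [Module.Flat A B] :
    (PowerSeries.map (algebraMap A B)).Flat := by
  let _ : Algebra (PowerSeries A) (PowerSeries B) := (PowerSeries.map (algebraMap A B)).toAlgebra
  refine Module.Flat.of_forall_isTrivialRelation fun {l a z} haz => ?_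
  change ∑ i, PowerSeries.map (algebraMap A B) (a i) * z i = 0 at haz
  let f : (Fin l → PowerSeries A) →ₗ[PowerSeries A] PowerSeries A :=
    Fintype.linearCombination (PowerSeries A) a
  have hf : ∀ v, f v = ∑ i, a i * v i := fun v => by
    simp [f, Fintype.linearCombination_apply, mul_comm]
  -- The Artin–Rees constant of the ideal generated by the `a_i`.
  obtain ⟨c, hc⟩ := Ideal.exists_pow_inf_eq_pow_smul (Ideal.span {(X : PowerSeries A)})
    (LinearMap.range f)
  obtain ⟨s, g, hg⟩ := Submodule.FG.exists_range_eq (IsNoetherian.noetherian (LinearMap.ker f))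
  have hgker : ∀ j, f (g (Pi.single j 1)) = 0 := fun j => hg.le ⟨_, rfl⟩
  have step : ∀ z : Fin l → PowerSeries B,
      ∑ i, PowerSeries.map (algebraMap A B) (a i) * z i = 0 →
      ∃ (n : Fin s → PowerSeries B) (z' : Fin l → PowerSeries B),
        (∑ i, PowerSeries.map (algebraMap A B) (a i) * z' i = 0) ∧
        ∀ i, z i = ∑ j, PowerSeries.map (algebraMap A B) (g (Pi.single j 1) i) * n j +
          X * z' i := by
    intro z hz
    -- With precision `c + 1`, Artin–Rees gives `f (v t) = X * f (w t)`, so `v t - X • w t` is an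
    -- exact relation over `A⟦X⟧`.
    obtain ⟨k, v, y, z', hv, hz'⟩ := exists_of_X_pow_dvd_sum a z (c + 1) (hz ▸ dvd_zero _)
    have hw : ∀ t, ∃ w, f (v t) = X * f w := by
      intro t
      have h1 : f (v t) ∈ Ideal.span {(X : PowerSeries A)} ^ (c + 1) •
          (⊤ : Submodule (PowerSeries A) (PowerSeries A)) ⊓ LinearMap.range f := by
        refine ⟨?_, ⟨_, rfl⟩⟩
        rw [Ideal.span_singleton_pow, smul_eq_mul, Ideal.mul_top, SetLike.mem_coe,
          Ideal.mem_span_singleton, hf]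
        exact hv t
      rw [hc _ (Nat.le_succ c), Nat.succ_sub le_rfl, Nat.sub_self, pow_one] at h1
      rw [Submodule.ideal_span_singleton_smul] at h1
      obtain ⟨_, ⟨-, ⟨w, rfl⟩⟩, hw⟩ := h1
      exact ⟨w, hw.symm⟩
    choose w hw using hw
    have hk : ∀ t, ∃ u, g u = v t - (X : PowerSeries A) • w t := fun t => hg.ge (by
      have h1 : f (v t - (X : PowerSeries A) • w t) = f (v t) - (X : PowerSeries A) • f (w t) := by
        rw [map_sub, LinearMap.map_smul]
      exact h1.trans (by rw [hw, smul_eq_mul, sub_self]))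
    choose u hu using hk
    let z1 : Fin l → PowerSeries B := fun i =>
      ∑ t, PowerSeries.map (algebraMap A B) (w t i) * y t + X ^ c * z' i
    have hz1 : ∀ i, z i = ∑ j, PowerSeries.map (algebraMap A B) (g (Pi.single j 1) i) *
        (∑ t, PowerSeries.map (algebraMap A B) (u t j) * y t) + X * z1 i := by
      intro i
      have h2 : ∀ t, v t i = ∑ j, g (Pi.single j 1) i * u t j + X * w t i := fun t => by
        have h3 := LinearMap.pi_apply_eq_sum g (u t) i
        rw [← h3, hu t]
        exact (sub_add_cancel (v t i) (X * w t i)).symm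
      rw [hz']
      simp only [h2, map_add, map_sum, map_mul, PowerSeries.map_X, z1, add_mul, Finset.sum_mul,
        Finset.mul_sum, mul_add, Finset.sum_add_distrib]
      rw [Finset.sum_comm, add_assoc]
      simp only [mul_assoc, pow_succ']
    refine ⟨_, z1, ?_, hz1⟩
    refine X_mul_injective (Eq.trans ?_ (mul_zero X).symm)
    rw [← hz]
    have h3 : ∀ i, X * z1 i = z i - ∑ j, PowerSeries.map (algebraMap A B) (g (Pi.single j 1) i) *
        (∑ t, PowerSeries.map (algebraMap A B) (u t j) * y t) := fun i => by rw [hz1 i]; ring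
    simp only [Finset.mul_sum]
    simp only [mul_left_comm X, h3, mul_sub, Finset.sum_sub_distrib]
    rw [sub_eq_self]
    simp only [Finset.mul_sum]
    rw [Finset.sum_comm]
    refine Finset.sum_eq_zero fun j _ => ?_
    rw [Finset.sum_comm]
    refine Finset.sum_eq_zero fun t _ => ?_
    simp only [← mul_assoc, ← Finset.sum_mul, ← map_mul, ← map_sum]
    rw [← hf, hgker]
    simp
  choose! n z' hz'0 hz' using step
  -- The successive remainders, each again a solution of the relation.
  let Z : ℕ → Fin l → PowerSeries B := fun p => z'^[p] z
  have hZ : ∀ p, ∑ i, PowerSeries.map (algebraMap A B) (a i) * Z p i = 0 := fun p => by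
    induction p with
    | zero => exact haz
    | succ p ih =>
      simp only [Z, Function.iterate_succ_apply']
      exact hz'0 _ ih
  have hsumZ : ∀ P i, z i = ∑ j, PowerSeries.map (algebraMap A B) (g (Pi.single j 1) i) *
      (∑ p ∈ Finset.range P, X ^ p * n (Z p) j) + X ^ P * Z P i := by
    intro P i
    induction P with
    | zero => simp [Z]
    | succ P ih =>
      have h1 : Z (P + 1) = z' (Z P) := Function.iterate_succ_apply' _ _ _
      conv_lhs => rw [ih, hz' _ (hZ P) i]
      simp only [Finset.sum_range_succ, mul_add, Finset.sum_add_distrib, h1, Finset.mul_sum,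
        pow_succ]
      rw [add_assoc]
      congr 2
      · exact Finset.sum_congr rfl fun j _ => by ring
      · ring
  refine ⟨s, fun i j => g (Pi.single j 1) i, fun j => sumXPow fun p => n (Z p) j, fun i => ?_,
    fun j => by rw [← hf, hgker]⟩
  change z i = ∑ j, PowerSeries.map (algebraMap A B) (g (Pi.single j 1) i) * _
  rw [← sub_eq_zero]
  refine eq_zero_of_X_pow_dvd fun P => ?_
  have h1 : z i - ∑ j, PowerSeries.map (algebraMap A B) (g (Pi.single j 1) i) *
      sumXPow (fun p => n (Z p) j) = X ^ P * Z P i -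
      ∑ j, PowerSeries.map (algebraMap A B) (g (Pi.single j 1) i) *
        (sumXPow (fun p => n (Z p) j) - ∑ p ∈ Finset.range P, X ^ p * n (Z p) j) := by
    conv_lhs => rw [hsumZ P i]
    simp only [mul_sub, Finset.sum_sub_distrib]
    ring
  rw [h1]
  exact dvd_sub (dvd_mul_right _ _) (Finset.dvd_sum fun j _ =>
    (X_pow_dvd_sumXPow_sub _ P).mul_left _)

lemma MvPowerSeries.finSuccEquiv_map {A B : Type*} [CommRing A] [CommRing B] (φ : A →+* B) (r : ℕ)
    (f : MvPowerSeries (Fin (r + 1)) A) : MvPowerSeries.finSuccEquiv B r (MvPowerSeries.map φ f) =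
      PowerSeries.map (MvPowerSeries.map φ) (MvPowerSeries.finSuccEquiv A r f) := by
  ext k x
  rw [MvPowerSeries.coeff_coeff_finSuccEquiv, PowerSeries.coeff_map, MvPowerSeries.coeff_map,
    MvPowerSeries.coeff_map, MvPowerSeries.coeff_coeff_finSuccEquiv]

theorem MvPowerSeries.flat_map {A B : Type*} [CommRing A] [CommRing B] [IsNoetherianRing A]
    (φ : A →+* B) (hφ : φ.Flat) (r : ℕ) :
    (MvPowerSeries.map φ : MvPowerSeries (Fin r) A →+* MvPowerSeries (Fin r) B).Flat := by
  induction r with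
  | zero =>
    have : (MvPowerSeries.map φ : MvPowerSeries (Fin 0) A →+* MvPowerSeries (Fin 0) B) =
        ((MvPowerSeries.isEmptyEquiv (Fin 0) B).symm.toRingEquiv.toRingHom.comp φ).comp
          (MvPowerSeries.isEmptyEquiv (Fin 0) A).toRingEquiv.toRingHom := by
      ext f d
      obtain rfl : d = 0 := Subsingleton.elim _ _
      simp [MvPowerSeries.isEmptyEquiv]
    rw [this]
    exact (RingHom.Flat.of_bijective (MvPowerSeries.isEmptyEquiv (Fin 0) A).bijective).comp
      (hφ.comp (RingHom.Flat.of_bijective (MvPowerSeries.isEmptyEquiv (Fin 0) B).symm.bijective))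
  | succ r ih =>
    have : (MvPowerSeries.map φ : MvPowerSeries (Fin (r + 1)) A →+* MvPowerSeries (Fin (r + 1)) B) =
        ((MvPowerSeries.finSuccEquiv B r).symm.toRingEquiv.toRingHom.comp
          (PowerSeries.map (MvPowerSeries.map φ))).comp
          (MvPowerSeries.finSuccEquiv A r).toRingEquiv.toRingHom := by
      ext1 f
      exact ((MvPowerSeries.finSuccEquiv B r).symm_apply_eq.2
        (MvPowerSeries.finSuccEquiv_map φ r f).symm).symm
    rw [this]
    let _ := (MvPowerSeries.map φ : MvPowerSeries (Fin r) A →+* MvPowerSeries (Fin r) B).toAlgebra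
    have : Module.Flat (MvPowerSeries (Fin r) A) (MvPowerSeries (Fin r) B) := ih
    exact (RingHom.Flat.of_bijective (MvPowerSeries.finSuccEquiv A r).bijective).comp
      (RingHom.Flat.comp PowerSeries.flat_map
        (RingHom.Flat.of_bijective (MvPowerSeries.finSuccEquiv B r).symm.bijective))

end PowerSeriesFlat

/-! ### Flatness and regularity for condensed rings. -/

namespace CondensedCommRing

/-- All rings of sections are flat over the underlying ring, and finitely generated submodules of
finite free modules over the underlying ring have finite free resolutions. -/
def IsFlatRegular (R : CondensedCommRing.{u}) : Prop :=
  HasFiniteFreeResolutions R.underlying ∧ ∀ S : CompHaus.{u}, (R.toSections S).Flat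

lemma IsFlatRegular.isTAdmissible {R : CondensedCommRing.{u}} (h : R.IsFlatRegular) :
    R.IsTAdmissible :=
  ⟨h.1.isRegularCoherent, fun S => h.2 S.compHaus⟩

/-- The ring isomorphism on sections over `S` induced by an isomorphism of condensed rings. -/
def sectionsEquiv {R R' : CondensedCommRing.{u}} (e : R ≅ R') (S : CompHaus.{u}ᵒᵖ) :
    R.obj.obj S ≃+* R'.obj.obj S :=
  (((sheafToPresheaf _ _).mapIso e).app S).commRingCatIsoToRingEquiv

lemma toSections_sectionsEquiv {R R' : CondensedCommRing.{u}} (e : R ≅ R') (S : CompHaus.{u})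
    (x : R.underlying) : R'.toSections S (sectionsEquiv e _ x) =
      sectionsEquiv e _ (R.toSections S x) :=
  congr($(e.hom.hom.naturality (CompHausLike.ofHom _ (ContinuousMap.const S PUnit.unit) :
    S ⟶ point).op).hom x).symm

lemma IsFlatRegular.of_iso {R R' : CondensedCommRing.{u}} (e : R ≅ R') (h : R.IsFlatRegular) :
    R'.IsFlatRegular := by
  refine ⟨h.1.of_ringEquiv (sectionsEquiv e _), fun S => ?_⟩
  have : R'.toSections S = ((sectionsEquiv e (op S)).toRingHom.comp (R.toSections S)).comp
      (sectionsEquiv e (op point)).symm.toRingHom := by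
    ext x
    obtain ⟨y, rfl⟩ := (sectionsEquiv e (op point)).surjective x
    rw [toSections_sectionsEquiv]
    simp
  rw [this]
  exact (RingHom.Flat.of_bijective (sectionsEquiv e (op point)).symm.bijective).comp
    ((h.2 S).comp (RingHom.Flat.of_bijective (sectionsEquiv e (op S)).bijective))

/-- The underlying ring of the condensed ring attached to a topological ring. -/
def underlyingOfTop (A : TopCommRingCat.{u + 1}) : (ofTop.{u}.obj A).underlying ≃+* A where
  toFun f := DFunLike.coe (F := C(PUnit.{u + 1}, A)) f PUnit.unit
  invFun a := (ContinuousMap.const PUnit a : C(PUnit, A))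
  left_inv f := by
    refine ContinuousMap.ext (X := PUnit.{u + 1}) fun _ => ?_
    rfl
  right_inv _ := rfl
  map_mul' _ _ := rfl
  map_add' _ _ := rfl

lemma isFlatRegular_ofTop (A : TopCommRingCat.{u + 1}) (h : HasFiniteFreeResolutions A)
    (hA : ∀ S : CompHaus.{u}, (algebraMap A C(S, A)).Flat) : (ofTop.{u}.obj A).IsFlatRegular := by
  refine ⟨h.of_ringEquiv (underlyingOfTop A).symm, fun S => ?_⟩
  have : (ofTop.{u}.obj A).toSections S =
      RingHom.comp (algebraMap A C(S, A)) (underlyingOfTop A).toRingHom := by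
    ext x
    refine ContinuousMap.ext fun s => ?_
    rfl
  rw [this]
  exact (RingHom.Flat.of_bijective (underlyingOfTop A).bijective).comp (hA S)

end CondensedCommRing

/-- Functions with values in a domain have no torsion, and torsion-free modules over a principal
ideal domain are flat. -/
lemma flat_algebraMap_continuousMap_of_isPrincipalIdealRing (A : Type*) [CommRing A] [IsDomain A]
    [IsPrincipalIdealRing A] [TopologicalSpace A] [IsTopologicalRing A] (S : Type*)
    [TopologicalSpace S] : (algebraMap A C(S, A)).Flat := by
  have : Module.IsTorsionFree A C(S, A) := by
    refine ⟨fun a ha f g h => ?_⟩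
    ext s
    exact ha.left congr($h s)
  rw [RingHom.flat_algebraMap_iff]
  infer_instance

/-! ### Continuous functions with values in power series. -/

section MvPowerSeries

open scoped MvPowerSeries.WithPiTopology

/-- The power series of continuous functions attached to a continuous function with values in
power series. -/
def MvPowerSeries.ofContinuousMap {σ A S : Type*} [CommRing A] [TopologicalSpace A]
    [TopologicalSpace S] (f : C(S, MvPowerSeries σ A)) : MvPowerSeries σ C(S, A) :=
  fun d => ⟨fun s => MvPowerSeries.coeff d (f s),
    (MvPowerSeries.WithPiTopology.continuous_coeff A d).comp f.continuous⟩

/-- Continuous functions with values in power series are power series of continuous functions. -/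
def MvPowerSeries.continuousMapEquiv (σ A S : Type*) [CommRing A] [TopologicalSpace A]
    [IsTopologicalRing A] [TopologicalSpace S] :
    C(S, MvPowerSeries σ A) ≃+* MvPowerSeries σ C(S, A) where
  toFun := ofContinuousMap
  invFun f := ⟨fun s => fun d => (MvPowerSeries.coeff d f) s,
    continuous_pi fun d => (MvPowerSeries.coeff d f).continuous⟩
  left_inv _ := rfl
  right_inv _ := rfl
  map_mul' f g := by
    classical
    ext d s
    change MvPowerSeries.coeff d (f s * g s) =
      (MvPowerSeries.coeff d (ofContinuousMap f * ofContinuousMap g) : C(S, A)) s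
    rw [MvPowerSeries.coeff_mul, MvPowerSeries.coeff_mul, ContinuousMap.sum_apply]
    rfl
  map_add' _ _ := rfl

/-- Through `C(S, A⟦x⟧) = C(S, A)⟦x⟧` the structure map becomes the coefficientwise extension of `A
→ C(S, A)`. -/
lemma MvPowerSeries.flat_algebraMap_continuousMap (r : ℕ) (A S : Type*) [CommRing A]
    [TopologicalSpace A] [IsTopologicalRing A] [TopologicalSpace S] [IsNoetherianRing A]
    (h : (algebraMap A C(S, A)).Flat) :
    (algebraMap (MvPowerSeries (Fin r) A) C(S, MvPowerSeries (Fin r) A)).Flat := by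
  have : algebraMap (MvPowerSeries (Fin r) A) C(S, MvPowerSeries (Fin r) A) =
      (continuousMapEquiv (Fin r) A S).symm.toRingHom.comp
        (MvPowerSeries.map (algebraMap A C(S, A))) := rfl
  rw [this]
  exact (MvPowerSeries.flat_map _ h r).comp
    (RingHom.Flat.of_bijective (continuousMapEquiv (Fin r) A S).symm.bijective)

/-- The topological ring of power series in `r` variables. -/
abbrev topMvPowerSeries (r : ℕ) (A : TopCommRingCat.{w}) : TopCommRingCat.{w} :=
  .of (MvPowerSeries (Fin r) A)

lemma CondensedCommRing.isFlatRegular_topMvPowerSeries (r : ℕ) (A : TopCommRingCat.{u + 1})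
    [IsDomain A] [IsPrincipalIdealRing A] :
    (ofTop.{u}.obj (topMvPowerSeries r A)).IsFlatRegular :=
  isFlatRegular_ofTop _ ((hasFiniteFreeResolutions_of_isPrincipalIdealRing A).mvPowerSeries r)
    fun S => MvPowerSeries.flat_algebraMap_continuousMap r A S
      (flat_algebraMap_continuousMap_of_isPrincipalIdealRing A S)

lemma CondensedCommRing.isFlatRegular_ofTop_of_isPrincipalIdealRing (A : TopCommRingCat.{u + 1})
    [IsDomain A] [IsPrincipalIdealRing A] : (ofTop.{u}.obj A).IsFlatRegular :=
  isFlatRegular_ofTop _ (hasFiniteFreeResolutions_of_isPrincipalIdealRing A)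
    fun S => flat_algebraMap_continuousMap_of_isPrincipalIdealRing A S

end MvPowerSeries

/-! ### Sheaves under flat base change, and pushouts of condensed rings. -/

namespace CondensedCommRing

lemma flat_of_isPushout {A B C D : CommRingCat.{w}} {f : A ⟶ B} {g : A ⟶ C} {h : B ⟶ D}
    {k : C ⟶ D} (sq : IsPushout f g h k) (hf : f.hom.Flat) : k.hom.Flat := by
  algebraize [f.hom, g.hom, h.hom, k.hom, h.hom.comp f.hom]
  have : IsScalarTower A C D := .of_algebraMap_eq' congr($(sq.w).hom)
  have := (CommRingCat.isPushout_iff_isPushout (R := A) (S := C) (R' := B) (S' := D)).1 sq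
  exact RingHom.Flat.isStableUnderBaseChange A B C D hf

variable {F H : CompHaus.{u}ᵒᵖ ⥤ CommRingCat.{u + 1}}

/-- The map `F(*) → F(S)`. -/
abbrev constMap (F : CompHaus.{u}ᵒᵖ ⥤ CommRingCat.{u + 1}) (S : CompHaus.{u}ᵒᵖ) :
    F.obj (op point) ⟶ F.obj S :=
  F.map (CompHausLike.ofHom _ (ContinuousMap.const S.unop PUnit.unit) : S.unop ⟶ point).op

lemma constMap_map (F : CompHaus.{u}ᵒᵖ ⥤ CommRingCat.{u + 1}) {S S' : CompHaus.{u}ᵒᵖ}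
    (f : S ⟶ S') : constMap F S ≫ F.map f = constMap F S' := by
  rw [← F.map_comp]
  rfl

/-- Naturality of the isomorphism from a given pushout to the chosen one, in the form used by
`isSheaf_pushout`. -/
lemma desc_isoPushout_inv {C : Type*} [Category* C] {A B X Y X' Y' : C} {b : A ⟶ B}
    {c : A ⟶ X} {i : X ⟶ Y} {j : B ⟶ Y} {c' : A ⟶ X'} {i' : X' ⟶ Y'} {j' : B ⟶ Y'}
    [HasPushout c b] [HasPushout c' b] (sq : IsPushout c b i j)
    (sq' : IsPushout c' b i' j') (φ : X ⟶ X') (ψ : Y ⟶ Y')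
    (h : φ ≫ i' = i ≫ ψ) (h' : j ≫ ψ = j')
    (w : c ≫ φ ≫ pushout.inl c' b = b ≫ pushout.inr c' b) :
    pushout.desc (φ ≫ pushout.inl c' b) (pushout.inr c' b) w ≫ sq'.isoPushout.inv =
      sq.isoPushout.inv ≫ ψ := by
  apply pushout.hom_ext
  · rw [pushout.inl_desc_assoc, Category.assoc, IsPushout.inl_isoPushout_inv,
      IsPushout.inl_isoPushout_inv_assoc, h]
  · rw [pushout.inr_desc_assoc, IsPushout.inr_isoPushout_inv, IsPushout.inr_isoPushout_inv_assoc, h']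

/-- `H` is `F ⊗_A B` with constant rings `A` and `B`. On `CompHaus` the sheaf condition for the
coherent topology involves only finite limits, and these are preserved by base change along the flat
map `A → B`. -/
lemma isSheaf_pushout {A B : CommRingCat.{u + 1}} (b : A ⟶ B) (hb : b.hom.Flat)
    (hF : Presheaf.IsSheaf (coherentTopology CompHaus.{u}) F)
    (c : ∀ S, A ⟶ F.obj S) (hc : ∀ {S S'} (f : S ⟶ S'), c S ≫ F.map f = c S')
    (i : F ⟶ H) (j : ∀ S, B ⟶ H.obj S) (hj : ∀ {S S'} (f : S ⟶ S'), j S ≫ H.map f = j S')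
    (sq : ∀ S, IsPushout (c S) b (i.app S) (j S)) :
    Presheaf.IsSheaf (coherentTopology CompHaus.{u}) H := by
  let FU : CompHaus.{u}ᵒᵖ ⥤ Under A := F.toUnder A c hc
  have hFU : Presheaf.IsSheaf (coherentTopology CompHaus.{u}) FU :=
    Presheaf.isSheaf_coherent_of_hasPullbacks_of_comp FU (Under.forget A) hF
  have := CommRingCat.Under.preservesFiniteLimits_of_flat b hb
  have h1 := Presheaf.isSheaf_coherent_of_hasPullbacks_comp FU (Under.pushout b ⋙ Under.forget B) hFU
  refine (Presheaf.isSheaf_of_iso_iff ?_).1 h1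
  refine NatIso.ofComponents (fun S => (sq S).isoPushout.symm) fun {S S'} f => ?_
  exact desc_isoPushout_inv (sq S) (sq S') (F.map f) (H.map f) (i.naturality f) (hj f) _

section

variable {L R L' : CondensedCommRing.{u}} (f : L ⟶ R) (g : L ⟶ L')
  (hg : (g.hom.app (op point)).hom.Flat)
  (hpo : ∀ S, IsPushout (constMap L.obj S) (g.hom.app (op point)) (g.hom.app S) (constMap L'.obj S))

include hg hpo in
/-- If `L'` is the tensor product of `L` with the flat `L(*)`-algebra `L'(*)`, then the sections of
a pushout along `L → L'` are the pushouts of the sections. -/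
lemma exists_isPushout_sections : ∃ (X : CondensedCommRing.{u}) (i : R ⟶ X) (j : L' ⟶ X),
    IsPushout f g i j ∧
      ∀ S, IsPushout (f.hom.app S) (g.hom.app S) (i.hom.app S) (j.hom.app S) := by
  have sqH := IsPushout.of_hasPushout f.hom g.hom
  have sqS : ∀ S, IsPushout (f.hom.app S) (g.hom.app S) ((pushout.inl f.hom g.hom).app S)
    ((pushout.inr f.hom g.hom).app S) := fun S => sqH.map ((evaluation _ _).obj S)
  -- Pasting squares gives `R(S) ⊗_{L(S)} L'(S) = R(S) ⊗_{L(*)} L'(*)`, so the presheaf pushout is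
  -- already a sheaf.
  have hH := isSheaf_pushout (g.hom.app (op point)) hg R.property
    (fun S => constMap L.obj S ≫ f.hom.app S)
    (fun h => by rw [Category.assoc, ← f.hom.naturality, ← Category.assoc, constMap_map])
    (pushout.inl f.hom g.hom)
    (fun S => constMap L'.obj S ≫ (pushout.inr f.hom g.hom).app S)
    (fun h => by rw [Category.assoc, ← NatTrans.naturality, ← Category.assoc, constMap_map])
    (fun S => (hpo S).paste_horiz (sqS S))
  refine ⟨⟨_, hH⟩, ⟨pushout.inl f.hom g.hom⟩, ⟨pushout.inr f.hom g.hom⟩, ?_, sqS⟩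
  exact IsPushout.of_map (sheafToPresheaf _ _) (ObjectProperty.hom_ext _ sqH.w) sqH

-- Pasting and cancelling squares yields `X(S) = R(S) ⊗_{R(*)} X(*)` for the pushout `X`. Flatness
-- of `X(S)` over `X(*)` is therefore base changed from `R`, and only the underlying ring `X(*)`
-- needs a separate argument.
include hg hpo in
theorem isFlatRegular_pushout (hR : ∀ S : CompHaus.{u}, (R.toSections S).Flat)
    (hP : ∀ (X : CommRingCat.{u + 1}) (i : R.underlying ⟶ X) (j : L'.underlying ⟶ X),
      IsPushout (f.hom.app (op point)) (g.hom.app (op point)) i j → HasFiniteFreeResolutions X) :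
    (pushout f g).IsFlatRegular := by
  obtain ⟨X, i, j, sq, sqS⟩ := exists_isPushout_sections f g hg hpo
  refine IsFlatRegular.of_iso sq.isoPushout ⟨hP _ _ _ (sqS (op point)), fun S => ?_⟩
  have h1 := (hpo (op S)).paste_horiz (sqS (op S))
  have h2 : constMap L.obj (op S) ≫ f.hom.app (op S) =
    f.hom.app (op point) ≫ constMap R.obj (op S) := (f.hom.naturality _)
  have h3 : constMap L'.obj (op S) ≫ j.hom.app (op S) =
    j.hom.app (op point) ≫ constMap X.obj (op S) := (j.hom.naturality _)
  rw [h2, h3] at h1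
  exact flat_of_isPushout (IsPushout.of_left h1 (i.hom.naturality _) (sqS (op point))) (hR S)

omit hg in
include hpo in
theorem isFlatRegular_of_isPushout (hL : ∀ S : CompHaus.{u}, (L.toSections S).Flat)
    (hL' : HasFiniteFreeResolutions L'.underlying) : L'.IsFlatRegular :=
  ⟨hL', fun S => flat_of_isPushout (hpo (op S)) (hL S)⟩

end

end CondensedCommRing

/-! ### Pushouts of rings recognized by bases. -/

section Basis

/-- The family `b` is a basis of `B` as a module over `A` via the ring map `g`. -/
def RingHom.IsBasis {A B ι : Type*} [CommRing A] [CommRing B] (g : A →+* B) (b : ι → B) : Prop :=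
  Function.Bijective fun c : ι →₀ A => c.sum fun i a => g a * b i

namespace RingHom.IsBasis

variable {A B ι : Type*} [CommRing A] [CommRing B] {g : A →+* B} {b : ι → B}

/-- The basis in the sense of linear algebra. -/
def toBasis (h : g.IsBasis b) : letI := g.toAlgebra; Module.Basis ι A B :=
  letI := g.toAlgebra
  .ofRepr (LinearEquiv.ofBijective (Finsupp.linearCombination A b) h).symm

lemma toBasis_apply (h : g.IsBasis b) (i : ι) : letI := g.toAlgebra; h.toBasis i = b i := by
  let _ := g.toAlgebra
  exact (Finsupp.linearCombination_single A (1 : A) i).trans (one_smul A _)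

lemma mk (hspan : ∀ x, ∃ c : ι →₀ A, (c.sum fun i a => g a * b i) = x)
    (hinj : ∀ c : ι →₀ A, (c.sum fun i a => g a * b i) = 0 → c = 0) : g.IsBasis b := by
  let _ := g.toAlgebra
  exact ⟨(injective_iff_map_eq_zero (Finsupp.linearCombination A b)).2 hinj, hspan⟩

lemma eq_zero (h : g.IsBasis b) (c : ι →₀ A) (hc : (c.sum fun i a => g a * b i) = 0) : c = 0 :=
  h.1 (hc.trans (by simp))

/-- The coordinates of an element. -/
def coord (h : g.IsBasis b) (x : B) : ι →₀ A := (Equiv.ofBijective _ h).symm x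

lemma sum_coord (h : g.IsBasis b) (x : B) : ((h.coord x).sum fun i a => g a * b i) = x :=
  (Equiv.ofBijective _ h).apply_symm_apply x

lemma finset_sum_coord [Fintype ι] (h : g.IsBasis b) (x : B) : ∑ i, g (h.coord x i) * b i = x := by
  rw [← Finsupp.sum_fintype _ (fun i a => g a * b i) (by simp), h.sum_coord]

end RingHom.IsBasis

/-- The map `M ⊗_A B → N` carries the base change of one basis to the other basis, so it is
bijective. -/
lemma CommRingCat.isPushout_of_isBasis {A B M N : CommRingCat.{w}} {f : A ⟶ M} {g : A ⟶ B}
    {h : M ⟶ N} {k : B ⟶ N} (sq : f ≫ h = g ≫ k) {ι : Type*} {b : ι → B} (hb : g.hom.IsBasis b)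
    (hb' : h.hom.IsBasis fun i => k (b i)) : IsPushout f g h k := by
  algebraize [f.hom, g.hom, h.hom, k.hom, h.hom.comp f.hom]
  have : IsScalarTower A B N := .of_algebraMap_eq' congr($(sq).hom)
  refine (CommRingCat.isPushout_iff_isPushout (R := A) (S := B) (R' := M) (S' := N)).2 ⟨?_⟩
  let e := (hb.toBasis.baseChange M).equiv hb'.toBasis (Equiv.refl ι)
  refine IsBaseChange.of_equiv e fun x => ?_
  let e' : B →ₗ[A] N := (e.toLinearMap.restrictScalars A) ∘ₗ TensorProduct.mk A M B 1
  change e' x = (IsScalarTower.toAlgHom A B N).toLinearMap x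
  congr 1
  refine hb.toBasis.ext fun i => ?_
  have h1 : hb.toBasis.baseChange M i = 1 ⊗ₜ[A] hb.toBasis i := Module.Basis.baseChange_apply _ _ _
  change e (1 ⊗ₜ[A] hb.toBasis i) = k (hb.toBasis i)
  rw [← h1, Module.Basis.equiv_apply, hb'.toBasis_apply, hb.toBasis_apply]
  rfl

end Basis

/-! ### Base change of rings of continuous functions. -/

namespace CondensedCommRing

section ofTop

variable {A B : TopCommRingCat.{u + 1}} (φ : A ⟶ B) {ι : Type*} {b : ι → B}

/-- The ring map `C(T, A) → C(T, B)` -/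
abbrev compHom (T : CompHaus.{u}ᵒᵖ) := ((ofTop.{u}.map φ).hom.app T).hom

lemma compHom_apply (T : CompHaus.{u}ᵒᵖ) (f : C(T.unop, A)) (t : T.unop) :
    DFunLike.coe (F := C(T.unop, B)) (compHom φ T f) t = φ.1 (f t) := rfl

/-- The constant function, as a section of the condensed ring attached to a topological ring. -/
abbrev constSection (T : CompHaus.{u}ᵒᵖ) (x : B) : (ofTop.{u}.obj B).obj.obj T :=
  (ContinuousMap.const T.unop x : C(T.unop, B))

lemma sum_compHom_apply (T : CompHaus.{u}ᵒᵖ) (c : ι →₀ (ofTop.{u}.obj A).obj.obj T) (t : T.unop) :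
    DFunLike.coe (F := C(T.unop, B)) (c.sum fun i a => compHom φ T a * constSection T (b i)) t =
      ((c.mapRange (fun a : C(T.unop, A) => a t) rfl).sum fun i a => φ.1 a * b i) := by
  have h1 := Finsupp.sum_mapRange_index (f := fun a : C(T.unop, A) => a t) (hf := rfl) (g := c)
    (h := fun i a => φ.1 a * b i) (by simp)
  refine Eq.trans ?_ h1.symm
  exact ContinuousMap.sum_apply (α := T.unop) (β := B) _ _ _

lemma isBasis_compHom (hb : φ.1.IsBasis b) (T : CompHaus.{u}ᵒᵖ)
    (hspan : ∀ x : C(T.unop, B), ∃ c : ι →₀ C(T.unop, A), ∀ t,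
      ((c.mapRange (fun a : C(T.unop, A) => a t) rfl).sum fun i a => φ.1 a * b i) = x t) :
    (compHom φ T).IsBasis fun i => constSection T (b i) := by
  refine .mk (fun x => ?_) fun c hc => ?_
  · obtain ⟨c, hc⟩ := hspan x
    exact ⟨c, ContinuousMap.ext fun t => (sum_compHom_apply φ T c t).trans (hc t)⟩
  · ext i : 1
    refine ContinuousMap.ext (X := T.unop) fun t => ?_
    have h1 := (sum_compHom_apply φ (b := b) T c t).symm.trans (congrArg
      (fun f => DFunLike.coe (F := C(T.unop, B)) f t) hc)
    exact DFunLike.congr_fun (hb.eq_zero _ h1) i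

/-- Continuity of the coordinates makes the coefficients in the pointwise expansion of a continuous
function continuous. -/
lemma isBasis_compHom_of_finite [Finite ι] (hb : φ.1.IsBasis b)
    (hcont : ∀ i, Continuous fun x => hb.coord x i) (T : CompHaus.{u}ᵒᵖ) :
    (compHom φ T).IsBasis fun i => constSection T (b i) := by
  have := Fintype.ofFinite ι
  refine isBasis_compHom φ hb T fun x => ?_
  refine ⟨Finsupp.equivFunOnFinite.symm fun i => ⟨fun t => hb.coord (x t) i,
    (hcont i).comp x.continuous⟩, fun t => ?_⟩
  rw [Finsupp.sum_fintype _ _ (by simp)]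
  exact hb.finset_sum_coord _

/-- The basis may be infinite here: a continuous map from a compact space to a discrete one has
finitely many values, so only finitely many basis elements occur in its expansion. -/
lemma isBasis_compHom_of_discrete [DiscreteTopology A] [DiscreteTopology B] (hb : φ.1.IsBasis b)
    (T : CompHaus.{u}ᵒᵖ) : (compHom φ T).IsBasis fun i => constSection T (b i) := by
  classical
  refine isBasis_compHom φ hb T fun x => ?_
  have hfin : (Set.range x).Finite := (isCompact_range x.continuous).finite_of_discrete
  let s : Finset ι := hfin.toFinset.biUnion fun y => (hb.coord y).support
  let c : ι →₀ C(T.unop, A) := Finsupp.onFinset s (fun i => ⟨fun t => hb.coord (x t) i,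
      (continuous_of_discreteTopology (f := fun y => hb.coord y i)).comp x.continuous⟩) fun i hi => by
    rw [Ne, ContinuousMap.ext_iff, not_forall] at hi
    obtain ⟨t, ht⟩ := hi
    exact Finset.mem_biUnion.2 ⟨x t, by simp, Finsupp.mem_support_iff.2 ht⟩
  refine ⟨c, fun t => ?_⟩
  have : c.mapRange (fun a : C(T.unop, A) => a t) rfl = hb.coord (x t) := by ext i; rfl
  rw [this, hb.sum_coord]

lemma isPushout_ofTop (hb : ∀ T : CompHaus.{u}ᵒᵖ,
    (compHom φ T).IsBasis fun i => constSection T (b i)) (S : CompHaus.{u}ᵒᵖ) :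
    IsPushout (constMap (ofTop.{u}.obj A).obj S) ((ofTop.{u}.map φ).hom.app (op point))
      ((ofTop.{u}.map φ).hom.app S) (constMap (ofTop.{u}.obj B).obj S) :=
  CommRingCat.isPushout_of_isBasis rfl (hb (op point)) (hb S)

end ofTop

section ofTopMvPowerSeries

open scoped MvPowerSeries.WithPiTopology

/-- The inclusion of the constants in the ring of power series. -/
def topMvPowerSeriesC (r : ℕ) (A : TopCommRingCat.{w}) : A ⟶ topMvPowerSeries r A :=
  ⟨MvPowerSeries.C, MvPowerSeries.WithPiTopology.continuous_C⟩

/-- The map of power series rings induced by a map of rings. -/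
def topMvPowerSeriesMap (r : ℕ) {A B : TopCommRingCat.{w}} (φ : A ⟶ B) :
    topMvPowerSeries r A ⟶ topMvPowerSeries r B :=
  ⟨MvPowerSeries.map φ.1, continuous_pi fun d =>
    φ.2.comp (MvPowerSeries.WithPiTopology.continuous_coeff A d)⟩

variable (r : ℕ) {A B : TopCommRingCat.{u + 1}} (φ : A ⟶ B) {ι : Type*} [Finite ι] {b : ι → B}

omit [Finite ι] in
lemma coeff_sum_topMvPowerSeriesMap (c : ι →₀ MvPowerSeries (Fin r) A) (d) :
    MvPowerSeries.coeff d (c.sum fun i a => (topMvPowerSeriesMap r φ).1 a * MvPowerSeries.C (b i)) =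
      ((c.mapRange (MvPowerSeries.coeff d) (map_zero _)).sum fun i a => φ.1 a * b i) := by
  rw [Finsupp.sum_mapRange_index (by simp), Finsupp.sum, map_sum]
  refine Finset.sum_congr rfl fun i _ => ?_
  rw [MvPowerSeries.coeff_mul_C]
  rfl

lemma isBasis_topMvPowerSeriesMap (hb : φ.1.IsBasis b) :
    (topMvPowerSeriesMap r φ).1.IsBasis fun i => (MvPowerSeries.C (b i) : MvPowerSeries (Fin r) B) := by
  have := Fintype.ofFinite ι
  have key := coeff_sum_topMvPowerSeriesMap r φ (b := b)
  refine .mk (fun x => ?_) fun c hc => ?_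
  · refine ⟨Finsupp.equivFunOnFinite.symm fun i => fun d => hb.coord (MvPowerSeries.coeff d x) i, ?_⟩
    ext d
    rw [key, Finsupp.sum_fintype _ _ (by simp)]
    exact hb.finset_sum_coord _
  · ext i d
    have h1 := hb.eq_zero _ ((key c d).symm.trans (by rw [hc, map_zero]))
    exact DFunLike.congr_fun h1 i

/-- This is `A⟦x⟧ ⊗_A B = B⟦x⟧` on sections over `S`. Expanding every coefficient in the basis gives
one power series over `A` per basis element, which is a finite expansion because the basis is
finite. -/
lemma isPushout_topMvPowerSeries (hb : φ.1.IsBasis b)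
    (hcont : ∀ i, Continuous fun x => hb.coord x i) (S : CompHaus.{u}ᵒᵖ) :
    IsPushout ((ofTop.{u}.map (topMvPowerSeriesC r A)).hom.app S) ((ofTop.{u}.map φ).hom.app S)
      ((ofTop.{u}.map (topMvPowerSeriesMap r φ)).hom.app S)
      ((ofTop.{u}.map (topMvPowerSeriesC r B)).hom.app S) := by
  have := Fintype.ofFinite ι
  refine CommRingCat.isPushout_of_isBasis ?_ (isBasis_compHom_of_finite φ hb hcont S)
    (isBasis_compHom_of_finite (topMvPowerSeriesMap r φ) (isBasis_topMvPowerSeriesMap r φ hb) ?_ S)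
  · ext f
    refine ContinuousMap.ext fun s => ?_
    exact MvPowerSeries.map_C _ _
  · intro i
    have h1 : ∀ x, (isBasis_topMvPowerSeriesMap r φ hb).coord x i =
        fun d => hb.coord (MvPowerSeries.coeff d x) i := by
      intro x
      have : (isBasis_topMvPowerSeriesMap r φ hb).coord x = Finsupp.equivFunOnFinite.symm fun i =>
          (fun d => hb.coord (MvPowerSeries.coeff d x) i : MvPowerSeries (Fin r) A) := by
        apply (isBasis_topMvPowerSeriesMap r φ hb).1
        refine ((isBasis_topMvPowerSeriesMap r φ hb).sum_coord x).trans ?_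
        ext d
        refine Eq.trans ?_ (coeff_sum_topMvPowerSeriesMap r φ _ d).symm
        rw [Finsupp.sum_fintype _ _ (by simp)]
        exact (hb.finset_sum_coord _).symm
      rw [this]
      rfl
    rw [continuous_congr h1]
    exact continuous_pi fun d =>
      (hcont i).comp (MvPowerSeries.WithPiTopology.continuous_coeff B d)

end ofTopMvPowerSeries

end CondensedCommRing

/-! ### Filtered colimits of rings: flatness and finite free resolutions. -/

section Flat

/-- By the equational criterion: a relation that lifts to a flat `A`-algebra `M` is trivial there,
and its trivialization maps to `K`. -/
lemma RingHom.flat_of_exists_lift {A K : Type*} [CommRing A] [CommRing K] (g : A →+* K)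
    (h : ∀ (l : ℕ) (f : Fin l → A) (x : Fin l → K), ∑ i, g (f i) * x i = 0 →
      ∃ (M : Type w) (_ : CommRing M) (g' : A →+* M) (e : M →+* K) (x' : Fin l → M),
        e.comp g' = g ∧ g'.Flat ∧ (∀ i, e (x' i) = x i) ∧ ∑ i, g' (f i) * x' i = 0) : g.Flat := by
  let _ := g.toAlgebra
  refine Module.Flat.of_forall_isTrivialRelation fun {l f x} hfx => ?_
  obtain ⟨M, _, g', e, x', hg, hflat, hx, hx'⟩ := h l f x hfx
  let _ := g'.toAlgebra
  have : Module.Flat A M := hflat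
  obtain ⟨k, a, y, h1, h2⟩ := Module.Flat.isTrivialRelation_of_sum_smul_eq_zero
    (f := f) (x := x') hx'
  refine ⟨k, a, fun j => e (y j), fun i => ?_, h2⟩
  rw [← hx, h1, map_sum]
  refine Finset.sum_congr rfl fun j _ => ?_
  change e (g' _ * _) = g _ * _
  rw [map_mul, ← hg]
  rfl

variable {J : Type w} [SmallCategory J] [IsFiltered J] {D : J ⥤ CommRingCat.{w'}} (c : Cocone D)
  (hc : IsColimit c) [PreservesColimit D (forget CommRingCat)]

include hc in
lemma exists_lift_of_isColimit (j : J) {ι : Type*} (s : Finset ι) (x : ι → c.pt) :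
    ∃ (k : J) (_ : j ⟶ k) (y : ι → D.obj k), ∀ i ∈ s, c.ι.app k (y i) = x i := by
  classical
  induction s using Finset.induction_on with
  | empty => exact ⟨j, 𝟙 j, 0, by simp⟩
  | insert a s ha ih =>
    obtain ⟨k, f, y, hy⟩ := ih
    obtain ⟨k', z, hz⟩ := Concrete.isColimit_exists_rep D hc (x a)
    refine ⟨IsFiltered.max k k', f ≫ IsFiltered.leftToMax k k', fun i => if i = a then
      D.map (IsFiltered.rightToMax k k') z else D.map (IsFiltered.leftToMax k k') (y i),
      fun i hi => ?_⟩
    dsimp only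
    split_ifs with h
    · rw [h, ← hz]
      exact congr($(c.w (IsFiltered.rightToMax k k')) z)
    · rw [← hy i ((Finset.mem_insert.1 hi).resolve_left h)]
      exact congr($(c.w (IsFiltered.leftToMax k k')) (y i))

-- A relation over the colimit involves finitely many elements, so it already holds at some later
-- stage, and that stage is flat over `D.obj j`.
include hc in
lemma flat_ι_of_isColimit (hD : ∀ {i j : J} (f : i ⟶ j), (D.map f).hom.Flat) (j : J) :
    (c.ι.app j).hom.Flat := by
  refine RingHom.flat_of_exists_lift.{w'} _ fun l f x hfx => ?_
  obtain ⟨k, g, y, hy⟩ := exists_lift_of_isColimit c hc j Finset.univ x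
  have hw : ∀ z, c.ι.app k (D.map g z) = c.ι.app j z := fun z => congr($(c.w g) z)
  have h0 : c.ι.app k (∑ i, D.map g (f i) * y i) = c.ι.app k 0 := by
    rw [map_zero, ← hfx, map_sum]
    refine Finset.sum_congr rfl fun i _ => ?_
    rw [map_mul, hy i (Finset.mem_univ i), hw]
  obtain ⟨m, g1, g2, h1⟩ := Concrete.isColimit_exists_of_rep_eq D hc _ _ h0
  refine ⟨D.obj m, _, (D.map (g ≫ g1)).hom, (c.ι.app m).hom, fun i => D.map g1 (y i), ?_,
    hD _, fun i => ?_, ?_⟩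
  · exact congr(($(c.w (g ≫ g1))).hom)
  · rw [← hy i (Finset.mem_univ i)]
    exact congr($(c.w g1) (y i))
  · rw [map_zero, map_sum] at h1
    rw [← h1]
    refine Finset.sum_congr rfl fun i _ => ?_
    rw [map_mul, D.map_comp]
    rfl

/-- Finite free resolutions exist over a pushout `X` of `R` and `B` over `A` if they exist over the
pushouts of `R` and `B'`, where the rings `B'` are such that `B` is flat over `B'` and finite
subsets of `B` come from some `B'`. -/
lemma hasFiniteFreeResolutions_of_isPushout {A R B X : CommRingCat.{w}} {f : A ⟶ R} {g : A ⟶ B}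
    {i : R ⟶ X} {j : B ⟶ X} (sq : IsPushout f g i j)
    (h : ∀ s : Finset B, ∃ (B' : CommRingCat.{w}) (g' : A ⟶ B') (e : B' ⟶ B), g' ≫ e = g ∧
      e.hom.Flat ∧ (s : Set B) ⊆ Set.range e ∧
        ∃ (X' : CommRingCat.{w}) (i' : R ⟶ X') (j' : B' ⟶ X'), IsPushout f g' i' j' ∧
          HasFiniteFreeResolutions X') : HasFiniteFreeResolutions X := by
  classical
  -- `X` is generated by the images of `R` and `B`, so each of its elements involves only finitely
  -- many elements `t` of `B`.
  have key : ∀ x : X, ∃ t : Finset B, ∀ S : Subring X, Set.range i ⊆ S → j '' t ⊆ S → x ∈ S := by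
    intro x
    have hx : x ∈ Subring.closure (Set.range i ∪ Set.range j) := by
      rw [CommRingCat.closure_range_union_range_eq_top_of_isPushout sq]
      trivial
    induction hx using Subring.closure_induction with
    | mem x hx =>
      obtain hx | ⟨b, rfl⟩ := hx
      · exact ⟨∅, fun S hS _ => hS hx⟩
      · exact ⟨{b}, fun S _ hS => hS ⟨b, by simp, rfl⟩⟩
    | zero => exact ⟨∅, fun S _ _ => S.zero_mem⟩
    | one => exact ⟨∅, fun S _ _ => S.one_mem⟩
    | neg x _ ih =>
      obtain ⟨t, ht⟩ := ih
      exact ⟨t, fun S h1 h2 => S.neg_mem (ht S h1 h2)⟩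
    | add x y _ _ ihx ihy =>
      obtain ⟨t, ht⟩ := ihx
      obtain ⟨t', ht'⟩ := ihy
      refine ⟨t ∪ t', fun S h1 h2 => S.add_mem (ht S h1 ?_) (ht' S h1 ?_)⟩
      · exact (Set.image_mono (by simp)).trans h2
      · exact (Set.image_mono (by simp)).trans h2
    | mul x y _ _ ihx ihy =>
      obtain ⟨t, ht⟩ := ihx
      obtain ⟨t', ht'⟩ := ihy
      refine ⟨t ∪ t', fun S h1 h2 => S.mul_mem (ht S h1 ?_) (ht' S h1 ?_)⟩
      · exact (Set.image_mono (by simp)).trans h2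
      · exact (Set.image_mono (by simp)).trans h2
  choose t ht using key
  refine .of_exists_flat.{w} fun s => ?_
  obtain ⟨B', g', e, hg, he, hs, X', i', j', sq', hX'⟩ := h (s.biUnion t)
  have w : f ≫ i = g' ≫ e ≫ j := by rw [← Category.assoc, hg, sq.w]
  -- Cancelling pushout squares gives `X = X' ⊗_{B'} B`, so `X` is flat over `X'` because `B` is
  -- flat over `B'`.
  have sq2 : IsPushout e j' j (sq'.desc i (e ≫ j) w) := by
    refine IsPushout.of_left (h₁₁ := g') (v₁₁ := f) (h₂₁ := i') ?_ (sq'.inr_desc _ _ w).symm sq'.flip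
    rw [hg, sq'.inl_desc]
    exact sq.flip
  let _ := (sq'.desc i (e ≫ j) w).hom.toAlgebra
  refine ⟨X', _, _, hX', CondensedCommRing.flat_of_isPushout sq2 he, fun x hx => ?_⟩
  refine ht x (sq'.desc i (e ≫ j) w).hom.range ?_ ?_
  · rintro _ ⟨r, rfl⟩
    exact ⟨i' r, congr($(sq'.inl_desc i (e ≫ j) w) r)⟩
  · rintro _ ⟨b, hb, rfl⟩
    obtain ⟨b', rfl⟩ := hs (Finset.mem_biUnion.2 ⟨x, hx, hb⟩)
    exact ⟨j' b', congr($(sq'.inr_desc i (e ≫ j) w) b')⟩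

end Flat

/-! ### Colimits of condensed rings computed on sections. -/

section Colimit

/-- A colimit of pushouts of a fixed map is a pushout. -/
lemma isPushout_colimit {C : Type*} [Category* C] {J : Type*} [Category* J] {j₀ : J}
    (hj₀ : IsInitial j₀) {D₁ D₂ : J ⥤ C} (α : D₁ ⟶ D₂) {c₁ : Cocone D₁} (h₁ : IsColimit c₁)
    {c₂ : Cocone D₂} (h₂ : IsColimit c₂) (β : c₁.pt ⟶ c₂.pt)
    (hβ : ∀ j, c₁.ι.app j ≫ β = α.app j ≫ c₂.ι.app j) {A M : C} (f : A ⟶ M)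
    (φ : A ⟶ D₁.obj j₀) (ψ : M ⟶ D₂.obj j₀)
    (sq : ∀ j, IsPushout f (φ ≫ D₁.map (hj₀.to j)) (ψ ≫ D₂.map (hj₀.to j)) (α.app j)) :
    IsPushout f (φ ≫ c₁.ι.app j₀) (ψ ≫ c₂.ι.app j₀) β := by
  have hψ : ∀ j, ψ ≫ c₂.ι.app j₀ = ψ ≫ D₂.map (hj₀.to j) ≫ c₂.ι.app j := fun j => by rw [c₂.w]
  have hφ : ∀ j, φ ≫ c₁.ι.app j₀ = φ ≫ D₁.map (hj₀.to j) ≫ c₁.ι.app j := fun j => by rw [c₁.w]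
  have hw : f ≫ ψ ≫ c₂.ι.app j₀ = (φ ≫ c₁.ι.app j₀) ≫ β := by
    have h3 := (sq j₀).w
    rw [hψ j₀, ← Category.assoc ψ, ← Category.assoc f, h3, hφ j₀]
    simp only [Category.assoc, hβ]
  refine ⟨⟨hw⟩, ⟨PushoutCocone.IsColimit.mk _ (fun s => h₂.desc ⟨s.pt, ⟨fun j =>
    (sq j).desc s.inl (c₁.ι.app j ≫ s.inr) ?_, fun j j' g => ?_⟩⟩) (fun s => ?_) (fun s => ?_)
    fun s m hl hr => ?_⟩⟩
  · refine s.condition.trans ((congrArg (· ≫ s.inr) (hφ j)).trans ?_)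
    simp only [Category.assoc]
  · refine (sq j).hom_ext ?_ ?_
    · simp only [Functor.const_obj_obj, Functor.const_obj_map, Category.comp_id, IsPushout.inl_desc]
      rw [Category.assoc, ← D₂.map_comp_assoc, hj₀.hom_ext (hj₀.to j ≫ g) (hj₀.to j'),
        ← Category.assoc, IsPushout.inl_desc]
    · simp only [Functor.const_obj_obj, Functor.const_obj_map, Category.comp_id, IsPushout.inr_desc]
      rw [← α.naturality_assoc, IsPushout.inr_desc, c₁.w_assoc]
  · rw [hψ j₀, Category.assoc, Category.assoc, h₂.fac, ← Category.assoc, IsPushout.inl_desc]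
  · refine h₁.hom_ext fun j => ?_
    rw [← Category.assoc, hβ, Category.assoc, h₂.fac, IsPushout.inr_desc]
  · refine h₂.hom_ext fun j => (sq j).hom_ext ?_ ?_
    · rw [h₂.fac, IsPushout.inl_desc, ← hl, hψ j]
      simp only [Category.assoc]
    · rw [h₂.fac, IsPushout.inr_desc, ← hr, ← Category.assoc, ← hβ, Category.assoc]

end Colimit

namespace CondensedCommRing

variable {J : Type w} [SmallCategory J] {j₀ : J}
    (hj₀ : IsInitial j₀) (D : J ⥤ CondensedCommRing.{u}) {L : CondensedCommRing.{u}}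
    (φ : L ⟶ D.obj j₀)
    (sq : ∀ S j, IsPushout (constMap L.obj S) ((φ ≫ D.map (hj₀.to j)).hom.app (op point))
      ((φ ≫ D.map (hj₀.to j)).hom.app S) (constMap (D.obj j).obj S))

-- The presheaf colimit has sections `L(S) ⊗_{L(*)} colim_j D_j(*)`. This is a flat base change of
-- the sheaf `L` with constant coefficients, hence a sheaf by `isSheaf_pushout`, and so it is also
-- the colimit of condensed rings.
include sq in
lemma preservesColimit_of_isPushout [HasColimitsOfShape J CommRingCat.{u + 1}] [HasColimit D]
    (hflat : ∀ c : Cocone (D ⋙ (sheafToPresheaf _ _) ⋙ (evaluation _ _).obj (op point)),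
      IsColimit c → (φ.hom.app (op point) ≫ c.ι.app j₀).hom.Flat) :
    PreservesColimit D (sheafToPresheaf (coherentTopology CompHaus.{u}) CommRingCat.{u + 1}) := by
  let c := colimit.cocone (D ⋙ sheafToPresheaf _ _)
  let hc : IsColimit c := colimit.isColimit _
  let hcS (S) := isColimitOfPreserves ((evaluation CompHaus.{u}ᵒᵖ CommRingCat.{u + 1}).obj S) hc
  have hsheaf : Presheaf.IsSheaf (coherentTopology CompHaus.{u}) c.pt := by
    refine isSheaf_pushout (φ.hom.app (op point) ≫ (c.ι.app j₀).app (op point))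
      (hflat _ (hcS (op point))) L.property (constMap L.obj)
      (fun h => constMap_map L.obj h)
      (φ.hom ≫ c.ι.app j₀) (constMap c.pt) (fun h => constMap_map c.pt h) fun S => ?_
    refine isPushout_colimit hj₀ (((Functor.whiskeringLeft _ _ _).obj
      (D ⋙ sheafToPresheaf _ _)).map ((evaluation CompHaus.{u}ᵒᵖ CommRingCat.{u + 1}).map
        (X := op point) (Y := S)
        (CompHausLike.ofHom _ (ContinuousMap.const S.unop PUnit.unit) : S.unop ⟶ point).op))
      (hcS (op point)) (hcS S) _ (fun j => ?_) _ _ _ fun j => sq S j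
    exact ((c.ι.app j).naturality _).symm
  let c' : Cocone D := ⟨⟨c.pt, hsheaf⟩, ⟨fun j => ⟨c.ι.app j⟩, fun j k g =>
    ObjectProperty.hom_ext _ (c.ι.naturality g)⟩⟩
  have hc' : IsColimit ((sheafToPresheaf _ _).mapCocone c') :=
    IsColimit.ofIsoColimit hc (Cocone.ext (Iso.refl _))
  exact preservesColimit_of_preserves_colimit_cocone (isColimitOfReflects (sheafToPresheaf _ _) hc') hc'

end CondensedCommRing

open Filter Topology

/-! ### Linear topologies and group algebras of finite groups. -/

section LinearTopology

lemma IsLinearTopology.tendsto_zero_iff {R ι : Type*} [CommRing R] [TopologicalSpace R]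
    [IsLinearTopology R R] {l : Filter ι} {x : ι → R} :
    Tendsto x l (𝓝 0) ↔ ∀ I : Ideal R, (I : Set R) ∈ 𝓝 0 → ∀ᶠ n in l, x n ∈ I :=
  IsLinearTopology.hasBasis_ideal.tendsto_right_iff

/-- An open ideal that contains `y ^ m` contains `x ^ (q * m)` and every higher power of `x`. -/
lemma IsTopologicallyNilpotent.of_pow_eq_mul {R : Type*} [CommRing R] [TopologicalSpace R]
    [IsLinearTopology R R] {x y r : R} (hy : IsTopologicallyNilpotent y) {q : ℕ}
    (h : x ^ q = y * r) : IsTopologicallyNilpotent x := by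
  refine IsLinearTopology.tendsto_zero_iff.2 fun I hI => ?_
  obtain ⟨m, hm⟩ := hy.exists_pow_mem_of_mem_nhds hI
  filter_upwards [eventually_ge_atTop (q * m)] with n hn
  rw [← Nat.add_sub_cancel' hn, pow_add, pow_mul, h, mul_pow]
  exact I.mul_mem_right _ (I.mul_mem_right _ hm)

/-- For finite `H` the elements with all coefficients in an open ideal of `A` form an open ideal,
and these ideals are a basis of neighbourhoods of zero. -/
lemma MonoidAlgebra.isLinearTopology (A H : Type*) [CommRing A] [TopologicalSpace A]
    [IsLinearTopology A A] [CommGroup H] [Finite H] :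
    IsLinearTopology (MonoidAlgebra A H) (MonoidAlgebra A H) := by
  classical
  have := Fintype.ofFinite H
  let K (I : Ideal A) : Ideal (MonoidAlgebra A H) :=
    { carrier := {x | ∀ g, x.coeff g ∈ I}
      add_mem' := fun hx hy g => I.add_mem (hx g) (hy g)
      zero_mem' := fun g => I.zero_mem
      smul_mem' := fun c x hx g => by
        have h : (c * x).coeff g =
          ∑ p ∈ (Finset.univ : Finset (H × H)).filter (fun p => p.1 * p.2 = g),
            c.coeff p.1 * x.coeff p.2 := MonoidAlgebra.coeff_mul_antidiag _ _ _ _ (by simp)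
        rw [smul_eq_mul, h]
        exact I.sum_mem fun p _ => I.mul_mem_left _ (hx _) }
  have hb : (𝓝 (0 : MonoidAlgebra A H)).HasBasis (fun I : Ideal A => (I : Set A) ∈ 𝓝 0)
      (fun I => (K I : Set (MonoidAlgebra A H))) := by
    have h0 : (𝓝 (0 : H → A)).HasBasis (fun I : Ideal A => (I : Set A) ∈ 𝓝 0)
        (fun I => {x | ∀ g, x g ∈ I}) := by
      rw [nhds_pi]
      refine (IsLinearTopology.hasBasis_ideal (R := A)).pi_self.to_hasBasis ?_ ?_
      · rintro ⟨D, I⟩ ⟨-, hI⟩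
        exact ⟨I, hI, fun f hf g _ => hf g⟩
      · intro I hI
        exact ⟨⟨Set.univ, I⟩, ⟨Set.finite_univ, hI⟩, fun f hf g => hf g trivial⟩
    rw [nhds_induced]
    exact h0.comap _
  exact IsLinearTopology.mk_of_hasBasis _ hb

lemma MonoidAlgebra.compactSpace (A H : Type*) [CommRing A] [TopologicalSpace A]
    [CompactSpace A] [Finite H] : CompactSpace (MonoidAlgebra A H) := by
  have : Topology.IsInducing fun (x : MonoidAlgebra A H) (g : H) => x.coeff g := ⟨rfl⟩
  have hs : Function.Surjective fun (x : MonoidAlgebra A H) (g : H) => x.coeff g := fun f =>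
    ⟨.ofCoeff (Finsupp.equivFunOnFinite.symm f), by ext; simp⟩
  rw [← isCompact_univ_iff, this.isCompact_iff, Set.image_univ, hs.range_eq]
  exact isCompact_univ

lemma MonoidAlgebra.t2Space (A H : Type*) [CommRing A] [TopologicalSpace A]
    [T2Space A] : T2Space (MonoidAlgebra A H) := by
  refine T2Space.of_injective_continuous (f := fun (x : MonoidAlgebra A H) (g : H) => x.coeff g) ?_
    continuous_induced_dom
  intro x y h
  ext g
  exact congrFun h g

lemma MonoidAlgebra.continuous_algebraMap (A H : Type*) [CommRing A] [TopologicalSpace A]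
    [Group H] : Continuous (algebraMap A (MonoidAlgebra A H)) := by
  classical
  refine MonoidAlgebra.continuous_of_coeff fun g => ?_
  change Continuous fun a : A => (Finsupp.single 1 a) g
  simp only [Finsupp.single_apply]
  split_ifs
  · exact continuous_id
  · exact _root_.continuous_const

end LinearTopology

/-! ### The completed group algebra as a power series ring. -/

section TateBasis

/-- A compatible system of bases of the groups `G[ℓ^n]`. -/
structure IsTateBasis (ℓ : ℕ) {G : Type*} [CommGroup G] {r : ℕ}
    (γ : ∀ n, Fin r → torsionSubgroup G (ℓ ^ n)) : Prop where
  transition n i : torsionTransition ℓ G n (γ (n + 1) i) = γ n i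
  exists_prod_pow_eq n g : ∃ a : Fin r → ℕ, ∏ i, γ n i ^ a i = g
  modEq n (a b : Fin r → ℕ) : ∏ i, γ n i ^ a i = ∏ i, γ n i ^ b i → ∀ i, a i ≡ b i [MOD ℓ ^ n]

namespace IsTateBasis

open scoped MvPowerSeries.WithPiTopology
open MvPowerSeries

variable {ℓ : ℕ} [hprime : Fact ℓ.Prime] {G : Type*} [CommGroup G] {r : ℕ}
  {γ : ∀ n, Fin r → torsionSubgroup G (ℓ ^ n)} (hγ : IsTateBasis ℓ γ)
  {A : Type*} [CommRing A]

/-- The polynomials `(1 + x_i)^(ℓ^n) - 1` generate an ideal. -/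
def ideal (A : Type*) [CommRing A] (ℓ r n : ℕ) : Ideal (MvPowerSeries (Fin r) A) :=
  Ideal.span (Set.range fun i => (1 + X i) ^ ℓ ^ n - 1)

/-- Induction on `n`: with `y = (1 + x)^(ℓ^n) - 1 ∈ I^(n+1)`, the next element is `y^ℓ + ℓ * y * s`,
and both terms gain a factor in `I`. -/
lemma pow_sub_one_mem {R : Type*} [CommRing R] (I : Ideal R) (hℓ : (ℓ : R) ∈ I) {x : R}
    (hx : x ∈ I) (n : ℕ) : (1 + x) ^ ℓ ^ n - 1 ∈ I ^ (n + 1) := by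
  induction n with
  | zero => simpa using hx
  | succ n ih =>
    obtain ⟨s, hs⟩ := exists_add_pow_prime_eq (x := 1) (y := (1 + x) ^ ℓ ^ n - 1) hprime.out
    rw [add_sub_cancel, ← pow_mul, ← pow_succ] at hs
    rw [hs, one_pow, add_assoc, add_assoc, add_sub_cancel_left]
    refine Ideal.add_mem _ ?_ (Ideal.mul_mem_right _ _ ?_)
    · refine Ideal.pow_le_pow_right (?_ : n + 1 + 1 ≤ (n + 1) * ℓ) ?_
      · nlinarith [hprime.out.two_le]
      · rw [pow_mul]
        exact Ideal.pow_mem_pow ih ℓ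
    · rw [mul_one, ← add_assoc, pow_succ' I]
      exact Ideal.mul_mem_mul hℓ ih

variable [TopologicalSpace A]

/-- The ideal `I` generated by `ℓ` and the variables is finitely generated by topologically
nilpotent elements, so some power of it lies in the open ideal `U`; `pow_sub_one_mem` then applies.
-/
lemma exists_ideal_le [IsLinearTopology A A]
    (hℓ : IsTopologicallyNilpotent (ℓ : A)) (U : Ideal (MvPowerSeries (Fin r) A))
    (hU : (U : Set (MvPowerSeries (Fin r) A)) ∈ 𝓝 0) : ∃ n, ideal A ℓ r n ≤ U := by
  let I : Ideal (MvPowerSeries (Fin r) A) := Ideal.span (insert (ℓ : MvPowerSeries (Fin r) A)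
    (Set.range X))
  have hfg : (I.map (Ideal.Quotient.mk U)).FG :=
    Ideal.FG.map ⟨(insert (ℓ : MvPowerSeries (Fin r) A) (Set.range X) : Set _).toFinite.toFinset,
      by simp [I]⟩ _
  have hnil : ∀ x, IsTopologicallyNilpotent x → IsNilpotent (Ideal.Quotient.mk U x) := by
    intro x hx
    obtain ⟨m, hm⟩ := hx.exists_pow_mem_of_mem_nhds hU
    exact ⟨m, by rw [← map_pow]; exact Ideal.Quotient.eq_zero_iff_mem.2 hm⟩
  have hI : I.map (Ideal.Quotient.mk U) ≤ nilradical _ := by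
    rw [Ideal.map_span, Ideal.span_le]
    rintro _ ⟨x, rfl | ⟨i, rfl⟩, rfl⟩
    · refine hnil _ ?_
      have := hℓ.map (WithPiTopology.continuous_C (σ := Fin r) (R := A))
      simpa using this
    · exact hnil _ (HasEval.X.hpow i)
  obtain ⟨n, hn⟩ := hfg.isNilpotent_iff_le_nilradical.2 hI
  refine ⟨n, Ideal.span_le.2 ?_⟩
  rintro _ ⟨i, rfl⟩
  rw [← Ideal.map_pow, Ideal.zero_eq_bot, Ideal.map_eq_bot_iff_le_ker, Ideal.mk_ker] at hn
  exact hn (Ideal.pow_le_pow_right n.le_succ (pow_sub_one_mem I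
    (Ideal.subset_span (Set.mem_insert _ _))
    (Ideal.subset_span (Set.mem_insert_of_mem _ ⟨i, rfl⟩)) n))

lemma eq_zero_of_mem_ideal [IsTopologicalRing A] [IsLinearTopology A A] [T2Space A]
    (hℓ : IsTopologicallyNilpotent (ℓ : A)) (f : MvPowerSeries (Fin r) A)
    (hf : ∀ n, f ∈ ideal A ℓ r n) : f = 0 := by
  by_contra h
  have h1 : ({f}ᶜ : Set (MvPowerSeries (Fin r) A)) ∈ 𝓝 0 :=
    isClosed_singleton.isOpen_compl.mem_nhds (Ne.symm h)
  obtain ⟨U, hU, hU'⟩ := IsLinearTopology.hasBasis_ideal.mem_iff.1 h1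
  obtain ⟨n, hn⟩ := exists_ideal_le hℓ U hU
  exact hU' (hn (hf n)) rfl

-- A finitely generated ideal of a compact ring is a continuous image of a compact space.
omit hprime in
lemma isClosed_ideal [IsTopologicalRing A] [CompactSpace A] [T2Space A] (n : ℕ) :
    IsClosed (ideal A ℓ r n : Set (MvPowerSeries (Fin r) A)) := by
  have : CompactSpace (MvPowerSeries (Fin r) A) := inferInstanceAs (CompactSpace ((Fin r →₀ ℕ) → A))
  have h : (ideal A ℓ r n : Set (MvPowerSeries (Fin r) A)) =
      Set.range fun c : Fin r → MvPowerSeries (Fin r) A =>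
        ∑ i, c i * ((1 + X i) ^ ℓ ^ n - 1) := by
    ext x
    exact Ideal.mem_span_range_iff_exists_fun
  rw [h]
  exact (isCompact_range (by fun_prop)).isClosed

/-- Polynomials are dense in the ring of power series. -/
lemma algHom_ext {B : Type*} [CommRing B] [TopologicalSpace B] [T2Space B] [Algebra A B]
    {f g : MvPowerSeries (Fin r) A →ₐ[A] B} (hf : Continuous f) (hg : Continuous g)
    (h : ∀ i, f (X i) = g (X i)) : f = g := by
  have h1 : f.comp (MvPolynomial.coeToMvPowerSeries.algHom A) =
      g.comp (MvPolynomial.coeToMvPowerSeries.algHom A) := by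
    ext i
    simpa using h i
  refine DFunLike.coe_injective (WithPiTopology.denseRange_toMvPowerSeries.equalizer hf hg ?_)
  ext p
  simpa using DFunLike.congr_fun h1 p

variable [IsTopologicalRing A] [IsLinearTopology A A] [CompactSpace A] [T2Space A]
  [∀ n, Finite (torsionSubgroup G (ℓ ^ n))]

variable (γ A) in
/-- The elements at which power series are evaluated. -/
def point (n : ℕ) (i : Fin r) : MonoidAlgebra A (torsionSubgroup G (ℓ ^ n)) :=
  MonoidAlgebra.single (γ n i) 1 - 1

-- For `y = γ - 1`, expanding `1 = γ^(ℓ^n) = (1 + y)^(ℓ^n)` shows that `y^(ℓ^n)` is a multiple of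
-- the topologically nilpotent element `ℓ`.
omit [IsTopologicalRing A] [CompactSpace A] [T2Space A] in
lemma hasEval_point (hℓ : IsTopologicallyNilpotent (ℓ : A)) (n : ℕ) :
    HasEval (point γ A n) := by
  have := MonoidAlgebra.isLinearTopology A (torsionSubgroup G (ℓ ^ n))
  refine ⟨fun i => ?_, by simp [Filter.cofinite_eq_bot]⟩
  obtain ⟨s, hs⟩ := exists_add_pow_prime_pow_eq (x := 1) (y := point γ A n i) hprime.out n
  have hone : γ n i ^ ℓ ^ n = 1 := Subtype.ext (γ n i).2
  have hone' : 1 + point γ A n i = MonoidAlgebra.single (γ n i) 1 := by rw [point, add_sub_cancel]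
  rw [hone', MonoidAlgebra.single_pow, hone, one_pow, one_pow,
    ← MonoidAlgebra.one_def, add_assoc, left_eq_add] at hs
  have hℓ' : IsTopologicallyNilpotent (ℓ : MonoidAlgebra A (torsionSubgroup G (ℓ ^ n))) := by
    simpa using hℓ.map (MonoidAlgebra.continuous_algebraMap A (torsionSubgroup G (ℓ ^ n)))
  refine hℓ'.of_pow_eq_mul (q := ℓ ^ n) (r := -(point γ A n i * s)) ?_
  rw [eq_comm, ← sub_eq_zero, ← neg_eq_zero, ← hs]
  ring

lemma exists_evalHom (hℓ : IsTopologicallyNilpotent (ℓ : A)) (n : ℕ) :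
    ∃ φ : MvPowerSeries (Fin r) A →ₐ[A] MonoidAlgebra A (torsionSubgroup G (ℓ ^ n)),
      Continuous φ ∧ ∀ i, φ (X i) = point γ A n i := by
  let _ : UniformSpace A := IsTopologicalAddGroup.rightUniformSpace A
  have : IsUniformAddGroup A := isUniformAddGroup_of_addCommGroup
  let _ : UniformSpace (MonoidAlgebra A (torsionSubgroup G (ℓ ^ n))) :=
    IsTopologicalAddGroup.rightUniformSpace _
  have : IsUniformAddGroup (MonoidAlgebra A (torsionSubgroup G (ℓ ^ n))) :=
    isUniformAddGroup_of_addCommGroup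
  have := MonoidAlgebra.isLinearTopology A (torsionSubgroup G (ℓ ^ n))
  have := MonoidAlgebra.compactSpace A (torsionSubgroup G (ℓ ^ n))
  have := MonoidAlgebra.t2Space A (torsionSubgroup G (ℓ ^ n))
  have : ContinuousSMul A (MonoidAlgebra A (torsionSubgroup G (ℓ ^ n))) :=
    continuousSMul_of_algebraMap _ _ (MonoidAlgebra.continuous_algebraMap _ _)
  refine ⟨aeval (hasEval_point (γ := γ) hℓ n), continuous_aeval _, fun i => ?_⟩
  rw [coe_aeval, eval₂_X]

section Section

variable {n : ℕ}

/-- The exponents of an element with respect to the basis. -/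
def exponent (hγ : IsTateBasis ℓ γ) {n : ℕ} (g : torsionSubgroup G (ℓ ^ n)) : Fin r → ℕ :=
  (hγ.exists_prod_pow_eq n g).choose

omit hprime [∀ n, Finite (torsionSubgroup G (ℓ ^ n))] in
lemma prod_pow_exponent (g : torsionSubgroup G (ℓ ^ n)) : ∏ i, γ n i ^ hγ.exponent g i = g :=
  (hγ.exists_prod_pow_eq n g).choose_spec

/-- The power series `∏ (1 + x_i)^(a_i)` for the exponents `a` of `g`. -/
def monomial (A : Type*) [CommRing A] (g : torsionSubgroup G (ℓ ^ n)) : MvPowerSeries (Fin r) A :=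
  ∏ i, (1 + X i) ^ hγ.exponent g i

-- Modulo the ideal, `(1 + X i)^a` depends only on `a` modulo `ℓ^n`. This independence of the chosen
-- exponents makes `toQuotient` multiplicative.
omit hprime [TopologicalSpace A] [IsTopologicalRing A] [IsLinearTopology A A] [CompactSpace A]
  [T2Space A] [∀ n, Finite (torsionSubgroup G (ℓ ^ n))] in
lemma mk_monomial_eq (g : torsionSubgroup G (ℓ ^ n)) (a : Fin r → ℕ) (h : ∏ i, γ n i ^ a i = g) :
    Ideal.Quotient.mk (ideal A ℓ r n) (hγ.monomial A g) =
      Ideal.Quotient.mk (ideal A ℓ r n) (∏ i, (1 + X i) ^ a i) := by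
  rw [monomial, map_prod, map_prod]
  refine Finset.prod_congr rfl fun i _ => ?_
  rw [map_pow, map_pow]
  refine pow_eq_pow_of_modEq (hγ.modEq n _ _ ((hγ.prod_pow_exponent g).trans h.symm) i) ?_
  rw [← map_pow, ← map_one (Ideal.Quotient.mk (ideal A ℓ r n)), Ideal.Quotient.eq]
  exact Ideal.subset_span ⟨i, rfl⟩

/-- The map from the group algebra to the quotient of the ring of power series. -/
def toQuotient (A : Type*) [CommRing A] (n : ℕ) :
    MonoidAlgebra A (torsionSubgroup G (ℓ ^ n)) →ₐ[A] MvPowerSeries (Fin r) A ⧸ ideal A ℓ r n :=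
  MonoidAlgebra.lift A _ _
    { toFun := fun g => Ideal.Quotient.mk (ideal A ℓ r n) (hγ.monomial A g)
      map_one' := by rw [hγ.mk_monomial_eq 1 0 (by simp)]; simp
      map_mul' := fun g h => by
        rw [hγ.mk_monomial_eq (g * h) (hγ.exponent g + hγ.exponent h), monomial, monomial, ← map_mul,
          ← Finset.prod_mul_distrib]
        · simp [pow_add]
        · simp [pow_add, Finset.prod_mul_distrib, prod_pow_exponent] }

omit hprime [TopologicalSpace A] [IsTopologicalRing A] [IsLinearTopology A A] [CompactSpace A]
  [T2Space A] [∀ n, Finite (torsionSubgroup G (ℓ ^ n))] in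
lemma toQuotient_point (i : Fin r) :
    hγ.toQuotient A n (point γ A n i) = Ideal.Quotient.mk (ideal A ℓ r n) (X i) := by
  classical
  rw [point, map_sub, map_one, toQuotient, MonoidAlgebra.lift_single, one_smul]
  change Ideal.Quotient.mk (ideal A ℓ r n) (hγ.monomial A (γ n i)) - 1 = _
  rw [hγ.mk_monomial_eq _ (Pi.single i 1), Finset.prod_eq_single i]
  · simp
  · intro j _ hj
    simp [hj]
  · simp
  · rw [Finset.prod_eq_single i] <;> simp +contextual

/-- A section of the evaluation map. -/
def sect (A : Type*) [CommRing A] (n : ℕ) [Fintype (torsionSubgroup G (ℓ ^ n))]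
    (x : MonoidAlgebra A (torsionSubgroup G (ℓ ^ n))) : MvPowerSeries (Fin r) A :=
  ∑ g, C (x.coeff g) * hγ.monomial A g

variable [Fintype (torsionSubgroup G (ℓ ^ n))]

omit hprime [TopologicalSpace A] [IsTopologicalRing A] [IsLinearTopology A A] [CompactSpace A]
  [T2Space A] [∀ n, Finite (torsionSubgroup G (ℓ ^ n))] in
lemma mk_sect (x : MonoidAlgebra A (torsionSubgroup G (ℓ ^ n))) :
    Ideal.Quotient.mk (ideal A ℓ r n) (hγ.sect A n x) = hγ.toQuotient A n x := by
  rw [toQuotient, MonoidAlgebra.lift_apply, Finsupp.sum_fintype _ _ (by simp), sect, map_sum]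
  refine Finset.sum_congr rfl fun g _ => ?_
  rw [map_mul, Algebra.smul_def]
  rfl

omit hprime [IsLinearTopology A A] [CompactSpace A]
  [T2Space A] [∀ n, Finite (torsionSubgroup G (ℓ ^ n))] in
lemma continuous_sect : Continuous (hγ.sect A n) :=
  continuous_finsetSum _ fun g _ => ((WithPiTopology.continuous_C (σ := Fin r) (R := A)).comp
    (MonoidAlgebra.continuous_coeff g)).mul _root_.continuous_const

variable {φ : MvPowerSeries (Fin r) A →ₐ[A] MonoidAlgebra A (torsionSubgroup G (ℓ ^ n))}
  (hφ : ∀ i, φ (X i) = point γ A n i)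

include hφ in
omit hprime [TopologicalSpace A] [IsTopologicalRing A] [IsLinearTopology A A] [CompactSpace A]
  [T2Space A] [∀ n, Finite (torsionSubgroup G (ℓ ^ n))] in
lemma map_sect (x : MonoidAlgebra A (torsionSubgroup G (ℓ ^ n))) : φ (hγ.sect A n x) = x := by
  have h1 : ∀ g, φ (hγ.monomial A g) = MonoidAlgebra.single g 1 := fun g => by
    rw [monomial, map_prod]
    simp only [map_pow, map_add, map_one, hφ, point, add_sub_cancel]
    conv_rhs => rw [← hγ.prod_pow_exponent g, ← MonoidAlgebra.of_apply, map_prod]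
    simp
  rw [sect, map_sum]
  have h2 : ∀ g, φ (C (x.coeff g) * hγ.monomial A g) = MonoidAlgebra.single g (x.coeff g) := fun g => by
    rw [map_mul, h1, c_eq_algebraMap, AlgHom.commutes, ← Algebra.smul_def, MonoidAlgebra.smul_single,
      smul_eq_mul, mul_one]
  simp only [h2]
  ext g
  classical
  rw [MonoidAlgebra.coeff_sum, Finsupp.finsetSum_apply]
  simp [Finsupp.single_apply]

-- On polynomials, `f` and `sect (φ f)` agree modulo the ideal. Since `sect` is continuous and the
-- ideal is closed, density extends this to all power series, and `φ f = 0` gives `f ∈ ideal`.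
include hγ hφ in
omit hprime [IsLinearTopology A A] [∀ n, Finite (torsionSubgroup G (ℓ ^ n))] in
lemma mem_ideal_of_map_eq_zero (hc : Continuous φ) (f : MvPowerSeries (Fin r) A) (hf : φ f = 0) :
    f ∈ ideal A ℓ r n := by
  have h1 : ((hγ.toQuotient A n).comp φ).comp (MvPolynomial.coeToMvPowerSeries.algHom A) =
      (Ideal.Quotient.mkₐ A (ideal A ℓ r n)).comp (MvPolynomial.coeToMvPowerSeries.algHom A) := by
    ext i
    simpa [hφ] using hγ.toQuotient_point i
  have h2 : ∀ f, f - hγ.sect A n (φ f) ∈ ideal A ℓ r n := by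
    intro f
    refine WithPiTopology.denseRange_toMvPowerSeries.induction_on (p := fun f =>
      f - hγ.sect A n (φ f) ∈ ideal A ℓ r n) f ?_ fun p => ?_
    · exact (isClosed_ideal n).preimage (continuous_id.sub (hγ.continuous_sect.comp hc))
    · rw [← Ideal.Quotient.eq, mk_sect]
      simpa using (DFunLike.congr_fun h1 p).symm
  have h3 := h2 f
  rw [hf] at h3
  have h4 : hγ.sect A n 0 = 0 := by simp [sect]
  rwa [h4, sub_zero] at h3

end Section

omit hprime [IsLinearTopology A A] [CompactSpace A] [T2Space A] in
lemma _root_.MonoidAlgebra.continuous_mapDomainRingHom {H H' : Type*} [Group H] [Group H'] [Finite H]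
    (f : H →* H') : Continuous (MonoidAlgebra.mapDomainRingHom A f) := by
  classical
  have := Fintype.ofFinite H
  refine MonoidAlgebra.continuous_of_coeff fun g => ?_
  have h : ∀ x : MonoidAlgebra A H, (MonoidAlgebra.mapDomainRingHom A f x).coeff g =
      ∑ h, Finsupp.single (f h) (x.coeff h) g := fun x => by
    change Finsupp.mapDomain f x.coeff g = _
    rw [Finsupp.mapDomain, Finsupp.sum_fintype _ _ (by simp), Finsupp.finsetSum_apply]
  rw [continuous_congr h]
  refine continuous_finsetSum _ fun h _ => ?_
  simp only [Finsupp.single_apply]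
  split_ifs
  · exact MonoidAlgebra.continuous_coeff h
  · exact _root_.continuous_const

/-- The evaluations `x_i ↦ γ n i - 1` are compatible in `n`. The resulting map to the limit is
injective because the ideals `((1 + x_i)^(ℓ^n) - 1)` have zero intersection, surjective by
compactness, and a homeomorphism as a continuous bijection from a compact space to a Hausdorff one.
-/
theorem exists_ringEquiv (hγ : IsTateBasis ℓ γ) (hℓ : IsTopologicallyNilpotent (ℓ : A)) :
    ∃ e : MvPowerSeries (Fin r) A ≃+* completedGroupAlgebra A ℓ G, Continuous e ∧
      Continuous e.symm ∧ (∀ a, e (C a) = completedGroupAlgebra.const A ℓ G a) ∧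
        ∀ f, completedGroupAlgebra.augmentation A ℓ G (e f) = constantCoeff f := by
  have (n : ℕ) := Fintype.ofFinite (torsionSubgroup G (ℓ ^ n))
  choose φ hφc hφ using fun n => exists_evalHom (γ := γ) hℓ n
  have := fun n => MonoidAlgebra.t2Space A (torsionSubgroup G (ℓ ^ n))
  have hcomp (n : ℕ) (f) :
      MonoidAlgebra.mapDomainRingHom A (torsionTransition ℓ G n) (φ (n + 1) f) = φ n f := by
    have h1 : (MonoidAlgebra.mapDomainAlgHom A A (torsionTransition ℓ G n)).comp (φ (n + 1)) = φ n := by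
      refine algHom_ext ((MonoidAlgebra.continuous_mapDomainRingHom (torsionTransition ℓ G n)).comp (hφc (n + 1))) (hφc n) fun i => ?_
      rw [AlgHom.comp_apply, hφ, hφ, point, map_sub, map_one]
      simp [point, hγ.transition]
    exact DFunLike.congr_fun h1 f
  let Φ : MvPowerSeries (Fin r) A →+* completedGroupAlgebra A ℓ G :=
    (RingHom.pi fun n => (φ n).toRingHom).codRestrict _ fun f n => hcomp n f
  have hΦ : Continuous Φ := Continuous.subtype_mk (continuous_pi hφc) _
  have hinj : Function.Injective Φ := by
    refine (injective_iff_map_eq_zero Φ).2 fun f hf => eq_zero_of_mem_ideal hℓ f fun n => ?_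
    exact hγ.mem_ideal_of_map_eq_zero (hφ n) (hφc n) f (congrFun (congrArg Subtype.val hf) n)
  have : CompactSpace (MvPowerSeries (Fin r) A) := inferInstanceAs (CompactSpace ((Fin r →₀ ℕ) → A))
  have hstep (x : completedGroupAlgebra A ℓ G) (n : ℕ) : ∀ m, m ≤ n →
      φ m (hγ.sect A n (x.1 n)) = x.1 m := by
    intro m hm
    induction hm using Nat.decreasingInduction with
    | self => exact hγ.map_sect (hφ n) _
    | of_succ m _ ih => rw [← hcomp, ih]; exact x.2 m
  have hsurj : Function.Surjective Φ := by
    intro x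
    -- Lifting the `n`-th component of `x` matches all components `m ≤ n`, so these lifts have
    -- images converging to `x`; the range is closed because it is compact.
    have hx : x ∈ closure (Set.range Φ) := by
      refine mem_closure_of_tendsto (f := fun n => Φ (hγ.sect A n (x.1 n))) (b := atTop) ?_
        (Eventually.of_forall fun n => ⟨_, rfl⟩)
      rw [tendsto_subtype_rng, tendsto_pi_nhds]
      intro m
      refine tendsto_const_nhds.congr' ?_
      filter_upwards [eventually_ge_atTop m] with n hn
      exact (hstep x n m hn).symm
    rwa [(isCompact_range hΦ).isClosed.closure_eq] at hx
  refine ⟨RingEquiv.ofBijective Φ ⟨hinj, hsurj⟩, hΦ, ?_, fun a => ?_, fun f => ?_⟩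
  · exact (Continuous.homeoOfEquivCompactToT2 (f := Equiv.ofBijective Φ ⟨hinj, hsurj⟩) hΦ).symm.continuous
  · refine Subtype.ext (funext fun n => ?_)
    exact (φ n).commutes a
  -- Both sides are continuous algebra maps, so it suffices to compare them on variables: `γ 0 i -
  -- 1` has augmentation zero.
  · let ε : MvPowerSeries (Fin r) A →ₐ[A] A := ⟨constantCoeff, constantCoeff_C⟩
    have hε : Continuous ε := WithPiTopology.continuous_constantCoeff A
    let ψ : MonoidAlgebra A (torsionSubgroup G (ℓ ^ 0)) →ₐ[A] A := MonoidAlgebra.lift A A _ 1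
    have haug : ∀ f, completedGroupAlgebra.augmentation A ℓ G (Φ f) = ψ.comp (φ 0) f := fun f => rfl
    have hψ : Continuous (ψ.comp (φ 0)) := by
      refine Continuous.congr ?_ haug
      exact (completedGroupAlgebra.continuous_augmentation A ℓ G).comp hΦ
    have h1 : ψ.comp (φ 0) = ε := by
      refine algHom_ext hψ hε fun i => ?_
      rw [AlgHom.comp_apply, hφ, point, map_sub, map_one]
      refine (sub_eq_zero.2 ?_).trans (constantCoeff_X i).symm
      rw [MonoidAlgebra.lift_single, one_smul, MonoidHom.one_apply]
    exact (haug f).trans (DFunLike.congr_fun h1 f)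

end IsTateBasis

end TateBasis

/-! ### Completion of a presheaf of rings along a family of ideals. -/

namespace CondensedCommRing

section adicCompletion

variable {F : CompHaus.{u}ᵒᵖ ⥤ CommRingCat.{u + 1}} (I : ∀ S, Ideal (F.obj S))
  (hI : ∀ S S' (f : S ⟶ S'), I S ≤ (I S').comap (F.map f).hom)
  (Q : ℕ → CondensedCommRing.{u}) (q : ∀ n, F ⟶ (Q n).obj)
  (hker : ∀ n S, RingHom.ker ((q n).app S).hom = I S ^ n)

/-- The map from `F / I^n` to a quotient of `F`. -/
def quotPowLift (n : ℕ) : quotPow I hI n ⟶ (Q n).obj where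
  app S := CommRingCat.ofHom (Ideal.Quotient.lift _ ((q n).app S).hom fun x hx => by
    rwa [← hker, RingHom.mem_ker] at hx)
  naturality S S' f := by
    ext : 1
    refine Ideal.Quotient.ringHom_ext ?_
    exact congr(($((q n).naturality f)).hom)

lemma quotPowLift_bijective (hsurj : ∀ n S, Function.Surjective ((q n).app S)) (n : ℕ)
    (S : CompHaus.{u}ᵒᵖ) : Function.Bijective ((quotPowLift I hI Q q hker n).app S) := by
  refine ⟨?_, fun y => ?_⟩
  · exact RingHom.lift_injective_of_ker_le_ideal _ _ (hker n S).le
  · obtain ⟨x, hx⟩ := hsurj n S y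
    exact ⟨Ideal.Quotient.mk _ x, hx⟩

/-- The map from the sheaf `F / I^n` to a quotient of `F` that is a sheaf. -/
def quotPowSheafLift (n : ℕ) : quotPowSheaf I hI n ⟶ Q n :=
  ⟨sheafifyLift _ (quotPowLift I hI Q q hker n) (Q n).property⟩

lemma toSheafify_quotPowSheafLift (n : ℕ) :
    toSheafify (coherentTopology CompHaus.{u}) (quotPow I hI n) ≫
      (quotPowSheafLift I hI Q q hker n).hom = quotPowLift I hI Q q hker n :=
  toSheafify_sheafifyLift _ _ _

/-- The presheaf quotient is isomorphic to the sheaf `Q n`, so sheafification does not change it. -/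
lemma isIso_quotPowSheafLift (hsurj : ∀ n S, Function.Surjective ((q n).app S)) (n : ℕ) :
    IsIso (quotPowSheafLift I hI Q q hker n) := by
  have : IsIso (quotPowLift I hI Q q hker n) := by
    have : ∀ S, IsIso ((quotPowLift I hI Q q hker n).app S) := fun S =>
      (ConcreteCategory.isIso_iff_bijective _).2 (quotPowLift_bijective I hI Q q hker hsurj n S)
    exact NatIso.isIso_of_isIso_app _
  have hs : IsIso (toSheafify (coherentTopology CompHaus.{u}) (quotPow I hI n)) :=
    isIso_toSheafify _ ((Presheaf.isSheaf_of_iso_iff (asIso (quotPowLift I hI Q q hker n))).2 (Q n).property)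
  have : IsIso (quotPowSheafLift I hI Q q hker n).hom := by
    exact @IsIso.of_isIso_fac_left _ _ _ _ _ _ _ _ hs this (toSheafify_quotPowSheafLift I hI Q q hker n)
  have : IsIso ((sheafToPresheaf _ _).map (quotPowSheafLift I hI Q q hker n)) := this
  exact isIso_of_reflects_iso (quotPowSheafLift I hI Q q hker n) (sheafToPresheaf _ _)

variable (t : ∀ n, Q (n + 1) ⟶ Q n) (ht : ∀ n, q (n + 1) ≫ (t n).hom = q n)

include ht in
lemma quotPowSheafLift_transition (n : ℕ) : quotPowSheafLift I hI Q q hker (n + 1) ≫ t n =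
    quotPowSheafTransition I hI n ≫ quotPowSheafLift I hI Q q hker n := by
  apply ObjectProperty.hom_ext
  refine sheafify_hom_ext _ _ _ (Q n).property ?_
  have h1 := congrArg (· ≫ (t n).hom) (toSheafify_quotPowSheafLift I hI Q q hker (n + 1))
  have h2 := congrArg (· ≫ (quotPowSheafLift I hI Q q hker n).hom)
    (toSheafify_naturality (coherentTopology CompHaus.{u}) (quotPowTransition I hI n))
  have h3 := congrArg (quotPowTransition I hI n ≫ ·) (toSheafify_quotPowSheafLift I hI Q q hker n)
  have h4 : quotPowLift I hI Q q hker (n + 1) ≫ (t n).hom =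
      quotPowTransition I hI n ≫ quotPowLift I hI Q q hker n := by
    ext S : 3
    refine Ideal.Quotient.ringHom_ext ?_
    exact congr(($(ht n).app S).hom)
  exact (Category.assoc _ _ _).symm.trans (h1.trans (h4.trans (h3.symm.trans
    ((Category.assoc _ _ _).symm.trans (h2.trans (Category.assoc _ _ _))))))

variable (G : CondensedCommRing.{u}) (g : ∀ n, G ⟶ Q n) (hg : ∀ n, g (n + 1) ≫ t n = g n)

include hker ht hg in
/-- A condensed ring which is sectionwise the limit of quotients of `F` by the powers of `I` is the
`I`-adic completion of `F`. -/
theorem exists_iso_adicCompletion (hsurj : ∀ n S, Function.Surjective ((q n).app S))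
    (hinj : ∀ S (x y : G.obj.obj S), (∀ n, (g n).hom.app S x = (g n).hom.app S y) → x = y)
    (hlim : ∀ S (x : ∀ n, (Q n).obj.obj S), (∀ n, (t n).hom.app S (x (n + 1)) = x n) →
      ∃ y, ∀ n, (g n).hom.app S y = x n) :
    ∃ e : adicCompletion I hI ≅ G, ∀ (R : CondensedCommRing.{u}) (φ : R.obj ⟶ F) (ψ : R ⟶ G),
      (∀ n, φ ≫ q n = (ψ ≫ g n).hom) → toAdicCompletion I hI R φ ≫ e.hom = ψ := by
  let D := Functor.ofOpSequence (quotPowSheafTransition I hI)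
  have := isIso_quotPowSheafLift I hI Q q hker hsurj
  let b n : quotPowSheaf I hI n ≅ Q n := asIso (quotPowSheafLift I hI Q q hker n)
  have hb n : (b (n + 1)).hom ≫ t n = quotPowSheafTransition I hI n ≫ (b n).hom :=
    quotPowSheafLift_transition I hI Q q hker t ht n
  have hb' n : (b (n + 1)).inv ≫ quotPowSheafTransition I hI n = t n ≫ (b n).inv := by
    rw [Iso.inv_comp_eq, ← Category.assoc, hb, Category.assoc, Iso.hom_inv_id, Category.comp_id]
  let π n : G ⟶ D.obj (op n) := g n ≫ (b n).inv
  have hπ n : π (n + 1) ≫ quotPowSheafTransition I hI n = π n := by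
    refine (Category.assoc _ _ _).trans ((congrArg (g (n + 1) ≫ ·) (hb' n)).trans ?_)
    exact (Category.assoc _ _ _).symm.trans (congrArg (· ≫ (b n).inv) (hg n))
  let c : Cone D :=
    { pt := G
      π := NatTrans.ofOpSequence π (fun n => by
        rw [Functor.ofOpSequence_map_homOfLE_succ]
        exact (Category.id_comp _).trans (hπ n).symm) }
  -- Being a limit may be tested on sections and then on underlying sets, where it amounts to `hinj`
  -- and `hlim`.
  have hc : IsLimit c := by
    have : ∀ S, IsLimit (((evaluation _ _).obj S).mapCone ((sheafToPresheaf _ _).mapCone c)) := by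
      intro S
      have : ReflectsLimitsOfShape ℕᵒᵖ (forget CommRingCat.{u + 1}) :=
        reflectsLimitsOfShape_of_reflectsIsomorphisms
      refine isLimitOfReflects (forget CommRingCat) ?_
      refine Nonempty.some ((Types.isLimit_iff _).2 fun s hs => ?_)
      let s' n : (quotPowSheaf I hI n).obj.obj S := s (op n)
      have hs' n : (quotPowSheafTransition I hI n).hom.app S (s' (n + 1)) = s' n := by
        have h1 := hs (homOfLE n.le_succ).op
        have h2 : D.map (homOfLE n.le_succ).op = quotPowSheafTransition I hI n :=
          Functor.ofOpSequence_map_homOfLE_succ _ n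
        exact (congr($(h2.symm).hom.app S (s' (n + 1)))).trans h1
      have hbi n (x) : (b n).inv.hom.app S ((b n).hom.hom.app S x) = x :=
        congr($((b n).hom_inv_id).hom.app S x)
      have hbh n (x) : (b n).hom.hom.app S ((b n).inv.hom.app S x) = x :=
        congr($((b n).inv_hom_id).hom.app S x)
      obtain ⟨y, hy⟩ := hlim S (fun n => (b n).hom.hom.app S (s' n)) (fun n => by
        have h1 : (t n).hom.app S ((b (n + 1)).hom.hom.app S (s' (n + 1))) =
          (b n).hom.hom.app S ((quotPowSheafTransition I hI n).hom.app S (s' (n + 1))) :=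
          congr($(hb n).hom.app S (s' (n + 1)))
        rw [h1, hs'])
      refine ⟨y, fun n => ?_, fun y' hy' => ?_⟩
      · exact (congrArg ((b n.unop).inv.hom.app S) (hy n.unop)).trans (hbi _ _)
      · refine hinj S _ _ fun n => ?_
        have h1 : (b n).inv.hom.app S ((g n).hom.app S y') = s' n := hy' (op n)
        rw [hy, ← h1, hbh]
    exact isLimitOfReflects (sheafToPresheaf _ _) (evaluationJointlyReflectsLimits _ this)
  let e : adicCompletion I hI ≅ G := (limit.isLimit D).conePointUniqueUpToIso hc
  refine ⟨e, fun R φ ψ h => hc.hom_ext fun n => ?_⟩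
  have h1 : e.hom ≫ c.π.app n = limit.π D n :=
    (limit.isLimit D).conePointUniqueUpToIso_hom_comp hc n
  have h2 : toAdicCompletion I hI R φ ≫ limit.π D n = toQuotPowSheaf I hI R φ n.unop :=
    limit.lift_π _ _
  have h3 : toQuotPowSheaf I hI R φ n.unop ≫ (b n.unop).hom = ψ ≫ g n.unop := by
    apply ObjectProperty.hom_ext
    refine Eq.trans ?_ (h n.unop)
    exact congrArg (φ ≫ quotPowProj I hI n.unop ≫ ·)
      (toSheafify_quotPowSheafLift I hI Q q hker n.unop)
  rw [Category.assoc, h1, h2, ← Iso.eq_comp_inv] at *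
  rw [h3, Category.assoc]
  rfl

end adicCompletion

end CondensedCommRing

/-! ### Powers of the ideal of the variables, and truncated power series. -/

namespace MvPowerSeries

variable {r : ℕ} {B : Type*} [CommRing B]

/-- Each nonconstant monomial is assigned to one variable `c d` occurring in it, and `g i` collects
the monomials assigned to `i`, divided by `X i`. Division lowers the degree by exactly one, whence
the vanishing statement. -/
lemma exists_sum_X_mul_eq (f : MvPowerSeries (Fin r) B) (hf : constantCoeff f = 0) :
    ∃ g : Fin r → MvPowerSeries (Fin r) B, f = ∑ i, X i * g i ∧
      ∀ n : ℕ, (∀ d : Fin r →₀ ℕ, d.degree < n + 1 → coeff d f = 0) →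
        ∀ i (d : Fin r →₀ ℕ), d.degree < n → coeff d (g i) = 0 := by
  classical
  have h : ∀ d : Fin r →₀ ℕ, d ≠ 0 → ∃ i, d i ≠ 0 := fun d hd => by
    by_contra! h
    exact hd (Finsupp.ext h)
  let c : (Fin r →₀ ℕ) → Option (Fin r) := fun d => if hd : d ≠ 0 then some (h d hd).choose else none
  have hc : ∀ d i, c d = some i → d i ≠ 0 := by
    intro d i hi
    by_cases hd : d ≠ 0
    · simp only [c, dif_pos hd, Option.some.injEq] at hi
      rw [← hi]
      exact (h d hd).choose_spec
    · simp [c, hd] at hi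
  let g : Fin r → MvPowerSeries (Fin r) B := fun i d => if c (d + Finsupp.single i 1) = some i then
    coeff (d + Finsupp.single i 1) f else 0
  have hg : ∀ i d, coeff d (g i) = if c (d + Finsupp.single i 1) = some i then
    coeff (d + Finsupp.single i 1) f else 0 := fun i d => rfl
  refine ⟨g, ?_, fun n hn i d hd => ?_⟩
  · ext d
    rw [map_sum]
    have h1 : ∀ i, coeff d (X i * g i) = if c d = some i then coeff d f else 0 := by
      intro i
      rw [X_def, coeff_monomial_mul, one_mul]
      by_cases hi : Finsupp.single i 1 ≤ d
      · rw [if_pos hi, hg, tsub_add_cancel_of_le hi]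
      · rw [if_neg hi, if_neg]
        intro h2
        refine hi (Finsupp.single_le_iff.2 ?_)
        exact Nat.one_le_iff_ne_zero.2 (hc d i h2)
    rw [Finset.sum_congr rfl fun i _ => h1 i]
    by_cases hd : d = 0
    · subst hd
      have : coeff 0 f = 0 := hf
      simp [this]
    · have h2 : c d = some (h d hd).choose := dif_pos hd
      simp [h2]
  · rw [hg]
    split_ifs
    · refine hn _ ?_
      rw [map_add, Finsupp.degree_single]
      omega
    · rfl

/-- The order is superadditive in one direction; in the other, `exists_sum_X_mul_eq` extracts one
variable at a time. No noetherian hypothesis enters, so the result is available for `B = C(S, ℤ_ℓ)`.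
-/
lemma mem_ker_constantCoeff_pow_iff {f : MvPowerSeries (Fin r) B} {n : ℕ} :
    f ∈ RingHom.ker (constantCoeff (σ := Fin r) (R := B)) ^ n ↔
      ∀ d : Fin r →₀ ℕ, d.degree < n → coeff d f = 0 := by
  constructor
  · intro hf d hd
    let K (n : ℕ) : Ideal (MvPowerSeries (Fin r) B) :=
      { carrier := {f | (n : ℕ∞) ≤ f.order}
        add_mem' := fun hx hy => (le_min hx hy).trans (min_order_le_add)
        zero_mem' := by simp
        smul_mem' := fun c x hx => (le_trans (le_trans hx le_add_self) le_order_mul) }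
    have hle : RingHom.ker (constantCoeff (σ := Fin r) (R := B)) ^ n ≤ K n := by
      clear hf hd
      induction n with
      | zero => exact fun x _ => (Nat.cast_zero (R := ℕ∞)).trans_le zero_le
      | succ n ih =>
        rw [pow_succ, Ideal.mul_le]
        intro x hx y hy
        have h1 : (1 : ℕ∞) ≤ y.order := one_le_order_iff_constCoeff_eq_zero.2 hy
        exact le_trans (by push_cast; exact add_le_add (ih hx) h1) le_order_mul
    exact coeff_of_lt_order ((Nat.cast_lt.2 hd).trans_le (hle hf))
  · induction n generalizing f with
    | zero => simp
    | succ n ih =>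
      intro h
      obtain ⟨g, hg, hgn⟩ := exists_sum_X_mul_eq f (h 0 (by simp))
      rw [hg, pow_succ']
      exact Ideal.sum_mem _ fun i _ => Ideal.mul_mem_mul (by simp [RingHom.mem_ker]) (ih (hgn n h i))

open scoped MvPowerSeries.WithPiTopology

variable (r) in
/-- The ring of power series modulo the power series whose terms have degree at least `n`. -/
abbrev Truncated (r : ℕ) (B : Type*) [CommRing B] (n : ℕ) : Type _ :=
  MvPowerSeries (Fin r) B ⧸ RingHom.ker (constantCoeff (σ := Fin r) (R := B)) ^ n

/-- The representative with terms of degree less than `n`. -/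
def Truncated.lift {n : ℕ} (x : Truncated r B n) : MvPowerSeries (Fin r) B :=
  Quotient.liftOn' x (fun f d => if d.degree < n then coeff d f else 0) fun f g h => by
    funext d
    split_ifs with hd
    · rw [← sub_eq_zero, ← map_sub]
      exact mem_ker_constantCoeff_pow_iff.1 ((Submodule.quotientRel_def _).1 h) d hd
    · rfl

lemma Truncated.coeff_lift_mk {n : ℕ} (f : MvPowerSeries (Fin r) B) (d : Fin r →₀ ℕ) :
    coeff d (Truncated.lift (Ideal.Quotient.mk _ f : Truncated r B n)) =
      if d.degree < n then coeff d f else 0 := rfl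

lemma Truncated.mk_eq_mk_iff {n : ℕ} {f g : MvPowerSeries (Fin r) B} :
    (Ideal.Quotient.mk _ f : Truncated r B n) = Ideal.Quotient.mk _ g ↔
      ∀ d : Fin r →₀ ℕ, d.degree < n → coeff d f = coeff d g := by
  simp [Ideal.Quotient.eq, mem_ker_constantCoeff_pow_iff, sub_eq_zero]

lemma Truncated.mk_lift {n : ℕ} (x : Truncated r B n) : Ideal.Quotient.mk _ x.lift = x := by
  obtain ⟨f, rfl⟩ := Ideal.Quotient.mk_surjective x
  rw [Truncated.mk_eq_mk_iff]
  intro d hd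
  rw [Truncated.coeff_lift_mk, if_pos hd]

/-- The coefficients of a truncated power series are thus continuous for the quotient topology,
which is what gluing and clearing denominators over `S` require. -/
lemma Truncated.continuous_lift [TopologicalSpace B] {n : ℕ} :
    Continuous (Truncated.lift : Truncated r B n → _) := by
  refine Continuous.quotient_liftOn' (continuous_pi fun d => ?_) _
  split_ifs
  · exact WithPiTopology.continuous_coeff B d
  · exact _root_.continuous_const

/-- The power series with given truncations. -/
def Truncated.glue (x : ∀ n, Truncated r B n) : MvPowerSeries (Fin r) B :=
  -- `d.degree + 1` is the first level at which the coefficient of `d` survives truncation.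
  fun d => coeff d (x (d.degree + 1)).lift

lemma Truncated.coeff_glue (x : ∀ n, Truncated r B n) (d : Fin r →₀ ℕ) :
    coeff d (glue x) = coeff d (x (d.degree + 1)).lift := by
  rw [coeff_apply, glue]

/-- The transition map between the rings of truncated power series. -/
def Truncated.transition (n : ℕ) : Truncated r B (n + 1) →+* Truncated r B n :=
  Ideal.Quotient.factor (Ideal.pow_le_pow_right n.le_succ)

lemma Truncated.transition_mk (n : ℕ) (f : MvPowerSeries (Fin r) B) :
    Truncated.transition n (Ideal.Quotient.mk _ f) = Ideal.Quotient.mk _ f := rfl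

lemma Truncated.coeff_lift_transition (n : ℕ) (x : Truncated r B (n + 1)) (d : Fin r →₀ ℕ)
    (hd : d.degree < n) : coeff d (Truncated.transition n x).lift = coeff d x.lift := by
  obtain ⟨f, rfl⟩ := Ideal.Quotient.mk_surjective x
  rw [transition_mk, coeff_lift_mk, coeff_lift_mk, if_pos hd, if_pos (hd.trans n.lt_succ_self)]

lemma Truncated.coeff_lift_eq (x : ∀ n, Truncated r B n)
    (hx : ∀ n, Truncated.transition n (x (n + 1)) = x n) (d : Fin r →₀ ℕ) (n : ℕ)
    (hd : d.degree + 1 ≤ n) : coeff d (x n).lift = coeff d (x (d.degree + 1)).lift := by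
  induction n, hd using Nat.le_induction with
  | base => rfl
  | succ n hn ih =>
    exact ((coeff_lift_transition n (x (n + 1)) d hn).symm.trans (by rw [hx])).trans ih

lemma Truncated.mk_glue (x : ∀ n, Truncated r B n)
    (hx : ∀ n, Truncated.transition n (x (n + 1)) = x n) (n : ℕ) :
    Ideal.Quotient.mk _ (Truncated.glue x) = x n := by
  refine Eq.trans ?_ (Truncated.mk_lift (x n))
  exact Truncated.mk_eq_mk_iff.2 fun d hd =>
    (coeff_glue x d).trans (coeff_lift_eq x hx d n hd).symm

end MvPowerSeries

/-! ### Inverting `ℓ` and completing: from `ℤ_ℓ⟦x⟧` to `ℚ_ℓ⟦x⟧`. -/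

namespace CondensedCommRing

/-- A map `P → G` extends to `P[1/ℓ]` if `ℓ` is invertible in `G`. -/
def invertDesc {P G : CompHaus.{u}ᵒᵖ ⥤ CommRingCat.{u + 1}} (ℓ : ℕ) (c : P ⟶ G)
    (hG : ∀ S, IsUnit (ℓ : G.obj S)) : invert P ℓ ⟶ G where
  app S := CommRingCat.ofHom (IsLocalization.Away.lift (S := Localization.Away (ℓ : P.obj S))
    (ℓ : P.obj S) (g := (c.app S).hom) (by rw [map_natCast]; exact hG S))
  naturality S S' f := by
    ext : 1
    refine IsLocalization.ringHom_ext (R := P.obj S) (S := Localization.Away (ℓ : P.obj S))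
      (Submonoid.powers (ℓ : P.obj S)) ?_
    ext x
    have h1 : ((invert P ℓ).map f).hom (((toInvert P ℓ).app S).hom x) =
        ((toInvert P ℓ).app S').hom ((P.map f).hom x) :=
      congr($((toInvert P ℓ).naturality f).hom x).symm
    have h2 : (G.map f).hom ((c.app S).hom x) = (c.app S').hom ((P.map f).hom x) :=
      congr($(c.naturality f).hom x).symm
    have h3 := IsLocalization.Away.lift_eq (S := Localization.Away (ℓ : P.obj S)) (ℓ : P.obj S)
      (g := (c.app S).hom) (by rw [map_natCast]; exact hG S) x
    have h4 := IsLocalization.Away.lift_eq (S := Localization.Away (ℓ : P.obj S')) (ℓ : P.obj S')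
      (g := (c.app S').hom) (by rw [map_natCast]; exact hG S') ((P.map f).hom x)
    exact (congrArg _ h1).trans (h4.trans (h2.symm.trans (congrArg (G.map f).hom h3).symm))

lemma toInvert_desc {P G : CompHaus.{u}ᵒᵖ ⥤ CommRingCat.{u + 1}} (ℓ : ℕ) (c : P ⟶ G)
    (hG : ∀ S, IsUnit (ℓ : G.obj S)) : toInvert P ℓ ≫ invertDesc ℓ c hG = c := by
  ext S : 3
  ext x
  exact IsLocalization.Away.lift_eq (S := Localization.Away (ℓ : P.obj S)) (ℓ : P.obj S)
      (g := (c.app S).hom) (by rw [map_natCast]; exact hG S) x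

lemma invertLift_comp {P Q Z G : CompHaus.{u}ᵒᵖ ⥤ CommRingCat.{u + 1}} (ℓ : ℕ) (i : Z ⟶ Q)
    (hi : ∀ S, @IsLocalization.Away _ _ (ℓ : Z.obj S) (Q.obj S) _ (i.app S).hom.toAlgebra)
    (c : Z ⟶ P) (α : invert P ℓ ⟶ G) (β : Q ⟶ G) (h : c ≫ toInvert P ℓ ≫ α = i ≫ β) :
    invertLift ℓ i hi c ≫ α = β := by
  ext S : 3
  let _ := (i.app S).hom.toAlgebra
  have := hi S
  refine IsLocalization.ringHom_ext (Submonoid.powers (ℓ : Z.obj S)) ?_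
  ext x
  have h1 := IsLocalization.Away.lift_eq (S := Q.obj S) (ℓ : Z.obj S)
      (isUnit_invert ℓ (c.app S).hom) x
  exact (congrArg (α.app S).hom h1).trans congr(($(h).app S).hom x)

end CondensedCommRing

open scoped MvPowerSeries.WithPiTopology
open MvPowerSeries

namespace CondensedCommRing

/-- The topological ring of truncated power series. -/
abbrev topTruncated (r : ℕ) (A : TopCommRingCat.{w}) (n : ℕ) : TopCommRingCat.{w} :=
  .of (Truncated r A n)

/-- The truncation map. -/
def topTruncate (r : ℕ) (A : TopCommRingCat.{w}) (n : ℕ) :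
    topMvPowerSeries r A ⟶ topTruncated r A n :=
  ⟨Ideal.Quotient.mk _, continuous_quotient_mk'⟩

/-- The transition map between the rings of truncated power series. -/
def topTruncatedTransition (r : ℕ) (A : TopCommRingCat.{w}) (n : ℕ) :
    topTruncated r A (n + 1) ⟶ topTruncated r A n :=
  ⟨Truncated.transition n,
    continuous_quot_lift _ continuous_quotient_mk'⟩

lemma ideal_comap_pow {R S : Type*} [CommRing R] [CommRing S] (e : R ≃+* S) (J : Ideal S) (n : ℕ) :
    (J ^ n).comap e = (J.comap e) ^ n := by
  rw [← Ideal.map_symm, ← Ideal.map_symm, Ideal.map_pow]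

section

variable (r : ℕ) (A : TopCommRingCat.{u + 1}) (S : CompHaus.{u}ᵒᵖ)

lemma truncate_injective (x y : C(S.unop, topMvPowerSeries r A))
    (h : ∀ n, compHom (topTruncate r A n) S x = compHom (topTruncate r A n) S y) : x = y := by
  ext s : 1
  ext d
  have h1 : (Ideal.Quotient.mk _ (x s) : Truncated r A (d.degree + 1)) = Ideal.Quotient.mk _ (y s) :=
    congrArg (fun f => DFunLike.coe (F := C(S.unop, topTruncated r A (d.degree + 1))) f s)
      (h (d.degree + 1))
  exact Truncated.mk_eq_mk_iff.1 h1 d d.degree.lt_succ_self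

lemma exists_truncate_eq (x : ∀ n, C(S.unop, topTruncated r A n))
    (h : ∀ n, compHom (topTruncatedTransition r A n) S (x (n + 1)) = x n) :
    ∃ y : C(S.unop, topMvPowerSeries r A), ∀ n, compHom (topTruncate r A n) S y = x n := by
  have hx : ∀ s n, Truncated.transition n (x (n + 1) s) = x n s :=
    fun s n => (compHom_apply _ S (x (n + 1)) s).symm.trans (DFunLike.congr_fun (F := C(S.unop, topTruncated r A n)) (h n) s)
  refine ⟨⟨fun s => Truncated.glue fun n => x n s, continuous_pi fun d =>
    (WithPiTopology.continuous_coeff A d).comp (Truncated.continuous_lift.comp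
      (x (d.degree + 1)).continuous)⟩, fun n => ContinuousMap.ext fun s => ?_⟩
  exact (compHom_apply _ S _ s).trans 
    (Truncated.mk_glue (r := r) (B := A) (fun n => x n s) (hx s) n)

end

variable (ℓ : ℕ) [Fact ℓ.Prime] {r : ℕ} {R : TopCommRingCat.{u + 1}} (ε : R ⟶ topZl ℓ)
  (κ : topZl ℓ ⟶ R) (e : R ≃+* MvPowerSeries (Fin r) (topZl.{u} ℓ)) (he : Continuous e)
  (he' : Continuous e.symm) (hε : ∀ x, ε.1 x = constantCoeff (e x)) (hκ : ∀ a, e (κ.1 a) = C a)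

-- The power of the ideal is taken in `C(S, R)` but is described pointwise: `C(S, R) ≅ C(S, ℤ_ℓ)⟦x⟧`
-- identifies the kernel with the ideal of the variables, to which `mem_ker_constantCoeff_pow_iff`
-- applies over the ring `C(S, ℤ_ℓ)`.
include he he' hε in
lemma mem_ker_pow_iff (S : CompHaus.{u}ᵒᵖ) (f : C(S.unop, R)) (n : ℕ) :
    (f : (ofTop.{u}.obj R).obj.obj S) ∈ RingHom.ker (compHom ε S) ^ n ↔
      ∀ s (d : Fin r →₀ ℕ), d.degree < n → coeff d (e (f s)) = 0 := by
  let e₁ : C(S.unop, R) ≃+* C(S.unop, MvPowerSeries (Fin r) (topZl.{u} ℓ)) :=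
    { toFun := fun f => ⟨fun s => e (f s), he.comp f.continuous⟩
      invFun := fun f => ⟨fun s => e.symm (f s), he'.comp f.continuous⟩
      left_inv := fun f => by ext; simp
      right_inv := fun f => ContinuousMap.ext fun s => by simp
      map_mul' := fun f g => ContinuousMap.ext fun s => map_mul e _ _
      map_add' := fun f g => ContinuousMap.ext fun s => map_add e _ _ }
  let E := e₁.trans (continuousMapEquiv (Fin r) (topZl.{u} ℓ) S.unop)
  have h1 : RingHom.ker ((ofTop.map ε).hom.app S).hom = (RingHom.ker
      (constantCoeff (σ := Fin r) (R := C(S.unop, topZl.{u} ℓ)))).comap E := by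
    ext f
    refine ⟨fun h => ContinuousMap.ext fun s => ?_, fun h => ContinuousMap.ext fun s => ?_⟩
    · exact (hε _).symm.trans (congrArg (fun f => DFunLike.coe (F := C(S.unop, topZl.{u} ℓ)) f s) h)
    · exact (hε _).trans (congrArg (fun f => DFunLike.coe (F := C(S.unop, topZl.{u} ℓ)) f s) h)
  have h2 := ideal_comap_pow E (RingHom.ker
      (constantCoeff (σ := Fin r) (R := C(S.unop, topZl.{u} ℓ)))) n
  have h3 : f ∈ (RingHom.ker (constantCoeff (σ := Fin r) (R := C(S.unop, topZl.{u} ℓ)))).comap E ^ n ↔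
      E f ∈ RingHom.ker (constantCoeff (σ := Fin r) (R := C(S.unop, topZl.{u} ℓ))) ^ n := by
    rw [← h2, Ideal.mem_comap]
  rw [h1]
  refine h3.trans (mem_ker_constantCoeff_pow_iff.trans ?_)
  exact ⟨fun h s d hd => congrArg (fun f => DFunLike.coe (F := C(S.unop, topZl.{u} ℓ)) f s) (h d hd),
    fun h d hd => ContinuousMap.ext fun s => h s d hd⟩

/-- The comparison map from `C(S, R)` to `C(S, ℚ_ℓ⟦x⟧)`. -/
def toTopMvPowerSeriesQl : R ⟶ topMvPowerSeries r (topQl.{u} ℓ) :=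
  ⟨(MvPowerSeries.map (topZlToQl ℓ).1).comp e.toRingHom, (topMvPowerSeriesMap r (topZlToQl ℓ)).2.comp he⟩

lemma isUnit_natCast_topMvPowerSeries (S : CompHaus.{u}ᵒᵖ) :
    IsUnit (ℓ : (ofTop.{u}.obj (topMvPowerSeries r (topQl.{u} ℓ))).obj.obj S) := by
  have h0 : (ℓ : ℚ_[ℓ]) ≠ 0 := Nat.cast_ne_zero.2 (Fact.out : ℓ.Prime).ne_zero
  have h : IsUnit (ℓ : ULift.{u + 1} ℚ_[ℓ]) := by
    rw [← map_natCast (ULift.ringEquiv.symm : ℚ_[ℓ] ≃+* ULift.{u + 1} ℚ_[ℓ]) ℓ]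
    exact (Ne.isUnit h0).map _
  let φ : topQl.{u} ℓ →+* C(S.unop, topMvPowerSeries r (topQl.{u} ℓ)) :=
    (algebraMap (MvPowerSeries (Fin r) (topQl.{u} ℓ))
      C(S.unop, MvPowerSeries (Fin r) (topQl.{u} ℓ))).comp C
  have h1 := h.map φ
  rwa [map_natCast] at h1

/-- The comparison map from `C(S, R)[1/ℓ]` to `C(S, ℚ_ℓ⟦x⟧)`. -/
def invertToTopMvPowerSeriesQl :
    invert (ofTop.{u}.obj R).obj ℓ ⟶ (ofTop.{u}.obj (topMvPowerSeries r (topQl.{u} ℓ))).obj :=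
  invertDesc ℓ (ofTop.map (toTopMvPowerSeriesQl ℓ e he)).hom (isUnit_natCast_topMvPowerSeries ℓ)

lemma invertToTopMvPowerSeriesQl_toInvert (S : CompHaus.{u}ᵒᵖ) (f : C(S.unop, R)) :
    (invertToTopMvPowerSeriesQl ℓ e he).app S ((toInvert (ofTop.{u}.obj R).obj ℓ).app S f) =
      compHom (toTopMvPowerSeriesQl ℓ e he) S f :=
  congr($(toInvert_desc ℓ (ofTop.map (toTopMvPowerSeriesQl ℓ e he)).hom
    (isUnit_natCast_topMvPowerSeries ℓ)).app S f)

lemma compHom_truncate_eq_zero_iff {A : TopCommRingCat.{u + 1}} (S : CompHaus.{u}ᵒᵖ) (n : ℕ)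
    (f : C(S.unop, topMvPowerSeries r A)) :
    compHom (topTruncate r A n) S f = 0 ↔
      ∀ s (d : Fin r →₀ ℕ), d.degree < n → coeff d (f s) = 0 := by
  have h : ∀ s, (topTruncate r A n).1 (f s) = 0 ↔
      ∀ (d : Fin r →₀ ℕ), d.degree < n → coeff d (f s) = 0 := fun s =>
    Ideal.Quotient.eq_zero_iff_mem.trans mem_ker_constantCoeff_pow_iff
  refine ⟨fun hf s => (h s).1 ?_, fun hf => ContinuousMap.ext fun s => ?_⟩
  · exact (compHom_apply (topTruncate r A n) S f s).symm.trans
      (DFunLike.congr_fun (F := C(S.unop, topTruncated r A n)) hf s)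
  · exact (compHom_apply (topTruncate r A n) S f s).trans ((h s).2 (hf s))

lemma compHom_truncate_toTopMvPowerSeriesQl_eq_zero_iff (S : CompHaus.{u}ᵒᵖ) (n : ℕ)
    (f : C(S.unop, R)) :
    compHom (topTruncate r (topQl ℓ) n) S (compHom (toTopMvPowerSeriesQl ℓ e he) S f) = 0 ↔
      ∀ s (d : Fin r →₀ ℕ), d.degree < n → coeff d (e (f s)) = 0 := by
  refine (compHom_truncate_eq_zero_iff S n _).trans ?_
  have hinj : Function.Injective (topZlToQl.{u} ℓ).1 := by
    intro x y h
    apply ULift.ext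
    exact Subtype.ext (congrArg ULift.down h)
  refine forall_congr' fun s => forall_congr' fun d => forall_congr' fun _ => ?_
  exact map_eq_zero_iff _ hinj

/-- The comparison map from `C(S, R)[1/ℓ]` to the truncated power series. -/
def invertToTruncated (n : ℕ) :
    invert (ofTop.{u}.obj R).obj ℓ ⟶ (ofTop.{u}.obj (topTruncated r (topQl.{u} ℓ) n)).obj :=
  invertToTopMvPowerSeriesQl ℓ e he ≫ (ofTop.map (topTruncate r (topQl ℓ) n)).hom

omit [Fact ℓ.Prime] in
lemma exists_invert_mul_pow_eq (S : CompHaus.{u}ᵒᵖ) (x : (invert (ofTop.{u}.obj R).obj ℓ).obj S) :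
    ∃ (k : ℕ) (f : C(S.unop, R)),
      x * (ℓ : (invert (ofTop.{u}.obj R).obj ℓ).obj S) ^ k = (toInvert (ofTop.{u}.obj R).obj ℓ).app S f := by
  let P := (ofTop.{u}.obj R).obj.obj S
  obtain ⟨⟨f, ⟨_, k, rfl⟩⟩, hf⟩ := IsLocalization.surj (S := Localization.Away (ℓ : P))
    (Submonoid.powers (ℓ : P)) x
  refine ⟨k, f, Eq.trans ?_ hf⟩
  congr 1
  change (ℓ : Localization.Away (ℓ : P)) ^ k = algebraMap P _ ((ℓ : P) ^ k)
  rw [map_pow, map_natCast]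

omit [Fact ℓ.Prime] in
lemma isUnit_natCast_invert (P : CompHaus.{u}ᵒᵖ ⥤ CommRingCat.{u + 1}) (S : CompHaus.{u}ᵒᵖ) :
    IsUnit (ℓ : (invert P ℓ).obj S) := by
  have h := IsLocalization.Away.algebraMap_isUnit (S := Localization.Away (ℓ : P.obj S))
    (ℓ : P.obj S)
  rwa [map_natCast] at h

-- Since `ℓ` is a unit, denominators can be cleared, and membership reduces to `mem_ker_pow_iff`
-- because `ℤ_ℓ → ℚ_ℓ` is injective.
include he' hε in
lemma ker_invertToTruncated (n : ℕ) (S : CompHaus.{u}ᵒᵖ) :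
    RingHom.ker ((invertToTruncated ℓ e he n).app S).hom =
      invertKer ℓ (ofTop.map ε).hom S ^ n := by
  have hf : ∀ f : C(S.unop, R), (invertToTruncated ℓ e he n).app S
      ((toInvert (ofTop.{u}.obj R).obj ℓ).app S f) = 0 ↔
        (f : (ofTop.{u}.obj R).obj.obj S) ∈ RingHom.ker (compHom ε S) ^ n := by
    intro f
    rw [mem_ker_pow_iff ℓ ε e he he' hε,
      ← compHom_truncate_toTopMvPowerSeriesQl_eq_zero_iff ℓ e he S n f,
      ← invertToTopMvPowerSeriesQl_toInvert]
    rfl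
  rw [invertKer, ← Ideal.map_pow]
  refine le_antisymm (fun x hx => ?_) (Ideal.map_le_iff_le_comap.2 fun f hf' => (hf f).2 hf')
  obtain ⟨k, f, hk⟩ := exists_invert_mul_pow_eq ℓ S x
  have hu := (isUnit_natCast_invert ℓ (ofTop.{u}.obj R).obj S).pow k
  have h1 : (invertToTruncated ℓ e he n).app S ((toInvert (ofTop.{u}.obj R).obj ℓ).app S f) = 0 := by
    rw [← hk, map_mul]
    have h2 : (invertToTruncated ℓ e he n).app S x = 0 := hx
    rw [h2, zero_mul]
  rw [← Ideal.mul_unit_mem_iff_mem _ hu, hk]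
  exact Ideal.mem_map_of_mem _ ((hf f).1 h1)

lemma exists_pow_mul_eq (S : CompHaus.{u}ᵒᵖ) (f : C(S.unop, topQl.{u} ℓ)) :
    ∃ (k : ℕ) (z : C(S.unop, topZl.{u} ℓ)), ∀ s, (topZlToQl ℓ).1 (z s) = f s * (ℓ : topQl.{u} ℓ) ^ k := by
  let φ : C(S.unop, topZl.{u} ℓ) →+* C(S.unop, topQl.{u} ℓ) := compHom (topZlToQl ℓ) S
  obtain ⟨⟨z, ⟨_, k, rfl⟩⟩, hz⟩ := @IsLocalization.surj _ _ _ _ _ φ.toAlgebra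
    (isLocalization_topZlToQl ℓ S) f
  refine ⟨k, z, fun s => ?_⟩
  have h1 : f * (ℓ : C(S.unop, topQl.{u} ℓ)) ^ k = φ z := by
    rw [← map_natCast φ ℓ, ← map_pow]
    exact hz
  exact (DFunLike.congr_fun h1 s).symm

/-- Each coefficient has a bounded denominator by compactness of `S`, and after truncation only
finitely many coefficients matter, so a common power of `ℓ` works. -/
lemma exists_pow_mul_eq_topMvPowerSeries (n : ℕ) (S : CompHaus.{u}ᵒᵖ)
    (y : C(S.unop, topTruncated r (topQl.{u} ℓ) n)) :
    ∃ (k : ℕ) (z : C(S.unop, topMvPowerSeries r (topZl.{u} ℓ))),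
      ∀ s, Ideal.Quotient.mk _ (MvPowerSeries.map (topZlToQl ℓ).1 (z s)) =
        y s * (ℓ : Truncated r (topQl.{u} ℓ) n) ^ k := by
  classical
  choose k z hz using fun d : Fin r →₀ ℕ => exists_pow_mul_eq ℓ S
    ⟨fun s => coeff d (y s).lift, (WithPiTopology.continuous_coeff (topQl.{u} ℓ) d).comp
      (Truncated.continuous_lift.comp y.continuous)⟩
  let D : Finset (Fin r →₀ ℕ) := (Finsupp.finite_of_degree_le n).toFinset
  let K := D.sup k
  -- Outside `D` the exponent `K - k d` may be cut off at zero; this is harmless because those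
  -- monomials vanish in the truncation.
  refine ⟨K, ⟨fun s d => (ℓ : topZl.{u} ℓ) ^ (K - k d) * z d s, continuous_pi fun d =>
    continuous_const.mul (z d).continuous⟩, fun s => ?_⟩
  have h1 : y s * (ℓ : Truncated r (topQl.{u} ℓ) n) ^ K =
      Ideal.Quotient.mk _ ((y s).lift * C ((ℓ : topQl.{u} ℓ) ^ K)) := by
    rw [map_mul, Truncated.mk_lift, map_pow, map_natCast, map_pow, map_natCast]
  rw [h1, Truncated.mk_eq_mk_iff]
  intro d hd
  have hk : k d ≤ K := Finset.le_sup (f := k) (by simpa [D] using hd.le)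
  rw [coeff_map, coeff_mul_C]
  change (topZlToQl ℓ).1 ((ℓ : topZl.{u} ℓ) ^ (K - k d) * z d s) = _
  rw [map_mul, hz, map_pow, map_natCast]
  change _ * (coeff d (y s).lift * _) = _
  rw [mul_left_comm, ← pow_add, Nat.sub_add_cancel hk]

include he' in
lemma surjective_invertToTruncated (n : ℕ) (S : CompHaus.{u}ᵒᵖ) :
    Function.Surjective ((invertToTruncated ℓ e he n).app S) := by
  intro y
  let y' : C(S.unop, topTruncated r (topQl.{u} ℓ) n) := y
  obtain ⟨k, z, hz⟩ := exists_pow_mul_eq_topMvPowerSeries ℓ n S y'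
  let f : C(S.unop, R) := ⟨fun s => e.symm (z s), he'.comp z.continuous⟩
  obtain ⟨v, hv⟩ := (isUnit_natCast_invert ℓ (ofTop.{u}.obj R).obj S).pow k
  have h1 : (invertToTruncated ℓ e he n).app S ((toInvert (ofTop.{u}.obj R).obj ℓ).app S f) =
      y * (ℓ : (ofTop.{u}.obj (topTruncated r (topQl.{u} ℓ) n)).obj.obj S) ^ k := by
    refine (congrArg (compHom (topTruncate r (topQl ℓ) n) S)
      (invertToTopMvPowerSeriesQl_toInvert ℓ e he S f)).trans ?_
    refine ContinuousMap.ext fun s => ?_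
    have h2 : (Ideal.Quotient.mk _ (MvPowerSeries.map (topZlToQl ℓ).1 (e (e.symm (z s)))) :
        Truncated r (topQl.{u} ℓ) n) = y' s * (ℓ : Truncated r (topQl.{u} ℓ) n) ^ k := by
      rw [e.apply_symm_apply, hz]
    exact h2
  refine ⟨(toInvert (ofTop.{u}.obj R).obj ℓ).app S f * ↑v⁻¹, ?_⟩
  have h3 : (invertToTruncated ℓ e he n).app S (v : (invert (ofTop.{u}.obj R).obj ℓ).obj S) =
      (ℓ : (ofTop.{u}.obj (topTruncated r (topQl.{u} ℓ) n)).obj.obj S) ^ k := by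
    rw [hv, map_pow, map_natCast]
  rw [map_mul, h1, ← h3, mul_assoc, ← map_mul, Units.mul_inv, map_one, mul_one]

-- The truncations of `ℚ_ℓ⟦x⟧` are the quotients of `C(S, R)[1/ℓ]` by the powers of the ideal, for
-- every `S`, and `ℚ_ℓ⟦x⟧` is sectionwise their limit; hence `exists_iso_adicCompletion` applies.
include he he' hε hκ in
theorem exists_iso_adicCompletion_topMvPowerSeries :
    ∃ i : adicCompletion (invertKer ℓ (ofTop.map ε).hom) (invertKer_le_comap ℓ _) ≅
        ofTop.obj (topMvPowerSeries r (topQl ℓ)),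
      toAdicCompletion _ _ _ (invertLift ℓ (ofTop.map (topZlToQl ℓ)).hom
        (isLocalization_topZlToQl ℓ) (ofTop.map κ).hom) ≫ i.hom =
          ofTop.map (topMvPowerSeriesC r (topQl ℓ)) := by
  obtain ⟨i, hi⟩ := exists_iso_adicCompletion (invertKer ℓ (ofTop.map ε).hom)
    (invertKer_le_comap ℓ _) (fun n => ofTop.obj (topTruncated r (topQl ℓ) n))
    (invertToTruncated ℓ e he) (ker_invertToTruncated ℓ ε e he he' hε)
    (fun n => ofTop.map (topTruncatedTransition r (topQl ℓ) n)) (fun n => rfl)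
    (ofTop.obj (topMvPowerSeries r (topQl ℓ))) (fun n => ofTop.map (topTruncate r (topQl ℓ) n))
    (fun n => rfl) (surjective_invertToTruncated ℓ e he he')
    (truncate_injective r (topQl ℓ)) (exists_truncate_eq r (topQl ℓ))
  refine ⟨i, hi _ _ _ fun n => ?_⟩
  have h : invertLift ℓ (ofTop.map (topZlToQl ℓ)).hom
      (isLocalization_topZlToQl ℓ) (ofTop.map κ).hom ≫ invertToTopMvPowerSeriesQl ℓ e he =
        (ofTop.map (topMvPowerSeriesC r (topQl ℓ))).hom := by
    refine invertLift_comp _ _ _ _ _ _ ?_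
    rw [invertToTopMvPowerSeriesQl, toInvert_desc]
    ext S : 3
    ext f
    refine ContinuousMap.ext fun s => ?_
    have h1 : ∀ a, MvPowerSeries.map (topZlToQl ℓ).1 (e (κ.1 a)) = C ((topZlToQl ℓ).1 a) :=
      fun a => by rw [hκ, map_C]
    exact h1 _
  exact congrArg (· ≫ (ofTop.map (topTruncate r (topQl ℓ) n)).hom) h

end CondensedCommRing

/-! ### The `ℓ`-power torsion points of a torus. -/

section TateBasis

lemma IsTateBasis.of_mulEquiv {ℓ r : ℕ} {G H : Type*} [CommGroup G] [CommGroup H] (e : H ≃* G)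
    {γ : ∀ n, Fin r → torsionSubgroup H (ℓ ^ n)} (hγ : IsTateBasis ℓ γ) :
    IsTateBasis ℓ fun n i => (⟨e (γ n i), by
      have h := (γ n i).2
      rw [MonoidHom.mem_ker, powMonoidHom_apply] at h ⊢
      rw [← map_pow, h, map_one]⟩ : torsionSubgroup G (ℓ ^ n)) := by
  have key : ∀ n (a : Fin r → ℕ), ((∏ i, γ n i ^ a i : torsionSubgroup H (ℓ ^ n)) : H) =
      ∏ i, (γ n i : H) ^ a i := fun n a => by simp
  refine ⟨fun n i => ?_, fun n g => ?_, fun n a b h => ?_⟩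
  · apply Subtype.ext
    have h1 : ((γ (n + 1) i : H)) ^ ℓ = γ n i := congrArg Subtype.val (hγ.transition n i)
    change e (γ (n + 1) i) ^ ℓ = e (γ n i)
    rw [← map_pow, h1]
  · obtain ⟨a, ha⟩ := hγ.exists_prod_pow_eq n ⟨e.symm g, by
      have h := g.2
      rw [MonoidHom.mem_ker, powMonoidHom_apply] at h ⊢
      rw [← map_pow, h, map_one]⟩
    refine ⟨a, Subtype.ext ?_⟩
    have h1 : ∏ i, (γ n i : H) ^ a i = e.symm g := (key n a).symm.trans (congrArg Subtype.val ha)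
    rw [← e.apply_symm_apply (g : G), ← h1]
    simp
  · refine hγ.modEq n a b (Subtype.ext ?_)
    have h1 := congrArg Subtype.val h
    simp only [Subgroup.val_finsetProd, SubmonoidClass.coe_pow, ← map_pow, ← map_prod] at h1
    rw [key, key]
    exact e.injective h1

/-- If `x` has order `ℓ^(n+1)`, any `ℓ`-th root of `x` has order `ℓ^(n+2)`. The recursion starts at
order `ℓ`, since an `ℓ`-th root of `1` could be `1`. -/
lemma exists_compatible_roots (k : Type*) [Field k] [IsAlgClosed k] (ℓ : ℕ) [hp : Fact ℓ.Prime]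
    (hℓ : (ℓ : k) ≠ 0) :
    ∃ ζ : ℕ → kˣ, (∀ n, orderOf (ζ n) = ℓ ^ n) ∧ ∀ n, ζ (n + 1) ^ ℓ = ζ n := by
  have : NeZero (ℓ : k) := ⟨hℓ⟩
  have : NeZero ℓ := ⟨hp.out.ne_zero⟩
  have h0 : ∃ x : kˣ, orderOf x = ℓ ^ (0 + 1) := by
    obtain ⟨x, hx⟩ := HasEnoughRootsOfUnity.exists_primitiveRoot k ℓ
    obtain ⟨v, rfl⟩ := hx.isUnit hp.out.ne_zero
    exact ⟨v, by rw [← orderOf_units, ← hx.eq_orderOf, zero_add, pow_one]⟩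
  have hs : ∀ n (x : kˣ), orderOf x = ℓ ^ (n + 1) →
      ∃ y : kˣ, orderOf y = ℓ ^ (n + 1 + 1) ∧ y ^ ℓ = x := by
    intro n x hx
    obtain ⟨z, hz⟩ := IsAlgClosed.exists_pow_nat_eq (x : k) hp.out.pos
    have hz0 : z ≠ 0 := by
      rintro rfl
      rw [zero_pow hp.out.ne_zero] at hz
      exact x.ne_zero hz.symm
    have hy : (Units.mk0 z hz0) ^ ℓ = x := Units.ext hz
    refine ⟨Units.mk0 z hz0, orderOf_eq_prime_pow ?_ ?_, hy⟩
    · rw [pow_succ', pow_mul, hy]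
      exact pow_ne_one_of_lt_orderOf (pow_ne_zero _ hp.out.ne_zero)
        (by rw [hx]; exact Nat.pow_lt_pow_right hp.out.one_lt n.lt_succ_self)
    · rw [pow_succ', pow_mul, hy, ← hx, pow_orderOf_eq_one]
  choose s hs1 hs2 using hs
  let a : ∀ n : ℕ, {x : kˣ // orderOf x = ℓ ^ (n + 1)} := fun n => Nat.rec ⟨h0.choose, h0.choose_spec⟩
    (fun n x => ⟨s n x.1 x.2, hs1 n x.1 x.2⟩) n
  have ha : ∀ n, (a (n + 1)).1 ^ ℓ = (a n).1 := fun n => hs2 n _ _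
  -- Raising to the power `ℓ` corrects the shift: `a n` has order `ℓ^(n+1)`.
  refine ⟨fun n => (a n).1 ^ ℓ, fun n => ?_, fun n => congrArg (· ^ ℓ) (ha n)⟩
  have h1 : ℓ ∣ orderOf (a n).1 := by rw [(a n).2]; exact dvd_pow_self _ n.succ_ne_zero
  rw [orderOf_pow_of_dvd hp.out.ne_zero h1, (a n).2, pow_succ, Nat.mul_div_cancel _ hp.out.pos]

lemma exists_isTateBasis_pi {k : Type*} [Field k] (ℓ r : ℕ) [hp : Fact ℓ.Prime] (ζ : ℕ → kˣ)
    (h : ∀ n, orderOf (ζ n) = ℓ ^ n) (h' : ∀ n, ζ (n + 1) ^ ℓ = ζ n) :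
    ∃ γ : ∀ n, Fin r → torsionSubgroup (Fin r → kˣ) (ℓ ^ n), IsTateBasis ℓ γ := by
  classical
  let γ : ∀ n, Fin r → torsionSubgroup (Fin r → kˣ) (ℓ ^ n) := fun n i =>
    ⟨Pi.mulSingle i (ζ n), by
      rw [MonoidHom.mem_ker, powMonoidHom_apply, ← Pi.mulSingle_pow, ← h n, pow_orderOf_eq_one,
        Pi.mulSingle_one]⟩
  have key : ∀ n (a : Fin r → ℕ), ((∏ i, γ n i ^ a i : torsionSubgroup (Fin r → kˣ) (ℓ ^ n)) :
      Fin r → kˣ) = fun i => ζ n ^ a i := by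
    intro n a
    simp only [Subgroup.val_finsetProd, SubmonoidClass.coe_pow, γ, ← Pi.mulSingle_pow]
    exact Finset.univ_prod_mulSingle fun i => ζ n ^ a i
  refine ⟨γ, fun n i => ?_, fun n g => ?_, fun n a b hab i => ?_⟩
  · apply Subtype.ext
    change (Pi.mulSingle i (ζ (n + 1)) : Fin r → kˣ) ^ ℓ = Pi.mulSingle i (ζ n)
    rw [← Pi.mulSingle_pow, h']
  · have hg : ∀ i, ∃ a : ℕ, ζ n ^ a = g.1 i := by
      intro i
      have h1 : g.1 i ^ ℓ ^ n = 1 := congrFun (g.2 : g.1 ^ ℓ ^ n = 1) i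
      have : NeZero (ℓ ^ n) := ⟨pow_ne_zero _ hp.out.ne_zero⟩
      have h2 : IsPrimitiveRoot (ζ n : k) (ℓ ^ n) := by
        rw [IsPrimitiveRoot.coe_units_iff, ← h n]
        exact IsPrimitiveRoot.orderOf _
      obtain ⟨a, -, ha⟩ := h2.eq_pow_of_pow_eq_one (ξ := (g.1 i : k)) (by
        rw [← Units.val_pow_eq_pow_val, h1, Units.val_one])
      exact ⟨a, Units.ext ha⟩
    choose a ha using hg
    exact ⟨a, Subtype.ext ((key n a).trans (funext ha))⟩
  · have h1 := congrFun (((key n a).symm.trans (congrArg Subtype.val hab)).trans (key n b)) i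
    rw [← h n]
    exact pow_eq_pow_iff_modEq.1 h1

variable {k : Type u} [Field k]

section

open scoped MonObj

/-- The `k`-algebra homomorphism `k[ℤ^r] → k` attached to an `r`-tuple of units. -/
def torusPoint (r : ℕ) :
    (Fin r → kˣ) →* WithConv (AddMonoidAlgebra k (Fin r → ℤ) →ₐ[k] k) where
  toFun t := .toConv (AddMonoidAlgebra.lift k k (Fin r → ℤ)
    { toFun := fun a => ((∏ i, t i ^ (a.toAdd i) : kˣ) : k)
      map_one' := by simp
      map_mul' := fun a b => by simp [zpow_add, Finset.prod_mul_distrib] })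
  map_one' := by
    apply WithConv.ext
    refine AddMonoidAlgebra.algHom_ext (fun a => ?_) (Subsingleton.elim _ _)
    simp [AlgHom.convOne_def]
  map_mul' t s := by
    apply WithConv.ext
    refine AddMonoidAlgebra.algHom_ext (fun a => ?_) (Subsingleton.elim _ _)
    refine Eq.trans ?_ (convMul_single r _ _ a).symm
    simp [mul_zpow, Finset.prod_mul_distrib]

/-- An algebra map `k[ℤ^r] → k` is a character of `ℤ^r`, determined by arbitrary unit values on the
standard basis. -/
lemma torusPoint_bijective (r : ℕ) : Function.Bijective (torusPoint (k := k) r) := by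
  classical
  have hsingle : ∀ (t : Fin r → kˣ) i,
      (torusPoint r t).ofConv (AddMonoidAlgebra.single (Pi.single i 1) 1) = t i := by
    intro t i
    simp only [torusPoint, MonoidHom.coe_mk, OneHom.coe_mk, WithConv.ofConv_toConv,
      AddMonoidAlgebra.lift_single, one_smul]
    change ((∏ j, t j ^ (Pi.single i (1 : ℤ) : Fin r → ℤ) j : kˣ) : k) = t i
    rw [Finset.prod_eq_single i] <;> simp +contextual
  refine ⟨fun t s h => funext fun i => Units.ext ?_, fun f => ?_⟩
  · rw [← hsingle, ← hsingle, h]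
  · have hf : ∀ a : Fin r → ℤ, f.ofConv (AddMonoidAlgebra.single a 1) *
        f.ofConv (AddMonoidAlgebra.single (-a) 1) = 1 := fun a => by
      rw [← map_mul, AddMonoidAlgebra.single_mul_single, add_neg_cancel, mul_one,
        ← AddMonoidAlgebra.one_def, map_one]
    let t : Fin r → kˣ := fun i => ⟨f.ofConv (AddMonoidAlgebra.single (Pi.single i 1) 1),
      f.ofConv (AddMonoidAlgebra.single (-Pi.single i 1) 1), hf _, by rw [mul_comm]; exact hf _⟩
    refine ⟨t, WithConv.ext ?_⟩
    let toAdd (φ : AddMonoidAlgebra k (Fin r → ℤ) →ₐ[k] k) : (Fin r → ℤ) →+ Additive k :=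
      { toFun := fun a => Additive.ofMul (φ (AddMonoidAlgebra.single a 1))
        map_zero' := by rw [← AddMonoidAlgebra.one_def, map_one]; rfl
        map_add' := fun a b => by
          rw [← ofMul_mul, ← map_mul, AddMonoidAlgebra.single_mul_single, _root_.mul_one] }
    have hadd : toAdd (torusPoint r t).ofConv = toAdd f.ofConv := by
      apply AddMonoidHom.functions_ext'
      intro i
      apply AddMonoidHom.ext_int
      exact congrArg Additive.ofMul (hsingle t i)
    exact AddMonoidAlgebra.algHom_ext
      (fun a => congrArg Additive.toMul (DFunLike.congr_fun hadd a)) (Subsingleton.elim _ _)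

lemma exists_mulEquiv_kPoints (T : Over (Spec (.of k))) [CommGrpObj T] [IsTorus T] :
    ∃ r, Nonempty ((Fin r → kˣ) ≃* KPoints T) := by
  obtain ⟨r, e, he⟩ := IsTorus.exists_iso (T := T)
  -- The unit object has the identity as structure map, the other copy of `Spec k` the map induced
  -- by `algebraMap k k`.
  let i : (Spec (.of k)).asOver (Spec (.of k)) ≅
      MonoidalCategoryStruct.tensorUnit (Over (Spec (.of k))) :=
    Over.isoMk (Iso.refl _) (by
      change 𝟙 _ ≫ 𝟙 _ = Spec.map (CommRingCat.ofHom (algebraMap k k))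
      rw [Category.comp_id]; exact (Spec.map_id _).symm)
  let F : KPoints T ≃* ((Spec (.of k)).asOver (Spec (.of k)) ⟶ splitTorus k r) :=
    { toFun := fun x => i.hom ≫ x ≫ e.hom
      invFun := fun x => i.inv ≫ x ≫ e.inv
      left_inv := fun x => by simp
      right_inv := fun x => by simp
      map_mul' := fun x y => by rw [MonObj.mul_comp, MonObj.comp_mul] }
  let E := Spec.mapMulEquiv (R := k) (S := AddMonoidAlgebra k (Fin r → ℤ)) (T := k)
  exact ⟨r, ⟨(MulEquiv.ofBijective _ (torusPoint_bijective (k := k) r)).trans (E.trans F.symm)⟩⟩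

lemma exists_isTateBasis_kPoints [IsAlgClosed k] (T : Over (Spec (.of k))) [CommGrpObj T] [IsTorus T]
    (ℓ : ℕ) [Fact ℓ.Prime] (hℓ : (ℓ : k) ≠ 0) :
    ∃ (r : ℕ) (t : ∀ n, Fin r → torsionSubgroup (KPoints T) (ℓ ^ n)), IsTateBasis ℓ t := by
  obtain ⟨r, ⟨e⟩⟩ := exists_mulEquiv_kPoints T
  obtain ⟨ζ, h, h'⟩ := exists_compatible_roots k ℓ hℓ
  obtain ⟨t, ht⟩ := exists_isTateBasis_pi ℓ r ζ h h'
  exact ⟨r, _, ht.of_mulEquiv e⟩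

end

end TateBasis

/-! ### Universe lifts, and the topology of `ℤ_ℓ`. -/

section ULift

open scoped MvPowerSeries.WithPiTopology
open MvPowerSeries

lemma IsTateBasis.exists_ulift_ringEquiv {ℓ : ℕ} [Fact ℓ.Prime] {G : Type*} [CommGroup G] {r : ℕ}
    {γ : ∀ n, Fin r → torsionSubgroup G (ℓ ^ n)} (hγ : IsTateBasis ℓ γ)
    {A : Type*} [CommRing A] [TopologicalSpace A] [IsTopologicalRing A] [IsLinearTopology A A]
    [CompactSpace A] [T2Space A] [∀ n, Finite (torsionSubgroup G (ℓ ^ n))]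
    (hℓ : IsTopologicallyNilpotent (ℓ : A)) :
    ∃ e : ULift.{w} (completedGroupAlgebra A ℓ G) ≃+* MvPowerSeries (Fin r) (ULift.{w'} A),
      Continuous e ∧ Continuous e.symm ∧
        (∀ a, e (uliftRingHom (completedGroupAlgebra.const A ℓ G) a) = C a) ∧
          ∀ x, uliftRingHom (completedGroupAlgebra.augmentation A ℓ G) x = constantCoeff (e x) := by
  obtain ⟨e, h1, h2, h3, h4⟩ := hγ.exists_ringEquiv (A := A) hℓ
  let m : MvPowerSeries (Fin r) A ≃+* MvPowerSeries (Fin r) (ULift.{w'} A) :=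
    RingEquiv.ofRingHom (MvPowerSeries.map (ULift.ringEquiv.symm : A ≃+* ULift.{w'} A).toRingHom)
      (MvPowerSeries.map (ULift.ringEquiv : ULift.{w'} A ≃+* A).toRingHom)
      (by ext; rfl) (by ext; rfl)
  have hm : Continuous m := continuous_pi fun d =>
    continuous_uliftUp.comp (WithPiTopology.continuous_coeff A d)
  have hm' : Continuous m.symm := continuous_pi fun d =>
    continuous_uliftDown.comp (WithPiTopology.continuous_coeff (ULift.{w'} A) d)
  refine ⟨(ULift.ringEquiv.trans e.symm).trans m, ?_, ?_, fun a => ?_, fun x => ?_⟩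
  · exact hm.comp (h2.comp continuous_uliftDown)
  · exact continuous_uliftUp.comp (h1.comp hm')
  · have h5 : e.symm (completedGroupAlgebra.const A ℓ G a.down) = C a.down := by
      rw [← h3, e.symm_apply_apply]
    exact (congrArg m h5).trans
      (MvPowerSeries.map_C (ULift.ringEquiv.symm : A ≃+* ULift.{w'} A).toRingHom a.down)
  · have h5 := h4 (e.symm x.down)
    rw [e.apply_symm_apply] at h5
    exact congrArg ULift.up h5

end ULift

section Padic

variable (ℓ : ℕ) [hp : Fact ℓ.Prime]

/-- The closed balls of radius `ℓ^(-n)` around zero are the ideals `(ℓ^n)`. -/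
lemma PadicInt.isLinearTopology : IsLinearTopology ℤ_[ℓ] ℤ_[ℓ] := by
  refine IsLinearTopology.mk_of_hasBasis' (ι := ℕ) (p := fun _ => True) (s := fun n =>
    (Ideal.span {(ℓ : ℤ_[ℓ]) ^ n} : Ideal ℤ_[ℓ])) _ ?_ fun i r m hm => Ideal.mul_mem_left _ _ hm
  have h1 : (1 : ℝ) < ℓ := by exact_mod_cast hp.out.one_lt
  have h := Metric.nhds_basis_closedBall_pow (x := (0 : ℤ_[ℓ])) (inv_pos.2 (zero_lt_one.trans h1))
    (inv_lt_one_of_one_lt₀ h1)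
  refine h.congr (fun _ => Iff.rfl) fun n _ => Set.ext fun x => ?_
  rw [mem_closedBall_zero_iff, SetLike.mem_coe, ← PadicInt.norm_le_pow_iff_mem_span_pow, zpow_neg,
    zpow_natCast, inv_pow]

lemma PadicInt.isTopologicallyNilpotent_prime : IsTopologicallyNilpotent (ℓ : ℤ_[ℓ]) := by
  refine tendsto_pow_atTop_nhds_zero_of_norm_lt_one ?_
  rw [PadicInt.norm_p]
  exact inv_lt_one_of_one_lt₀ (by exact_mod_cast hp.out.one_lt)

end Padic

/-! ### Filtered colimits of condensed rings with sectionwise base change. -/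

namespace CondensedCommRing

section colimit

variable {J : Type} [SmallCategory J] [IsFiltered J] {j₀ : J} (hj₀ : IsInitial j₀)
  (D : J ⥤ CondensedCommRing.{u}) {L : CondensedCommRing.{u}} (φ : L ⟶ D.obj j₀)
  (sq : ∀ S j, IsPushout (constMap L.obj S) ((φ ≫ D.map (hj₀.to j)).hom.app (op point))
    ((φ ≫ D.map (hj₀.to j)).hom.app S) (constMap (D.obj j).obj S))
  (hφ : (φ.hom.app (op point)).hom.Flat)
  (hD : ∀ {i j : J} (f : i ⟶ j), ((D.map f).hom.app (op point)).hom.Flat)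

omit [IsFiltered J] in
instance hasColimitsOfShape_commRingCat : HasColimitsOfShape J CommRingCat.{u + 1} :=
  have := hasColimitsOfSizeShrink.{0, 0, u + 1, u + 1} CommRingCat.{u + 1}
  inferInstance

instance preservesColimitsOfShape_forget_commRingCat :
    PreservesColimitsOfShape J (forget CommRingCat.{u + 1}) :=
  have := preservesSmallestFilteredColimits_of_preservesFilteredColimits.{u + 1, u + 1}
    (forget CommRingCat.{u + 1})
  PreservesFilteredColimitsOfSize.preserves_filtered_colimits J

include sq hφ hD in
lemma preservesColimit_sheafToPresheaf :
    PreservesColimit D (sheafToPresheaf (coherentTopology CompHaus.{u}) CommRingCat.{u + 1}) := by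
  refine preservesColimit_of_isPushout hj₀ D φ sq fun c hc => ?_
  exact hφ.comp (flat_ι_of_isColimit c hc (fun f => hD f) j₀)

include sq hφ hD in
lemma nonempty_isColimit_sections (S : CompHaus.{u}ᵒᵖ) :
    Nonempty (IsColimit ((sheafToPresheaf (coherentTopology CompHaus.{u}) CommRingCat.{u + 1} ⋙
      (evaluation _ _).obj S).mapCocone (colimit.cocone D))) := by
  have := preservesColimit_sheafToPresheaf hj₀ D φ sq hφ hD
  exact ⟨isColimitOfPreserves _ (colimit.isColimit D)⟩

include sq hφ hD in
lemma isPushout_constMap_colimit (S : CompHaus.{u}ᵒᵖ) :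
    IsPushout (constMap L.obj S) ((φ ≫ colimit.ι D j₀).hom.app (op point))
      ((φ ≫ colimit.ι D j₀).hom.app S) (constMap (colimit D).obj S) := by
  obtain ⟨h₁⟩ := nonempty_isColimit_sections hj₀ D φ sq hφ hD (op point)
  obtain ⟨h₂⟩ := nonempty_isColimit_sections hj₀ D φ sq hφ hD S
  let α : D ⋙ (sheafToPresheaf (coherentTopology CompHaus.{u}) CommRingCat.{u + 1} ⋙
      (evaluation _ _).obj (op point)) ⟶ D ⋙ (sheafToPresheaf _ _ ⋙ (evaluation _ _).obj S) :=
    { app := fun j => constMap (D.obj j).obj S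
      naturality := fun i j f => ((D.map f).hom.naturality _).symm }
  exact isPushout_colimit hj₀ α h₁ h₂ (constMap (colimit D).obj S)
    (fun j => ((colimit.ι D j).hom.naturality _).symm) (constMap L.obj S)
    (φ.hom.app (op point)) (φ.hom.app S) (sq S)

include sq hφ hD in
lemma flat_ι_colimit (j : J) : ((colimit.ι D j).hom.app (op point)).hom.Flat := by
  obtain ⟨h₁⟩ := nonempty_isColimit_sections hj₀ D φ sq hφ hD (op point)
  exact flat_ι_of_isColimit _ h₁ (fun f => hD f) j

-- A finite subset of the underlying ring of the colimit comes from some stage `j`, over which that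
-- ring is flat. It therefore suffices to treat the pushouts of `R` with the rings `D_j(*)`.
include sq hφ hD in
lemma hasFiniteFreeResolutions_of_isPushout_colimit {R X : CommRingCat.{u + 1}}
    {f : L.underlying ⟶ R} {i : R ⟶ X} {k : (colimit D).underlying ⟶ X}
    (h : IsPushout f ((φ ≫ colimit.ι D j₀).hom.app (op point)) i k)
    (hP : ∀ j, ∃ (X' : CommRingCat.{u + 1}) (i' : R ⟶ X') (k' : (D.obj j).underlying ⟶ X'),
      IsPushout f ((φ ≫ D.map (hj₀.to j)).hom.app (op point)) i' k' ∧
        HasFiniteFreeResolutions X') : HasFiniteFreeResolutions X := by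
  refine hasFiniteFreeResolutions_of_isPushout h fun s => ?_
  obtain ⟨h₁⟩ := nonempty_isColimit_sections hj₀ D φ sq hφ hD (op point)
  obtain ⟨j, -, y, hy⟩ := exists_lift_of_isColimit _ h₁ j₀ s id
  refine ⟨_, (φ ≫ D.map (hj₀.to j)).hom.app (op point), (colimit.ι D j).hom.app (op point), ?_,
    flat_ι_colimit hj₀ D φ sq hφ hD j, fun x hx => ⟨y x, hy x hx⟩, hP j⟩
  rw [← NatTrans.comp_app, ← ObjectProperty.FullSubcategory.comp_hom, Category.assoc, colimit.w]

include sq hφ hD in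
lemma flat_toColimit : ((φ ≫ colimit.ι D j₀).hom.app (op point)).hom.Flat :=
  hφ.comp (flat_ι_colimit hj₀ D φ sq hφ hD j₀)

include sq hφ hD in
theorem isFlatRegular_colimit (hL : ∀ S : CompHaus.{u}, (L.toSections S).Flat)
    (hP : ∀ j, HasFiniteFreeResolutions (D.obj j).underlying) : (colimit D).IsFlatRegular :=
  isFlatRegular_of_isPushout _ (isPushout_constMap_colimit hj₀ D φ sq hφ hD) hL
    -- The underlying ring is viewed as the pushout along the identity of `L(*)`.
    (hasFiniteFreeResolutions_of_isPushout_colimit hj₀ D φ sq hφ hD (.of_id_fst)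
      fun j => ⟨_, _, _, .of_id_fst, hP j⟩)

include sq hφ hD in
theorem isFlatRegular_pushout_colimit {R : CondensedCommRing.{u}} (f : L ⟶ R)
    (hR : ∀ S : CompHaus.{u}, (R.toSections S).Flat)
    (hP : ∀ j, ∃ (X' : CommRingCat.{u + 1}) (i' : R.underlying ⟶ X')
      (k' : (D.obj j).underlying ⟶ X'), IsPushout (f.hom.app (op point))
        ((φ ≫ D.map (hj₀.to j)).hom.app (op point)) i' k' ∧ HasFiniteFreeResolutions X') :
    (pushout f (φ ≫ colimit.ι D j₀)).IsFlatRegular :=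
  isFlatRegular_pushout f _ (flat_toColimit hj₀ D φ sq hφ hD)
    (isPushout_constMap_colimit hj₀ D φ sq hφ hD) hR fun _ _ _ h =>
      hasFiniteFreeResolutions_of_isPushout_colimit hj₀ D φ sq hφ hD h hP

end colimit

end CondensedCommRing

/-! ### Rings of integers of finite extensions of `ℚ_ℓ`. -/

section padic
variable {ℓ : ℕ} [hp : Fact ℓ.Prime]

namespace FinExt

variable (E : FinExt ℓ)

instance : FiniteDimensional ℚ_[ℓ] E.1 := E.2

/-- The norm is the spectral norm, which is at most one exactly when the minimal polynomial over
`ℚ_ℓ` has coefficients in `ℤ_ℓ`. Since `ℤ_ℓ` is integrally closed, this is integrality. -/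
lemma isIntegral_iff_norm_le_one (x : PadicAlgCl ℓ) : IsIntegral ℤ_[ℓ] x ↔ ‖x‖ ≤ 1 := by
  have hx : IsIntegral ℚ_[ℓ] x := Algebra.IsIntegral.isIntegral x
  rw [← PadicAlgCl.spectralNorm_eq, spectralNorm, spectralValue_le_one_iff (minpoly.monic hx)]
  refine ⟨fun h n => ?_, fun h => ?_⟩
  · rw [minpoly.isIntegrallyClosed_eq_field_fractions' ℚ_[ℓ] h, Polynomial.coeff_map]
    exact ((minpoly ℤ_[ℓ] x).coeff n).2
  · have hl : minpoly ℚ_[ℓ] x ∈ Polynomial.lifts (algebraMap ℤ_[ℓ] ℚ_[ℓ]) :=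
      (Polynomial.lifts_iff_coeff_lifts _).2 fun n => ⟨⟨_, h n⟩, rfl⟩
    obtain ⟨q, hq, -, hq'⟩ := Polynomial.lifts_and_natDegree_eq_and_monic hl (minpoly.monic hx)
    refine ⟨q, hq', ?_⟩
    rw [IsScalarTower.algebraMap_eq ℤ_[ℓ] ℚ_[ℓ], ← Polynomial.eval₂_map, hq]
    exact minpoly.aeval _ x

lemma mem_integers_iff (x : E.1) : x ∈ E.integers ↔ ‖(x : PadicAlgCl ℓ)‖ ≤ 1 := by
  rw [← isIntegral_iff_norm_le_one]
  exact (isIntegral_algHom_iff (E.1.val.restrictScalars ℤ_[ℓ]) Subtype.val_injective).symm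

/-- Of two elements, the one of larger norm divides the other. Together with noetherianity this
makes the ring of integers principal. -/
instance : ValuationRing E.integers where
  cond' a b := by
    by_cases ha : a = 0
    · exact ⟨0, .inr (by rw [ha, mul_zero])⟩
    by_cases hb : b = 0
    · exact ⟨0, .inl (by rw [hb, mul_zero])⟩
    have ha' : (a : E.1) ≠ 0 := fun h => ha (Subtype.ext h)
    have hb' : (b : E.1) ≠ 0 := fun h => hb (Subtype.ext h)
    have key : ∀ x y : E.1, x ≠ 0 → ‖(y : PadicAlgCl ℓ)‖ ≤ ‖(x : PadicAlgCl ℓ)‖ →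
        x⁻¹ * y ∈ E.integers := fun x y hx h => by
      rw [mem_integers_iff]
      push_cast
      rw [norm_mul, norm_inv]
      exact (inv_mul_le_one₀ (norm_pos_iff.2 fun h => hx (Subtype.ext h))).2 h
    obtain h | h := le_total ‖((b : E.1) : PadicAlgCl ℓ)‖ ‖((a : E.1) : PadicAlgCl ℓ)‖
    · exact ⟨⟨_, key _ _ ha' h⟩, .inl (Subtype.ext (mul_inv_cancel_left₀ ha' _))⟩
    · exact ⟨⟨_, key _ _ hb' h⟩, .inr (Subtype.ext (mul_inv_cancel_left₀ hb' _))⟩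

instance : IsPrincipalIdealRing E.integers := by
  have := integralClosure.isNoetherianRing (A := ℤ_[ℓ]) (K := ℚ_[ℓ]) (L := E.1)
  infer_instance

instance : Module.IsTorsionFree ℤ_[ℓ] E.1 := .trans_faithfulSMul ℤ_[ℓ] ℚ_[ℓ] E.1

instance : Module.Free ℤ_[ℓ] E.integers :=
  IsIntegralClosure.module_free ℤ_[ℓ] ℚ_[ℓ] E.1 E.integers

instance : Module.Finite ℤ_[ℓ] E.integers :=
  IsIntegralClosure.finite ℤ_[ℓ] ℚ_[ℓ] E.1 E.integers

lemma flat_incl {E F : FinExt ℓ} (h : E ≤ F) : (incl h).Flat := by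
  let _ := (incl h).toAlgebra
  have : Module.Free E.1 F.1 := Module.Free.of_divisionRing E.1 F.1
  exact (Module.Flat.of_free : Module.Flat E.1 F.1)

lemma flat_inclIntegers {E F : FinExt ℓ} (h : E ≤ F) : (inclIntegers h).Flat := by
  let _ := (inclIntegers h).toAlgebra
  have : Module.IsTorsionFree E.integers F.integers :=
    Module.isTorsionFree_iff_algebraMap_injective.2 fun x y hxy =>
      Subtype.ext (Subtype.ext congr((($hxy : F.1) : PadicAlgCl ℓ)))
  exact (inferInstance : Module.Flat E.integers F.integers)

/-- A basis over `ℤ_ℓ` is also a basis of `E` over `ℚ_ℓ`, and linear forms on a finite-dimensional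
space over `ℚ_ℓ` are continuous. -/
lemma exists_basis_integers : ∃ (n : ℕ) (b : Module.Basis (Fin n) ℤ_[ℓ] E.integers),
    ∀ i, Continuous fun x => b.repr x i := by
  let b := Module.finBasis ℤ_[ℓ] E.integers
  refine ⟨_, b, fun i => ?_⟩
  have := IsIntegralClosure.isLocalization ℤ_[ℓ] ℚ_[ℓ] E.1 E.integers
  let bE := b.localizationLocalization ℚ_[ℓ] (nonZeroDivisors ℤ_[ℓ]) E.1
  have h : Continuous fun x => bE.repr x i :=
    LinearMap.continuous_of_finiteDimensional (bE.coord i)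
  refine Topology.IsInducing.subtypeVal.continuous_iff.2
    ((h.comp continuous_subtype_val).congr fun x => ?_)
  exact b.localizationLocalization_repr_algebraMap ℚ_[ℓ] (nonZeroDivisors ℤ_[ℓ]) E.1 x i

end FinExt

end padic

/-! ### Bases of finite extensions with continuous coordinates. -/

section ULift

variable {A B : Type*} [CommRing A] [CommRing B] [Algebra A B] {ι : Type*}
  {f : ULift.{w} A →+* ULift.{w'} B} (hf : ∀ a, f ⟨a⟩ = ⟨algebraMap A B a⟩) (b : Module.Basis ι A B)

include hf in
lemma sum_mul_up_basis (c : ι →₀ ULift.{w} A) : (c.sum fun i a => f a * ULift.up (b i)) =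
    ⟨b.repr.symm (c.mapRange ULift.down rfl)⟩ := by
  have h1 := map_finsuppSum (ULift.ringEquiv : ULift.{w'} B ≃+* B) c
    fun i a => f a * ULift.up (b i)
  refine ULift.down_injective (h1.trans ?_)
  rw [b.repr_symm_apply, Finsupp.linearCombination_apply,
    Finsupp.sum_mapRange_index fun i => zero_smul A (b i)]
  refine Finset.sum_congr rfl fun i _ => ?_
  refine Eq.trans ?_ (Algebra.smul_def (c i).down (b i)).symm
  exact congrArg (· * b i) (congrArg ULift.down (hf (c i).down))

include hf in
lemma sum_mul_up_basis_repr (x : ULift.{w'} B) :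
    (((b.repr x.down).mapRange (ULift.up.{w} (α := A)) rfl).sum fun i a => f a * ULift.up (b i)) =
      x := by
  rw [sum_mul_up_basis hf]
  refine ULift.down_injective ((congrArg b.repr.symm (a₂ := b.repr x.down) ?_).trans
    (b.repr.symm_apply_apply _))
  ext i
  rfl

include hf in
lemma RingHom.IsBasis.ulift : f.IsBasis fun i => ULift.up (b i) := by
  refine ⟨fun c d h => ?_, fun x => ⟨_, sum_mul_up_basis_repr hf b x⟩⟩
  have h1 := ((sum_mul_up_basis hf b c).symm.trans h).trans (sum_mul_up_basis hf b d)
  have h2 := b.repr.symm.injective (congrArg ULift.down h1)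
  ext i
  exact DFunLike.congr_fun h2 i

lemma RingHom.IsBasis.ulift_coord (x : ULift.{w'} B) (i : ι) :
    (RingHom.IsBasis.ulift hf b).coord x i = ⟨b.repr x.down i⟩ :=
  DFunLike.congr_fun ((Equiv.symm_apply_eq (Equiv.ofBijective _ (RingHom.IsBasis.ulift hf b))).2
    (sum_mul_up_basis_repr hf b x).symm) i

lemma RingHom.IsBasis.continuous_ulift_coord [TopologicalSpace A] [TopologicalSpace B] (i : ι)
    (h : Continuous fun x => b.repr x i) :
    Continuous fun x => (RingHom.IsBasis.ulift hf b).coord x i := by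
  exact (continuous_uliftUp.comp (h.comp continuous_uliftDown)).congr fun x =>
    (RingHom.IsBasis.ulift_coord hf b x i).symm

end ULift

section padic

open CondensedCommRing

variable (ℓ : ℕ) [hp : Fact ℓ.Prime]

instance : IsFiltered (FinExt ℓ) :=
  have : IsDirectedOrder (FinExt ℓ) := ⟨fun E F =>
    ⟨⟨E.1 ⊔ F.1, inferInstance⟩, le_sup_left (a := E.1), le_sup_right (a := E.1)⟩⟩
  have : Nonempty (FinExt ℓ) := ⟨FinExt.base ℓ⟩
  inferInstance

/-- `ℚ_ℓ` is the smallest finite extension of `ℚ_ℓ`. -/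
def FinExt.isInitialBase : IsInitial (FinExt.base ℓ) :=
  IsInitial.ofUniqueHom (fun E => homOfLE (bot_le (a := E.1))) fun _ _ => Subsingleton.elim _ _

/-- The inclusion of `ℚ_ℓ` in a finite extension. -/
abbrev topQlTo (E : FinExt ℓ) : topQl.{u} ℓ ⟶ (finExtDiagram.{u} ℓ).obj E :=
  qlToBase ℓ ≫ (finExtDiagram ℓ).map ((FinExt.isInitialBase ℓ).to E)

/-- The inclusion of `ℤ_ℓ` in the ring of integers of a finite extension of `ℚ_ℓ`. -/
abbrev topZlTo (E : FinExt ℓ) : topZl.{u} ℓ ⟶ (integersDiagram.{u} ℓ).obj E :=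
  zlToBase ℓ ≫ (integersDiagram ℓ).map ((FinExt.isInitialBase ℓ).to E)

lemma exists_isBasis_topQlTo (E : FinExt ℓ) :
    ∃ (n : ℕ) (b : Fin n → (finExtDiagram.{u} ℓ).obj E) (hb : (topQlTo ℓ E).1.IsBasis b),
      ∀ i, Continuous fun x => hb.coord x i := by
  let b := Module.finBasis ℚ_[ℓ] E.1
  have hf : ∀ a, (topQlTo.{u} ℓ E).1 ⟨a⟩ = ⟨algebraMap ℚ_[ℓ] E.1 a⟩ := fun a => rfl
  exact ⟨_, _, .ulift hf b, fun i => RingHom.IsBasis.continuous_ulift_coord hf b i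
    (LinearMap.continuous_of_finiteDimensional (b.coord i))⟩

lemma exists_isBasis_topZlTo (E : FinExt ℓ) :
    ∃ (n : ℕ) (b : Fin n → (integersDiagram.{u} ℓ).obj E) (hb : (topZlTo ℓ E).1.IsBasis b),
      ∀ i, Continuous fun x => hb.coord x i := by
  obtain ⟨n, b, hb⟩ := E.exists_basis_integers
  have hf : ∀ a, (topZlTo.{u} ℓ E).1 ⟨a⟩ = ⟨algebraMap ℤ_[ℓ] E.integers a⟩ := fun a => rfl
  exact ⟨_, _, .ulift hf b, fun i => RingHom.IsBasis.continuous_ulift_coord hf b i (hb i)⟩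

end padic

/-! ### Base change of power series rings to finite free extensions. -/

namespace CondensedCommRing

section powerSeries

variable {A : TopCommRingCat.{u + 1}} {R : CondensedCommRing.{u}} (f : ofTop.{u}.obj A ⟶ R) {r : ℕ}
  (i : R ≅ ofTop.{u}.obj (topMvPowerSeries r A)) (hi : f ≫ i.hom = ofTop.{u}.map (topMvPowerSeriesC r A))

-- The pushout is `B⟦x⟧`, which has finite free resolutions because `B` is a principal ideal domain.
include hi in
lemma exists_isPushout_of_iso_topMvPowerSeries {B : TopCommRingCat.{u + 1}} [IsDomain B]
    [IsPrincipalIdealRing B] (φ : A ⟶ B) {ι : Type*} [Finite ι] {b : ι → B} (hb : φ.1.IsBasis b)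
    (hcont : ∀ j, Continuous fun x => hb.coord x j) :
    ∃ (X' : CommRingCat.{u + 1}) (i' : R.underlying ⟶ X')
      (k' : (ofTop.{u}.obj B).underlying ⟶ X'), IsPushout (f.hom.app (op point))
        ((ofTop.{u}.map φ).hom.app (op point)) i' k' ∧ HasFiniteFreeResolutions X' := by
  refine ⟨_, i.hom.hom.app (op point) ≫ (ofTop.{u}.map (topMvPowerSeriesMap r φ)).hom.app (op point),
    (ofTop.{u}.map (topMvPowerSeriesC r B)).hom.app (op point),
    (isPushout_topMvPowerSeries r φ hb hcont (op point)).of_iso (Iso.refl _)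
    (((sheafToPresheaf _ _ ⋙ (evaluation _ _).obj (op point)).mapIso i).symm) (Iso.refl _)
    (Iso.refl _) ?_ ?_ ?_ ?_, (isFlatRegular_topMvPowerSeries r B).1⟩
  · rw [← hi]
    simp
  · simp
  · rw [Iso.refl_hom, Category.comp_id]
    exact congr(($(i.inv_hom_id_assoc (ofTop.map (topMvPowerSeriesMap r φ)))).hom.app _).symm
  · simp

end powerSeries

end CondensedCommRing

open CondensedCommRing

/-! ### The `ℓ`-adic coefficient rings and the passage to algebraic closures. -/

section padic

variable (ℓ : ℕ) [hp : Fact ℓ.Prime]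

instance (E : FinExt ℓ) : IsDomain ((finExtDiagram.{u} ℓ).obj E) :=
  inferInstanceAs (IsDomain (ULift.{u + 1} E.1))

instance (E : FinExt ℓ) : IsPrincipalIdealRing ((finExtDiagram.{u} ℓ).obj E) :=
  inferInstanceAs (IsPrincipalIdealRing (ULift.{u + 1} E.1))

instance (E : FinExt ℓ) : IsDomain ((integersDiagram.{u} ℓ).obj E) :=
  (ULift.ringEquiv : ULift.{u + 1} E.integers ≃+* E.integers).toMulEquiv.isDomain

instance (E : FinExt ℓ) : IsPrincipalIdealRing ((integersDiagram.{u} ℓ).obj E) :=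
  IsPrincipalIdealRing.of_surjective
    (ULift.ringEquiv.symm : E.integers ≃+* ULift.{u + 1} E.integers)
    (ULift.ringEquiv.symm : E.integers ≃+* ULift.{u + 1} E.integers).surjective

instance : IsDomain (topZl.{u} ℓ) :=
  (ULift.ringEquiv : ULift.{u + 1} ℤ_[ℓ] ≃+* ℤ_[ℓ]).toMulEquiv.isDomain

instance : IsPrincipalIdealRing (topZl.{u} ℓ) :=
  IsPrincipalIdealRing.of_surjective
    (ULift.ringEquiv.symm : ℤ_[ℓ] ≃+* ULift.{u + 1} ℤ_[ℓ])
    (ULift.ringEquiv.symm : ℤ_[ℓ] ≃+* ULift.{u + 1} ℤ_[ℓ]).surjective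

instance : IsDomain (topQl.{u} ℓ) := inferInstanceAs (IsDomain (ULift.{u + 1} ℚ_[ℓ]))

instance : IsPrincipalIdealRing (topQl.{u} ℓ) :=
  inferInstanceAs (IsPrincipalIdealRing (ULift.{u + 1} ℚ_[ℓ]))

lemma flat_uliftRingHom {A B : Type*} [CommRing A] [CommRing B] {f : A →+* B} (hf : f.Flat) :
    (uliftRingHom.{w, w'} f).Flat :=
  RingHom.Flat.comp
    (RingHom.Flat.comp (.of_bijective (ULift.ringEquiv : ULift.{w} A ≃+* A).bijective) hf)
    (.of_bijective (ULift.ringEquiv.symm : B ≃+* ULift.{w'} B).bijective)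

lemma CondensedCommRing.flat_ofTop_map_point {A B : TopCommRingCat.{u + 1}} (φ : A ⟶ B)
    (h : φ.1.Flat) : ((ofTop.{u}.map φ).hom.app (op point)).hom.Flat := by
  have : ((ofTop.{u}.map φ).hom.app (op point)).hom =
      ((underlyingOfTop B).symm.toRingHom.comp φ.1).comp (underlyingOfTop A).toRingHom := by
    ext x
    exact ContinuousMap.ext fun s => rfl
  rw [this]
  exact (RingHom.Flat.of_bijective (underlyingOfTop A).bijective).comp
    (h.comp (RingHom.Flat.of_bijective (underlyingOfTop B).symm.bijective))

lemma isPushout_topQlTo (S : CompHaus.{u}ᵒᵖ) (E : FinExt ℓ) :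
    IsPushout (constMap (ofTop.{u}.obj (topQl ℓ)).obj S)
      ((ofTop.{u}.map (topQlTo ℓ E)).hom.app (op point)) ((ofTop.{u}.map (topQlTo ℓ E)).hom.app S)
      (constMap (ofTop.{u}.obj ((finExtDiagram ℓ).obj E)).obj S) := by
  obtain ⟨n, b, hb, hc⟩ := exists_isBasis_topQlTo.{u} ℓ E
  exact isPushout_ofTop _ (isBasis_compHom_of_finite _ hb hc) S

lemma isPushout_topZlTo (S : CompHaus.{u}ᵒᵖ) (E : FinExt ℓ) :
    IsPushout (constMap (ofTop.{u}.obj (topZl ℓ)).obj S)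
      ((ofTop.{u}.map (topZlTo ℓ E)).hom.app (op point)) ((ofTop.{u}.map (topZlTo ℓ E)).hom.app S)
      (constMap (ofTop.{u}.obj ((integersDiagram ℓ).obj E)).obj S) := by
  obtain ⟨n, b, hb, hc⟩ := exists_isBasis_topZlTo.{u} ℓ E
  exact isPushout_ofTop _ (isBasis_compHom_of_finite _ hb hc) S

lemma flat_qlToBase : ((ofTop.{u}.map (qlToBase ℓ)).hom.app (op point)).hom.Flat := by
  refine flat_ofTop_map_point _ (flat_uliftRingHom ?_)
  have : Module.Free ℚ_[ℓ] (FinExt.base ℓ).1 := Module.Free.of_divisionRing _ _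
  exact (RingHom.flat_algebraMap_iff).2 Module.Flat.of_free

lemma flat_zlToBase : ((ofTop.{u}.map (zlToBase ℓ)).hom.app (op point)).hom.Flat := by
  refine flat_ofTop_map_point _ (flat_uliftRingHom ?_)
  exact (RingHom.flat_algebraMap_iff).2 Module.Flat.of_free

lemma flat_finExtDiagram_map {E F : FinExt ℓ} (h : E ⟶ F) :
    ((ofTop.{u}.map ((finExtDiagram ℓ).map h)).hom.app (op point)).hom.Flat :=
  flat_ofTop_map_point _ (flat_uliftRingHom (FinExt.flat_incl h.le))

lemma flat_integersDiagram_map {E F : FinExt ℓ} (h : E ⟶ F) :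
    ((ofTop.{u}.map ((integersDiagram ℓ).map h)).hom.app (op point)).hom.Flat :=
  flat_ofTop_map_point _ (flat_uliftRingHom (FinExt.flat_inclIntegers h.le))

theorem isFlatRegular_condensedQlBar : (condensedQlBar.{u} ℓ).IsFlatRegular :=
  isFlatRegular_colimit (FinExt.isInitialBase ℓ) (finExtDiagram.{u} ℓ ⋙ ofTop)
    (ofTop.map (qlToBase ℓ))
    (fun S E => by
      have h := isPushout_topQlTo.{u} ℓ S E
      rw [Functor.map_comp] at h
      exact h) (flat_qlToBase ℓ) (fun h => flat_finExtDiagram_map ℓ h)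
    (isFlatRegular_ofTop_of_isPrincipalIdealRing _).2
    fun E => (isFlatRegular_ofTop_of_isPrincipalIdealRing ((finExtDiagram.{u} ℓ).obj E)).1

theorem isFlatRegular_condensedZlBar : (condensedZlBar.{u} ℓ).IsFlatRegular :=
  isFlatRegular_colimit (FinExt.isInitialBase ℓ) (integersDiagram.{u} ℓ ⋙ ofTop)
    (ofTop.map (zlToBase ℓ))
    (fun S E => by
      have h := isPushout_topZlTo.{u} ℓ S E
      rw [Functor.map_comp] at h
      exact h) (flat_zlToBase ℓ) (fun h => flat_integersDiagram_map ℓ h)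
    (isFlatRegular_ofTop_of_isPrincipalIdealRing _).2
    fun E => (isFlatRegular_ofTop_of_isPrincipalIdealRing ((integersDiagram.{u} ℓ).obj E)).1

variable {R : CondensedCommRing.{u}} {r : ℕ}

theorem isFlatRegular_pushout_qlToQlBar (f : ofTop.{u}.obj (topQl ℓ) ⟶ R)
    (i : R ≅ ofTop.{u}.obj (topMvPowerSeries r (topQl ℓ)))
    (hi : f ≫ i.hom = ofTop.{u}.map (topMvPowerSeriesC r (topQl ℓ))) :
    (pushout f (qlToQlBar ℓ)).IsFlatRegular :=
  isFlatRegular_pushout_colimit (FinExt.isInitialBase ℓ) (finExtDiagram.{u} ℓ ⋙ ofTop)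
    (ofTop.map (qlToBase ℓ))
    (fun S E => by
      have h := isPushout_topQlTo.{u} ℓ S E
      rw [Functor.map_comp] at h
      exact h) (flat_qlToBase ℓ) (fun h => flat_finExtDiagram_map ℓ h) f
    ((isFlatRegular_topMvPowerSeries r (topQl ℓ)).of_iso i.symm).2
    fun E => by
      obtain ⟨n, b, hb, hc⟩ := exists_isBasis_topQlTo.{u} ℓ E
      have h := exists_isPushout_of_iso_topMvPowerSeries f i hi _ hb hc
      rw [Functor.map_comp] at h
      exact h

theorem isFlatRegular_pushout_zlToZlBar (f : ofTop.{u}.obj (topZl ℓ) ⟶ R)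
    (i : R ≅ ofTop.{u}.obj (topMvPowerSeries r (topZl ℓ)))
    (hi : f ≫ i.hom = ofTop.{u}.map (topMvPowerSeriesC r (topZl ℓ))) :
    (pushout f (zlToZlBar ℓ)).IsFlatRegular :=
  isFlatRegular_pushout_colimit (FinExt.isInitialBase ℓ) (integersDiagram.{u} ℓ ⋙ ofTop)
    (ofTop.map (zlToBase ℓ))
    (fun S E => by
      have h := isPushout_topZlTo.{u} ℓ S E
      rw [Functor.map_comp] at h
      exact h) (flat_zlToBase ℓ) (fun h => flat_integersDiagram_map ℓ h) f
    ((isFlatRegular_topMvPowerSeries r (topZl ℓ)).of_iso i.symm).2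
    fun E => by
      obtain ⟨n, b, hb, hc⟩ := exists_isBasis_topZlTo.{u} ℓ E
      have h := exists_isPushout_of_iso_topMvPowerSeries f i hi _ hb hc
      rw [Functor.map_comp] at h
      exact h

end padic

/-! ### The field `F_ℓ` and its algebraic closure. -/

section finiteField

variable (ℓ : ℕ) [hp : Fact ℓ.Prime]

instance : DiscreteTopology (topFlBar.{u} ℓ) := ⟨rfl⟩

instance : DiscreteTopology (topFl.{u} ℓ) :=
  (Homeomorph.ulift (X := ZMod ℓ)).symm.discreteTopology

instance : IsDomain (topFl.{u} ℓ) := inferInstanceAs (IsDomain (ULift.{u + 1} (ZMod ℓ)))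

instance : IsPrincipalIdealRing (topFl.{u} ℓ) :=
  inferInstanceAs (IsPrincipalIdealRing (ULift.{u + 1} (ZMod ℓ)))

instance : IsDomain (topFlBar.{u} ℓ) :=
  inferInstanceAs (IsDomain (ULift.{u + 1} (AlgebraicClosure (ZMod ℓ))))

instance : IsPrincipalIdealRing (topFlBar.{u} ℓ) :=
  inferInstanceAs (IsPrincipalIdealRing (ULift.{u + 1} (AlgebraicClosure (ZMod ℓ))))

/-- A subfield of the algebraic closure of `F_ℓ`, with the discrete topology. -/
def topSubfield (E : IntermediateField (ZMod ℓ) (AlgebraicClosure (ZMod ℓ))) :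
    TopCommRingCat.{u + 1} :=
  letI : TopologicalSpace (ULift.{u + 1} E) := ⊥
  haveI : DiscreteTopology (ULift.{u + 1} E) := ⟨rfl⟩
  .of (ULift.{u + 1} E)

variable {ℓ} (E : IntermediateField (ZMod ℓ) (AlgebraicClosure (ZMod ℓ)))

instance : DiscreteTopology (topSubfield.{u} ℓ E) := ⟨rfl⟩

instance : IsDomain (topSubfield.{u} ℓ E) := inferInstanceAs (IsDomain (ULift.{u + 1} E))

instance : IsPrincipalIdealRing (topSubfield.{u} ℓ E) :=
  inferInstanceAs (IsPrincipalIdealRing (ULift.{u + 1} E))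

/-- The inclusion of `F_ℓ` in a subfield of its algebraic closure. -/
def topFlToSubfield : topFl.{u} ℓ ⟶ topSubfield.{u} ℓ E :=
  ⟨uliftRingHom (algebraMap (ZMod ℓ) E), continuous_of_discreteTopology⟩

/-- The inclusion of a subfield of the algebraic closure of `F_ℓ`. -/
def topSubfieldToFlBar : topSubfield.{u} ℓ E ⟶ topFlBar.{u} ℓ :=
  ⟨uliftRingHom (algebraMap E (AlgebraicClosure (ZMod ℓ))), continuous_of_discreteTopology⟩

variable (ℓ) in
lemma isPushout_topFlToFlBar (S : CompHaus.{u}ᵒᵖ) :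
    IsPushout (constMap (ofTop.{u}.obj (topFl ℓ)).obj S)
      ((ofTop.{u}.map (topFlToFlBar ℓ)).hom.app (op point))
      ((ofTop.{u}.map (topFlToFlBar ℓ)).hom.app S)
      (constMap (ofTop.{u}.obj (topFlBar ℓ)).obj S) := by
  let b := Module.Basis.ofVectorSpace (ZMod ℓ) (AlgebraicClosure (ZMod ℓ))
  have hf : ∀ a, (topFlToFlBar.{u} ℓ).1 ⟨a⟩ = ⟨algebraMap _ _ a⟩ := fun a => rfl
  exact isPushout_ofTop _ (isBasis_compHom_of_discrete _ (.ulift hf b)) S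

lemma flat_algebraMap_of_field {K L : Type*} [Field K] [Field L] [Algebra K L] :
    (algebraMap K L).Flat := by
  have : Module.Free K L := Module.Free.of_divisionRing K L
  exact (RingHom.flat_algebraMap_iff).2 Module.Flat.of_free

-- The closure of `F_ℓ` is a single discrete ring here, so no colimit of condensed rings is needed:
-- an infinite basis gives the sectionwise pushouts, and finite subextensions enter only through the
-- underlying ring.
variable (ℓ) in
theorem isFlatRegular_pushout_topFlToFlBar {R : CondensedCommRing.{u}} {r : ℕ}
    (f : ofTop.{u}.obj (topFl ℓ) ⟶ R)
    (i : R ≅ ofTop.{u}.obj (topMvPowerSeries r (topFl ℓ)))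
    (hi : f ≫ i.hom = ofTop.{u}.map (topMvPowerSeriesC r (topFl ℓ))) :
    (pushout f (ofTop.{u}.map (topFlToFlBar ℓ))).IsFlatRegular := by
  classical
  refine isFlatRegular_pushout f _ (flat_ofTop_map_point _ (flat_uliftRingHom
    flat_algebraMap_of_field)) (isPushout_topFlToFlBar ℓ)
    ((isFlatRegular_topMvPowerSeries r (topFl ℓ)).of_iso i.symm).2 fun X i' j' h =>
    hasFiniteFreeResolutions_of_isPushout h fun s => ?_
  let val (x : (ofTop.{u}.obj (topFlBar ℓ)).underlying) : AlgebraicClosure (ZMod ℓ) :=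
    ULift.down (α := AlgebraicClosure (ZMod ℓ))
      (DFunLike.coe (F := C(point.{u}, topFlBar.{u} ℓ)) x PUnit.unit)
  -- The given finite set of elements generates a finite subextension `E`, over which the closure is
  -- flat and for which the pushout is `E⟦x⟧`.
  let E := IntermediateField.adjoin (ZMod ℓ) (val '' s)
  have : FiniteDimensional (ZMod ℓ) E := by
    have : Finite (val '' s) := (s.finite_toSet.image val).to_subtype
    exact IntermediateField.finiteDimensional_adjoin fun x _ => Algebra.IsIntegral.isIntegral x
  let b := Module.finBasis (ZMod ℓ) E
  have hf : ∀ a, (topFlToSubfield.{u} E).1 ⟨a⟩ = ⟨algebraMap _ _ a⟩ := fun a => rfl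
  refine ⟨(ofTop.{u}.obj (topSubfield ℓ E)).underlying,
    (ofTop.{u}.map (topFlToSubfield E)).hom.app (op point),
    (ofTop.{u}.map (topSubfieldToFlBar E)).hom.app (op point), rfl,
    flat_ofTop_map_point _ (flat_uliftRingHom flat_algebraMap_of_field), fun x hx => ?_,
    exists_isPushout_of_iso_topMvPowerSeries f i hi _ (.ulift hf b)
      fun j => continuous_of_discreteTopology⟩
  refine ⟨(ContinuousMap.const _ ⟨⟨val x, IntermediateField.subset_adjoin _ _ ⟨x, hx, rfl⟩⟩⟩ :
    C(point.{u}, topSubfield.{u} ℓ E)), ContinuousMap.ext fun t => rfl⟩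

end finiteField

open CondensedCommRing

/-! ### The rings `R_{T,Λ}` for the basic coefficients as power series rings. -/

section torusRing

/-- A ring isomorphism which is a homeomorphism is an isomorphism of topological rings. -/
def TopCommRingCat.isoMk {A B : TopCommRingCat.{w}} (e : A ≃+* B) (he : Continuous e)
    (he' : Continuous e.symm) : A ≅ B where
  hom := ⟨e.toRingHom, he⟩
  inv := ⟨e.symm.toRingHom, he'⟩
  hom_inv_id := Subtype.ext (RingHom.ext e.symm_apply_apply)
  inv_hom_id := Subtype.ext (RingHom.ext e.apply_symm_apply)

open scoped MonObj MvPowerSeries.WithPiTopology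

variable {k : Type u} [Field k] [IsAlgClosed k] (T : Over (Spec (.of k))) [CommGrpObj T] [IsTorus T]
  (ℓ : ℕ) [hp : Fact ℓ.Prime] (hℓ : (ℓ : k) ≠ 0)

include hℓ

lemma exists_iso_topTorusRingFl : ∃ (r : ℕ)
    (i : ofTop.{u}.obj (topTorusRingFl.{u} ℓ T) ≅ ofTop.{u}.obj (topMvPowerSeries r (topFl ℓ))),
    ofTop.{u}.map (torusRingFlConst ℓ T) ≫ i.hom =
      ofTop.{u}.map (topMvPowerSeriesC r (topFl ℓ)) := by
  obtain ⟨r, t, ht⟩ := exists_isTateBasis_kPoints T ℓ hℓ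
  obtain ⟨e, h1, h2, h3, -⟩ := ht.exists_ulift_ringEquiv.{u + 1, u + 1} (A := ZMod ℓ) (by
    rw [ZMod.natCast_self]
    exact IsTopologicallyNilpotent.zero)
  refine ⟨r, ofTop.{u}.mapIso (TopCommRingCat.isoMk (B := topMvPowerSeries r _) e h1 h2), ?_⟩
  rw [Functor.mapIso_hom, ← Functor.map_comp]
  exact congrArg _ (Subtype.ext (RingHom.ext h3))

lemma exists_ringEquiv_topTorusRingZl : ∃ (r : ℕ)
    (e : topTorusRingZl.{u} ℓ T ≃+* MvPowerSeries (Fin r) (topZl.{u} ℓ)),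
    Continuous e ∧ Continuous e.symm ∧
      (∀ a, e ((torusRingZlConst ℓ T).1 a) = MvPowerSeries.C a) ∧
        ∀ x, (torusRingZlAug ℓ T).1 x = MvPowerSeries.constantCoeff (e x) := by
  obtain ⟨r, t, ht⟩ := exists_isTateBasis_kPoints T ℓ hℓ
  have := PadicInt.isLinearTopology ℓ
  exact ⟨r, ht.exists_ulift_ringEquiv (PadicInt.isTopologicallyNilpotent_prime ℓ)⟩

lemma exists_iso_topTorusRingZl : ∃ (r : ℕ)
    (i : ofTop.{u}.obj (topTorusRingZl.{u} ℓ T) ≅ ofTop.{u}.obj (topMvPowerSeries r (topZl ℓ))),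
    ofTop.{u}.map (torusRingZlConst ℓ T) ≫ i.hom =
      ofTop.{u}.map (topMvPowerSeriesC r (topZl ℓ)) := by
  obtain ⟨r, e, h1, h2, h3, -⟩ := exists_ringEquiv_topTorusRingZl T ℓ hℓ
  refine ⟨r, ofTop.{u}.mapIso (TopCommRingCat.isoMk (B := topMvPowerSeries r _) e h1 h2), ?_⟩
  rw [Functor.mapIso_hom, ← Functor.map_comp]
  exact congrArg _ (Subtype.ext (RingHom.ext h3))

lemma exists_iso_torusRingQl : ∃ (r : ℕ)
    (i : torusRingQl.{u} ℓ T ≅ ofTop.{u}.obj (topMvPowerSeries r (topQl ℓ))),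
    torusRingQlConst ℓ T ≫ i.hom = ofTop.{u}.map (topMvPowerSeriesC r (topQl ℓ)) := by
  obtain ⟨r, e, h1, h2, h3, h4⟩ := exists_ringEquiv_topTorusRingZl T ℓ hℓ
  exact ⟨r, exists_iso_adicCompletion_topMvPowerSeries ℓ (torusRingZlAug ℓ T)
    (torusRingZlConst ℓ T) e h1 h2 h4 h3⟩

end torusRing

end

theorem mainTheorem11 (p : ℕ) [Fact p.Prime] {k : Type u} [Field k] [IsAlgClosed k] [CharP k p]
    (T : Over (Spec (.of k))) [CommGrpObj T] [IsTorus T]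
    (ℓ : ℕ) [Fact ℓ.Prime] (hℓ : ℓ ≠ p) (Λ : CoeffKind) :
    (coeffRing.{u} ℓ Λ).IsTAdmissible ∧ (torusRing ℓ T Λ).IsTAdmissible := by
  have h : (ℓ : k) ≠ 0 := fun h => hℓ
    ((Nat.prime_dvd_prime_iff_eq Fact.out Fact.out).1 ((CharP.cast_eq_zero_iff k p ℓ).1 h)).symm
  suffices (coeffRing.{u} ℓ Λ).IsFlatRegular ∧ (torusRing ℓ T Λ).IsFlatRegular from
    ⟨this.1.isTAdmissible, this.2.isTAdmissible⟩
  obtain ⟨r₁, i₁, h₁⟩ := exists_iso_topTorusRingFl T ℓ h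
  obtain ⟨r₂, i₂, h₂⟩ := exists_iso_topTorusRingZl T ℓ h
  obtain ⟨r₃, i₃, h₃⟩ := exists_iso_torusRingQl T ℓ h
  cases Λ
  · exact ⟨CondensedCommRing.isFlatRegular_ofTop_of_isPrincipalIdealRing (topFl ℓ),
      (CondensedCommRing.isFlatRegular_topMvPowerSeries r₁ (topFl ℓ)).of_iso i₁.symm⟩
  · exact ⟨CondensedCommRing.isFlatRegular_ofTop_of_isPrincipalIdealRing (topZl ℓ),
      (CondensedCommRing.isFlatRegular_topMvPowerSeries r₂ (topZl ℓ)).of_iso i₂.symm⟩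
  · exact ⟨CondensedCommRing.isFlatRegular_ofTop_of_isPrincipalIdealRing (topQl ℓ),
      (CondensedCommRing.isFlatRegular_topMvPowerSeries r₃ (topQl ℓ)).of_iso i₃.symm⟩
  · exact ⟨CondensedCommRing.isFlatRegular_ofTop_of_isPrincipalIdealRing (topFlBar ℓ),
      isFlatRegular_pushout_topFlToFlBar ℓ _ i₁ h₁⟩
  · exact ⟨isFlatRegular_condensedZlBar ℓ, isFlatRegular_pushout_zlToZlBar ℓ _ i₂ h₂⟩
  · exact ⟨isFlatRegular_condensedQlBar ℓ, isFlatRegular_pushout_qlToQlBar ℓ _ i₃ h₃⟩
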